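/- **Notation.** For a Polish space $X$ let $\mathcal M(X)$ and $\mathcal P(X)$ be the spaces of finite, respectively probability, Borel measures on $X$, with the Borel $\sigma$-algebra of the weak topology. For $\beta>0$ and $\nu\in\mathcal P(X)$, the Dirichlet--Ferguson measure $\mathcal D_{\beta\nu}$ is the unique Borel probability measure on $\mathcal P(X)$ such that, for every Borel $F\colon\mathcal P(X)\times X\to[0,\infty]$, $$\iint_X F(\eta,x)\,d\eta(x)\,d\mathcal D_{\beta\nu}(\eta)=\iint_0^1\!\!\int_X F\big((1-t)\eta+t\delta_x,x\big)\,d\nu(x)\,\beta(1-t)^{\beta-1}dt\,d\mathcal D_{\beta\nu}(\eta).$$ For $\theta>0$ and $\nu\in\mathcal P(X)$, the multiplicative infinite-dimensional Lebesgue measure $\mathcal L_{\theta,\nu}$ on $\mathcal M(X)$ is the image of $\mathcal D_{\theta\nu}\otimes\lambda_\theta$, $d\lambda_\theta(t)=\frac{t^{\theta-1}}{\Gamma(\theta)}dt$ on $(0,\infty)$, under $(\eta,t)\mapsto t\eta$. Set $\mathcal B_r=\{\mu:\mu X\le r\}$. A measure $\mathcal Q$ on $\mathcal M(X)$ is invariant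 under a Borel bijection $\psi$ of $X$ if it is invariant under $\mu\mapsto\psi_\sharp\mu$. **Statement.** (1) Let $X$ be Polish, $\theta>0$, $\nu\in\mathcal P(X)$, and let $G$ be any group of Borel bi-measurable bijections of $X$. Then $\mathcal L_{\theta,\nu}$ is invariant under every element of $G$ if and only if $\psi_\sharp\nu=\nu$ for every $\psi\in G$. (2) Let $(M,g)$ be a smooth, connected, oriented Riemannian manifold (Hausdorff, second countable, without boundary) with finite volume $\mathrm{vol}_g$, compact if its dimension is $1$. Let $\mathrm{Diff}^+_0(g)$ be the group of orientation-preserving, $\mathrm{vol}_g$-preserving smooth diffeomorphisms of $M$ that are the identity outside a compact set. (a) If $\theta>0$, $\nu\in\mathcal P(M)$ and $\mathcal L_{\theta,\nu}$ is invariant under $\mathrm{Diff}^+_0(g)$, then $\nu$ is the normalized volume, $\mathrm{vol}_g(M)\,\nu=\mathrm{vol}_g$; and then $\theta\nu=\mathrm{vol}_g$ if and only if $\theta=\mathrm{vol}_g(M)$. (b) For a Borel measure $\mathcal Q\geq 0$ on $\mathcal M(M)$ the following are equivalent: (i) $\mathcal Q\mathcal B_0=0$, $\mathcal Q\mathcal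 B_1=1$, for every $a\in C_c^\infty(M)$ the image of $\mathcal Q$ under $\mu\mapsto e^a\mu$ is a constant multiple of $\mathcal Q$, and $\mathcal Q$ is invariant under $\mathrm{Diff}_0^+(g)$; (ii) $\mathcal Q=\Gamma(\theta+1)\,\mathcal L_{\theta,\nu}$ for some $\theta>0$ and $\nu\in\mathcal P(M)$ with $\mathrm{vol}_g(M)\,\nu=\mathrm{vol}_g$. (c) For a Borel measure $\mathcal Q\ge 0$ on $\mathcal M(M)$, condition (i) together with the scale normalization $\mathcal Q\mathcal B_r=r^{\mathrm{vol}_g(M)}$ for all $r\ge 0$ holds if and only if $\mathcal Q=\Gamma(\theta+1)\,\mathcal L_{\theta,\nu}$ for some $\theta>0$ and $\nu\in\mathcal P(M)$ with $\theta\nu=\mathrm{vol}_g$. -/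

import Mathlib

open MeasureTheory Set
open scoped Manifold ContDiff NNReal ENNReal Topology CompactlySupported

noncomputable section

/-! ### Spaces of measures, group actions

`FiniteMeasure X` and `ProbabilityMeasure X` carry the sigma-algebra generated by the evaluations
`μ ↦ μ s`; on a separable metrizable space `X` this is the Borel sigma-algebra of the weak
topology. -/

/-- The group of shifts of `X`: all bijections of `X` that are measurable together with their
inverse. -/
def shiftGroup (X : Type*) [MeasurableSpace X] : Subgroup (Equiv.Perm X) where
  carrier := {ψ | Measurable ψ ∧ Measurable ψ.symm}
  mul_mem' := fun {_ _} h k => ⟨h.1.comp k.1, k.2.comp h.2⟩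
  one_mem' := ⟨measurable_id, measurable_id⟩
  inv_mem' := fun {_} h => ⟨h.2, h.1⟩

/-- The measure `Q` on the space of finite measures on `X` is invariant under the action
`μ ↦ ψ_♯ μ` of the single transformation `ψ` of `X`. -/
def InvariantUnderShift {X : Type*} [MeasurableSpace X] (Q : Measure (FiniteMeasure X))
    (ψ : X → X) : Prop :=
  Q.map (fun μ : FiniteMeasure X => μ.map ψ) = Q

/-- The action `μ ↦ e ^ a · μ` of a continuous compactly supported function `a` on the finite
measures on `X`. -/
def expMultiplier {X : Type*} [TopologicalSpace X] [MeasurableSpace X] (a : C_c(X, ℝ))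
    (μ : FiniteMeasure X) : FiniteMeasure X :=
  ⟨(μ : Measure X).withDensity (fun x => ENNReal.ofReal (Real.exp (a x))), by
    obtain ⟨C, hC⟩ := a.continuous.bddAbove_range_of_hasCompactSupport a.hasCompactSupport
    refine isFiniteMeasure_withDensity (ne_of_lt ?_)
    calc ∫⁻ x, ENNReal.ofReal (Real.exp (a x)) ∂(μ : Measure X)
        ≤ ∫⁻ _, ENNReal.ofReal (Real.exp C) ∂(μ : Measure X) :=
          lintegral_mono fun x =>
            ENNReal.ofReal_le_ofReal (Real.exp_le_exp.2 (hC (mem_range_self x)))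
      _ = ENNReal.ofReal (Real.exp C) * (μ : Measure X) univ := lintegral_const _
      _ < ⊤ := ENNReal.mul_lt_top ENNReal.ofReal_lt_top (measure_lt_top _ _)⟩

/-- The set of finite measures of total mass at most `r`. -/
def massBall (X : Type*) [MeasurableSpace X] (r : ℝ≥0) : Set (FiniteMeasure X) :=
  {μ | μ.mass ≤ r}

/-! ### The Dirichlet--Ferguson measure and the multiplicative infinite-dimensional Lebesgue
measure -/

/-- The Beta distribution of parameters `1` and `β`: density `β (1 - t) ^ (β - 1)` on `[0,1]`. -/
def betaOne (β : ℝ) : Measure unitInterval :=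
  volume.withDensity (fun t => ENNReal.ofReal (β * (1 - (t : ℝ)) ^ (β - 1)))

/-- The probability measure `(1 - t) η + t δ_x`. -/
def mixDirac {X : Type*} [MeasurableSpace X] (η : ProbabilityMeasure X) (x : X)
    (t : unitInterval) : ProbabilityMeasure X :=
  ⟨ENNReal.ofReal (1 - (t : ℝ)) • (η : Measure X) + ENNReal.ofReal (t : ℝ) • Measure.dirac x, by
    constructor
    have h0 : (0 : ℝ) ≤ 1 - (t : ℝ) := sub_nonneg.2 t.2.2
    simp [← ENNReal.ofReal_add h0 t.2.1]⟩

/-- The Mecke identity of intensity `β ν`, for a probability measure `D` on the space of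
probability measures on `X`:
`∬ F(η, x) dη(x) dD(η) = ∭ F((1 - t) η + t δ_x, x) dν(x) dB_β(t) dD(η)`. -/
structure IsDirichletFerguson {X : Type*} [MeasurableSpace X] (β : ℝ) (ν : ProbabilityMeasure X)
    (D : Measure (ProbabilityMeasure X)) : Prop where
  isProbabilityMeasure : IsProbabilityMeasure D
  mecke : ∀ F : ProbabilityMeasure X → X → ℝ≥0∞, Measurable (Function.uncurry F) →
    ∫⁻ η, ∫⁻ x, F η x ∂(η : Measure X) ∂D =
      ∫⁻ η, ∫⁻ t, ∫⁻ x, F (mixDirac η x t) x ∂(ν : Measure X) ∂(betaOne β) ∂D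

/-- The Dirichlet--Ferguson measure of intensity `β ν`: the unique probability measure on the space
of probability measures on `X` that satisfies the Mecke identity. -/
def dirichletFerguson {X : Type*} [MeasurableSpace X] (β : ℝ) (ν : ProbabilityMeasure X) :
    Measure (ProbabilityMeasure X) :=
  Classical.epsilon (IsDirichletFerguson β ν)

/-- The measure `t ^ (θ - 1) dt / Γ(θ)` on `(0, ∞)`. -/
def gammaLebesgue (θ : ℝ) : Measure ℝ :=
  (volume.restrict (Ioi 0)).withDensity (fun t => ENNReal.ofReal (t ^ (θ - 1) / Real.Gamma θ))

/-- The multiplicative infinite-dimensional Lebesgue measure of shape `θ` and intensity `ν`: the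
image under `(η, t) ↦ t η` of the product of the Dirichlet--Ferguson measure of intensity `θ ν`
with `t ^ (θ - 1) dt / Γ(θ)`. -/
def multLebesgue {X : Type*} [MeasurableSpace X] (θ : ℝ) (ν : ProbabilityMeasure X) :
    Measure (FiniteMeasure X) :=
  ((dirichletFerguson θ ν).prod (gammaLebesgue θ)).map
    (fun p => Real.toNNReal p.2 • p.1.toFiniteMeasure)

/-! ### Oriented Riemannian manifolds, their volume and their volume-preserving diffeomorphisms -/

section Manifold

variable {d : ℕ} {M : Type*} [TopologicalSpace M] [ChartedSpace (EuclideanSpace ℝ (Fin d)) M]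

/-- An oriented smooth atlas: charts of the smooth structure that cover `M` and whose transition
maps have positive Jacobian determinant. -/
structure IsOrientedAtlas (A : Set (OpenPartialHomeomorph M (EuclideanSpace ℝ (Fin d)))) :
    Prop where
  subset_maximalAtlas : A ⊆ IsManifold.maximalAtlas (𝓡 d) ∞ M
  covers : ∀ x : M, ∃ φ ∈ A, x ∈ φ.source
  det_pos : ∀ φ ∈ A, ∀ φ' ∈ A, ∀ x ∈ φ.source ∩ φ'.source,
    0 < (fderiv ℝ (φ' ∘ φ.symm) (φ x)).det

/-- In the charts of the oriented atlas `A`, the map `ψ` has positive Jacobian determinant. -/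
def OrientationPreserving (A : Set (OpenPartialHomeomorph M (EuclideanSpace ℝ (Fin d))))
    (ψ : M → M) : Prop :=
  ∀ φ ∈ A, ∀ φ' ∈ A, ∀ x ∈ φ.source, ψ x ∈ φ'.source →
    0 < (fderiv ℝ (φ' ∘ ψ ∘ φ.symm) (φ x)).det

variable [IsManifold (𝓡 d) ∞ M]

/-- Smooth Riemannian metrics on `M`. -/
abbrev RiemMetric (d : ℕ) (M : Type*) [TopologicalSpace M]
    [ChartedSpace (EuclideanSpace ℝ (Fin d)) M] [IsManifold (𝓡 d) ∞ M] :=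
  Bundle.ContMDiffRiemannianMetric (𝓡 d) ∞ (EuclideanSpace ℝ (Fin d))
    (fun x : M => TangentSpace (𝓡 d) x)

/-- The coordinate vector field `∂_i` of the chart `φ` at the point of coordinates `y`. -/
def coordVector (φ : OpenPartialHomeomorph M (EuclideanSpace ℝ (Fin d)))
    (y : EuclideanSpace ℝ (Fin d)) (i : Fin d) : TangentSpace (𝓡 d) (φ.symm y) :=
  mfderiv (𝓡 d) (𝓡 d) φ.symm y (EuclideanSpace.single i (1 : ℝ))

/-- The matrix `g_{ij} = g(∂_i, ∂_j)` in the chart `φ` at the point of coordinates `y`. -/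
def metricMatrix (g : RiemMetric d M) (φ : OpenPartialHomeomorph M (EuclideanSpace ℝ (Fin d)))
    (y : EuclideanSpace ℝ (Fin d)) : Matrix (Fin d) (Fin d) ℝ :=
  Matrix.of fun i j => g.inner (φ.symm y) (coordVector φ y i) (coordVector φ y j)

/-- The measure `√(det g_{ij}) dy` of the chart `φ`, transported to the domain of `φ` in `M`. -/
def chartVolume [MeasurableSpace M] (g : RiemMetric d M)
    (φ : OpenPartialHomeomorph M (EuclideanSpace ℝ (Fin d))) : Measure M :=
  ((volume.restrict φ.target).withDensity
    (fun y => ENNReal.ofReal (Real.sqrt (metricMatrix g φ y).det))).map φ.symm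

theorem exists_countable_chart_cover (d : ℕ) (M : Type*) [TopologicalSpace M]
    [ChartedSpace (EuclideanSpace ℝ (Fin d)) M] [SecondCountableTopology M] [Nonempty M] :
    ∃ x : ℕ → M, ⋃ n, (chartAt (EuclideanSpace ℝ (Fin d)) (x n)).source = univ := by
  obtain ⟨s, hs, hU⟩ := TopologicalSpace.countable_cover_nhds
    (fun x : M => chart_source_mem_nhds (EuclideanSpace ℝ (Fin d)) x)
  have hne : s.Nonempty := by
    rcases s.eq_empty_or_nonempty with h | h
    · subst h
      simp at hU
      exact absurd hU.symm (Set.univ_nonempty (α := M)).ne_empty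
    · exact h
  obtain ⟨x, rfl⟩ := hs.exists_eq_range hne
  exact ⟨x, by simpa using hU⟩

/-- The Riemannian volume measure: `√(det g_{ij}) dy` in each chart, glued along a countable
cover of `M` by chart domains, made disjoint. -/
def riemannianVolume [MeasurableSpace M] [SecondCountableTopology M] [Nonempty M]
    (g : RiemMetric d M) : Measure M :=
  let φ := fun n : ℕ =>
    chartAt (EuclideanSpace ℝ (Fin d)) ((exists_countable_chart_cover d M).choose n)
  Measure.sum fun n => (chartVolume g (φ n)).restrict (disjointed (fun k => (φ k).source) n)

/-- The orientation- and volume-preserving diffeomorphisms of `M` that are the identity outside a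
compact set. -/
def volumeDiffeos [MeasurableSpace M] [SecondCountableTopology M] [Nonempty M]
    (A : Set (OpenPartialHomeomorph M (EuclideanSpace ℝ (Fin d)))) (g : RiemMetric d M) :
    Set (Diffeomorph (𝓡 d) (𝓡 d) M M ∞) :=
  {ψ | (∃ K : Set M, IsCompact K ∧ ∀ x ∉ K, ψ x = x) ∧ OrientationPreserving A ψ ∧
    (riemannianVolume g).map ψ = riemannianVolume g}

/-- `Q` is a natural measure on the finite measures on `M`: it does not charge the zero measure,
gives mass one to the unit ball, is projectively invariant under the multipliers `e ^ a` with `a`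
smooth and compactly supported, and is invariant under the diffeomorphisms in
`volumeDiffeos A g`. -/
structure IsNaturalMeasure [MeasurableSpace M] [SecondCountableTopology M] [Nonempty M]
    (A : Set (OpenPartialHomeomorph M (EuclideanSpace ℝ (Fin d)))) (g : RiemMetric d M)
    (Q : Measure (FiniteMeasure M)) : Prop where
  nontrivial : Q (massBall M 0) = 0
  normalized : Q (massBall M 1) = 1
  multipliers : ∀ a : C_c(M, ℝ), ContMDiff (𝓡 d) 𝓘(ℝ, ℝ) ∞ a →
    ∃ c : ℝ≥0∞, Q.map (expMultiplier a) = c • Q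
  shifts : ∀ ψ ∈ volumeDiffeos A g, InvariantUnderShift Q ψ

end Manifold

end

/-! Everything rests on exponential functionals. If exp(-μ(1)) is Q-integrable, then Q is determined
by the numbers ∫ exp(-μ(e^a)) dQ(μ) with a ≥ 0 bounded: tilting Q by exp(-μ(1)) gives a finite
measure whose Laplace functional at h is the number belonging to a = log(1 + h)
(`ext_of_lintegral_expNeg_expMass`; on a manifold smooth a of compact support suffice, by
`ext_of_lintegral_expNeg_expMass_smooth`). For the multiplicative Lebesgue measure this number is
exp(-θ ∫ a dν) (`lintegral_expNeg_expMass_multLebesgue`): by the Mecke identity and the Beta-Gamma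
relation its logarithmic derivative along s ↦ e^(s a) is the constant -θ ∫ a dν. Part (1) follows,
since a shift ψ replaces a by a ∘ ψ and indicators a recover ν. Projective invariance under e^a
follows as well, since the exponents add.

The Dirichlet-Ferguson measure is a chosen solution of the Mecke identity, so a solution must be
exhibited. Stick breaking gives a law stationary under η ↦ (1 - t) η + t δ_x. Both sides of the
Mecke identity then satisfy the same affine recursion, whose linear part is a contraction in the sup
norm, and so they agree (`mecke_of_stationary`).

Conversely, let Q be projectively invariant with unit ball of mass one. Put w(z) = ((1 - z)⁺)² and
A(s) = ∫ w(μ(e^(s a))) dQ. Invariance multiplies A(0) and the integral defining A'(0) by the same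
constant to give A(s) and A'(s). Hence A' = -(∫ a dm) A for a finite measure m that does not depend
on a (`meanMeasure`), and e^a acts by the factor exp(-∫ a dm)
(`map_expMultiplier_eq_of_projective`). No regularity of the factor in a is assumed. So Q has the
exponential functionals of a multiple of the multiplicative Lebesgue measure with θ ν = m, and the
mass of the unit ball fixes the multiple as Γ(θ + 1) (`exists_eq_smul_multLebesgue`).

By part (1), invariance under diffeomorphisms concerns ν alone, and it remains to see that a finite
measure invariant under `volumeDiffeos` is a multiple of the volume
(`exists_eq_smul_riemannianVolume`). Each point has a chart that carries the volume to Lebesgue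
measure. In dimension at least two, small translations in it extend to volume-preserving maps of
compact support: a translation is the product of two half-turns, and a half-turn is cut off by
letting its angle depend on the radius (`exists_contDiff_eq_translation`). A connected noncompact
manifold of dimension one has no such maps but the identity; in the compact case the translations in
the charts glue to global maps. Thus the measure is locally a multiple of the volume, with a locally
constant factor, and connectedness makes the factor constant. -/

/-! ### Laplace functionals determine finite measures on spaces of measures -/

open scoped BoundedContinuousFunction in
/-- A multiplicative family of bounded continuous functions that separates points separates finite
measures. -/
theorem MeasureTheory.Measure.ext_of_submonoid_separatesPoints {E : Type*} [TopologicalSpace E]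
    [PolishSpace E] [MeasurableSpace E] [BorelSpace E] {P P' : Measure E} [IsFiniteMeasure P]
    [IsFiniteMeasure P'] (S : Submonoid (E →ᵇ ℝ))
    (hsep : ∀ x y : E, x ≠ y → ∃ f ∈ S, f x ≠ f y)
    (heq : ∀ f ∈ S, ∫ x, f x ∂P = ∫ x, f x ∂P') : P = P' := by
  let A : StarSubalgebra ℝ (E →ᵇ ℝ) :=
    { Algebra.adjoin ℝ (S : Set (E →ᵇ ℝ)) with
      star_mem' := by
        intro a ha
        have : star a = a := by ext; simp
        simpa [this] using ha }
  refine ext_of_forall_mem_subalgebra_integral_eq_of_polish (𝕜 := ℝ) (A := A) ?_ ?_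
  · intro x y hxy
    obtain ⟨f, hf, hne⟩ := hsep x y hxy
    refine ⟨_, ⟨_, ⟨f, Algebra.subset_adjoin hf, rfl⟩, rfl⟩, ?_⟩
    simpa using hne
  · intro g hg
    -- A multiplicative set spans the algebra it generates, so equality of integrals on S extends by
    -- linearity.
    have hg' : g ∈ Algebra.adjoin ℝ (S : Set (E →ᵇ ℝ)) := hg
    rw [← Subalgebra.mem_toSubmodule, Algebra.adjoin_eq_span, Submonoid.closure_eq] at hg'
    induction hg' using Submodule.span_induction with
    | mem f hf => exact heq f hf
    | zero => simp
    | add f f' h h' hf hf' =>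
      have hm : ∀ f ∈ Submodule.span ℝ (S : Set (E →ᵇ ℝ)), f ∈ A := by
        intro f hf
        change f ∈ Algebra.adjoin ℝ (S : Set (E →ᵇ ℝ))
        rw [← Subalgebra.mem_toSubmodule, Algebra.adjoin_eq_span, Submonoid.closure_eq]
        exact hf
      simp only [BoundedContinuousFunction.coe_add, Pi.add_apply]
      rw [integral_add (f.integrable _) (f'.integrable _),
        integral_add (f.integrable _) (f'.integrable _), hf (hm _ h), hf' (hm _ h')]
    | smul c f h hf =>
      have hm : f ∈ A := by
        change f ∈ Algebra.adjoin ℝ (S : Set (E →ᵇ ℝ))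
        rw [← Subalgebra.mem_toSubmodule, Algebra.adjoin_eq_span, Submonoid.closure_eq]
        exact h
      simp only [BoundedContinuousFunction.coe_smul, smul_eq_mul]
      rw [integral_const_mul, integral_const_mul, hf hm]

open scoped BoundedContinuousFunction in
/-- The function `x ↦ exp (-∑ nᵢ xᵢ)` on a finite power of `ℝ≥0`. -/
noncomputable def expMonomial {ι : Type*} [Fintype ι] (n : ι → ℕ) : (ι → ℝ≥0) →ᵇ ℝ :=
  BoundedContinuousFunction.ofNormedAddCommGroup
    (fun x => Real.exp (-∑ i, (n i : ℝ) * (x i : ℝ))) (by fun_prop) 1 (by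
      intro x
      rw [Real.norm_eq_abs, abs_of_pos (Real.exp_pos _), Real.exp_le_one_iff, neg_nonpos]
      exact Finset.sum_nonneg fun i _ => by positivity)

theorem expMonomial_apply {ι : Type*} [Fintype ι] (n : ι → ℕ) (x : ι → ℝ≥0) :
    expMonomial n x = Real.exp (-∑ i, (n i : ℝ) * (x i : ℝ)) := rfl

/-- The monomials are closed under multiplication because exponents add, and the monomial of a
single coordinate separates points that differ there. -/
theorem MeasureTheory.Measure.ext_of_integral_expMonomial {ι : Type*} [Fintype ι]
    {P P' : Measure (ι → ℝ≥0)} [IsFiniteMeasure P] [IsFiniteMeasure P']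
    (h : ∀ n : ι → ℕ, ∫ x, expMonomial n x ∂P = ∫ x, expMonomial n x ∂P') : P = P' := by
  classical
  refine Measure.ext_of_submonoid_separatesPoints
    { carrier := range expMonomial
      one_mem' := ⟨0, by ext x; simp [expMonomial_apply]⟩
      mul_mem' := by
        rintro _ _ ⟨m, rfl⟩ ⟨n, rfl⟩
        refine ⟨m + n, ?_⟩
        ext x
        simp only [expMonomial_apply, BoundedContinuousFunction.coe_mul, Pi.mul_apply,
          ← Real.exp_add, Pi.add_apply, Nat.cast_add, add_mul, Finset.sum_add_distrib]
        congr 1; ring } ?_ ?_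
  · intro x y hxy
    obtain ⟨i, hi⟩ := Function.ne_iff.1 hxy
    refine ⟨expMonomial (Pi.single i 1), ⟨_, rfl⟩, ?_⟩
    simp only [expMonomial_apply, ne_eq, Real.exp_eq_exp, neg_inj]
    simpa [Pi.single_apply] using hi
  · rintro _ ⟨n, rfl⟩
    exact h n

/-- A finite measure on a space whose sigma-algebra is generated by nonnegative functions is
determined by its joint Laplace transforms. -/
theorem MeasureTheory.Measure.ext_of_laplace_generating {Ω I : Type*} [mΩ : MeasurableSpace Ω]
    (G : I → Ω → ℝ≥0) (hgen : mΩ ≤ ⨆ i, MeasurableSpace.comap (G i) inferInstance)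
    (hG : ∀ i, Measurable (G i))
    {P P' : Measure Ω} [IsFiniteMeasure P] [IsFiniteMeasure P']
    (h : ∀ (s : Finset I) (n : s → ℕ),
      ∫ z, Real.exp (-∑ i, (n i : ℝ) * (G i z : ℝ)) ∂P =
        ∫ z, Real.exp (-∑ i, (n i : ℝ) * (G i z : ℝ)) ∂P') : P = P' := by
  have hGm : Measurable fun z i => G i z := measurable_pi_lambda _ hG
  have hmap : P.map (fun z i => G i z) = P'.map (fun z i => G i z) := by
    -- The finite-dimensional marginals agree; uniqueness of projective limits passes this on to the
    -- law on the full product.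
    have key : ∀ s : Finset I, (P.map (fun z i => G i z)).map s.restrict =
        (P'.map (fun z i => G i z)).map s.restrict := by
      intro s
      have hs : Measurable (s.restrict (π := fun _ => ℝ≥0)) := Finset.measurable_restrict s
      rw [Measure.map_map hs hGm, Measure.map_map hs hGm]
      refine Measure.ext_of_integral_expMonomial fun n => ?_
      rw [integral_map (hs.comp hGm).aemeasurable
          (expMonomial n).continuous.aestronglyMeasurable,
        integral_map (hs.comp hGm).aemeasurable (expMonomial n).continuous.aestronglyMeasurable]
      exact h s n
    exact IsProjectiveLimit.unique
      (P := fun s => (P'.map (fun z i => G i z)).map s.restrict) (fun s => key s) (fun s => rfl)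
  ext t ht
  have : MeasurableSet[MeasurableSpace.comap (fun z i => G i z) inferInstance] t := by
    have h2 := hgen t ht
    have h3 : MeasurableSpace.comap (fun z i => G i z) inferInstance =
        ⨆ i, MeasurableSpace.comap (G i) inferInstance := by
      simp_rw [MeasurableSpace.pi, MeasurableSpace.comap_iSup, MeasurableSpace.comap_comp,
        Function.comp_def]
    rwa [h3]
  obtain ⟨u, hu, rfl⟩ := this
  rw [← Measure.map_apply hGm hu, ← Measure.map_apply hGm hu, hmap]

/-- The function `z ↦ exp (-z)` on the extended nonnegative reals, with value `1` at `∞`. -/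
noncomputable def expNeg (z : ℝ≥0∞) : ℝ≥0∞ := ENNReal.ofReal (Real.exp (-z.toReal))

@[fun_prop]
theorem measurable_expNeg : Measurable expNeg := by
  unfold expNeg; fun_prop

theorem expNeg_ne_zero (z : ℝ≥0∞) : expNeg z ≠ 0 := by
  simp [expNeg, Real.exp_pos]

theorem expNeg_ne_top (z : ℝ≥0∞) : expNeg z ≠ ⊤ := ENNReal.ofReal_ne_top

theorem expNeg_add {z w : ℝ≥0∞} (hz : z ≠ ⊤) (hw : w ≠ ⊤) :
    expNeg (z + w) = expNeg z * expNeg w := by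
  unfold expNeg
  rw [ENNReal.toReal_add hz hw, ← ENNReal.ofReal_mul (Real.exp_pos _).le, ← Real.exp_add]
  ring_nf

/-! ### Measurability and Laplace functionals on the space of finite measures -/

namespace MeasureTheory.FiniteMeasure

variable {X : Type*} [MeasurableSpace X]

@[fun_prop]
theorem measurable_toMeasure : Measurable (fun μ : FiniteMeasure X => (μ : Measure X)) :=
  measurable_subtype_coe

theorem measurable_lintegral {f : X → ℝ≥0∞} (hf : Measurable f) :
    Measurable fun μ : FiniteMeasure X => ∫⁻ x, f x ∂(μ : Measure X) :=
  (Measure.measurable_lintegral hf).comp measurable_toMeasure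

theorem measurable_of_measurable_apply {Ω : Type*} [MeasurableSpace Ω] {Φ : Ω → FiniteMeasure X}
    (h : ∀ s, MeasurableSet s → Measurable fun z => (Φ z : Measure X) s) : Measurable Φ :=
  (Measure.measurable_of_measurable_coe (fun z => (Φ z : Measure X)) h).subtype_mk

/-- The tautological kernel from the finite measures on `X` to `X`. -/
noncomputable def tautKernel (X : Type*) [MeasurableSpace X] :
    ProbabilityTheory.Kernel (FiniteMeasure X) X where
  toFun μ := (μ : Measure X)
  measurable' := measurable_toMeasure

/-- The total mass is finite but not bounded over the whole space, so the kernel is cut into finite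
pieces by the integer part of the mass. -/
instance : ProbabilityTheory.IsSFiniteKernel (tautKernel X) := by
  classical
  let B : ℕ → Set (FiniteMeasure X) := fun n => {μ | ⌊μ.mass⌋₊ = n}
  have hmass : Measurable fun μ : FiniteMeasure X => μ.mass :=
    ((Measure.measurable_coe MeasurableSet.univ).comp measurable_toMeasure).ennreal_toNNReal
  have hB : ∀ n, MeasurableSet (B n) := fun n =>
    (Nat.measurable_floor.comp hmass) (measurableSet_singleton n)
  have hsum : tautKernel X = ProbabilityTheory.Kernel.sum fun n =>
      ProbabilityTheory.Kernel.piecewise (hB n) (tautKernel X) 0 := by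
    ext μ s hs
    rw [ProbabilityTheory.Kernel.sum_apply' _ _ hs, tsum_eq_single ⌊μ.mass⌋₊]
    · rw [ProbabilityTheory.Kernel.piecewise_apply, if_pos (show μ ∈ B ⌊μ.mass⌋₊ from rfl)]
    · intro n hn
      rw [ProbabilityTheory.Kernel.piecewise_apply, if_neg (show μ ∉ B n from fun h => hn h.symm)]
      simp
  have hfin : ∀ n, ProbabilityTheory.IsFiniteKernel
      (ProbabilityTheory.Kernel.piecewise (hB n) (tautKernel X) 0) := by
    intro n
    refine ⟨⟨(n + 1 : ℕ), by simp, fun μ => ?_⟩⟩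
    rw [ProbabilityTheory.Kernel.piecewise_apply]
    split_ifs with h
    · have h1 : ⌊μ.mass⌋₊ = n := h
      have h2 : μ.mass < (n + 1 : ℕ) := by
        rw [← h1]; exact_mod_cast Nat.lt_floor_add_one μ.mass
      change (μ : Measure X) univ ≤ _
      rw [← ennreal_mass]
      exact_mod_cast h2.le
    · simp
  rw [hsum]
  infer_instance

theorem measurable_lintegral_param {β : Type*} [MeasurableSpace β] {F : β → X → ℝ≥0∞}
    (hF : Measurable (Function.uncurry F)) :
    Measurable fun p : β × FiniteMeasure X => ∫⁻ x, F p.1 x ∂(p.2 : Measure X) := by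
  have h : Measurable (Function.uncurry fun (p : β × FiniteMeasure X) (x : X) => F p.1 x) :=
    hF.comp ((measurable_fst.comp measurable_fst).prodMk measurable_snd)
  exact h.lintegral_kernel_prod_right
    (κ := (tautKernel X).comap Prod.snd measurable_snd)

theorem lintegral_ne_top_of_le {f : X → ℝ≥0∞} {C : ℝ≥0} (h : ∀ x, f x ≤ C)
    (μ : FiniteMeasure X) : ∫⁻ x, f x ∂(μ : Measure X) ≠ ⊤ := by
  refine ne_of_lt ((lintegral_mono h).trans_lt ?_)
  rw [lintegral_const]
  exact ENNReal.mul_lt_top ENNReal.coe_lt_top (measure_lt_top _ _)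

/-- Finite measures on the space of finite measures on `X` are determined by their Laplace
functionals on an additive class of bounded functions that approximates the indicator functions of
a generating π-system. -/
theorem ext_of_laplace (H : Set (X → ℝ≥0∞)) (h0 : 0 ∈ H)
    (hadd : ∀ h ∈ H, ∀ h' ∈ H, h + h' ∈ H) (hmeas : ∀ h ∈ H, Measurable h)
    (hbdd : ∀ h ∈ H, ∃ C : ℝ≥0, ∀ x, h x ≤ C)
    (S : Set (Set X)) (hgen : ‹MeasurableSpace X› = MeasurableSpace.generateFrom S)
    (hpi : IsPiSystem S) (huniv : univ ∈ S)
    (happrox : ∀ U ∈ S, ∃ h : ℕ → X → ℝ≥0∞, (∀ n, h n ∈ H) ∧ (∀ n x, h n x ≤ 1) ∧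
      ∀ x, Filter.Tendsto (fun n => h n x) Filter.atTop (𝓝 (U.indicator 1 x)))
    {P P' : Measure (FiniteMeasure X)} [IsFiniteMeasure P] [IsFiniteMeasure P']
    (heq : ∀ h ∈ H, ∫⁻ μ, expNeg (∫⁻ x, h x ∂(μ : Measure X)) ∂P =
      ∫⁻ μ, expNeg (∫⁻ x, h x ∂(μ : Measure X)) ∂P') : P = P' := by
  have hSm : ∀ U ∈ S, MeasurableSet U := fun U hU => by
    rw [hgen]; exact MeasurableSpace.measurableSet_generateFrom hU
  let G : H → FiniteMeasure X → ℝ≥0 := fun h μ => (∫⁻ x, h.1 x ∂(μ : Measure X)).toNNReal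
  have hfin : ∀ (h : H) (μ : FiniteMeasure X), ∫⁻ x, h.1 x ∂(μ : Measure X) ≠ ⊤ := fun h μ => by
    obtain ⟨C, hC⟩ := hbdd h.1 h.2
    exact lintegral_ne_top_of_le hC μ
  have hG : ∀ h, Measurable (G h) := fun h =>
    (measurable_lintegral (hmeas h.1 h.2)).ennreal_toNNReal
  refine Measure.ext_of_laplace_generating G ?_ hG ?_
  -- Here m' is generated by the integrals of functions in H. Dominated convergence makes μ ↦ μ U
  -- measurable for it when U is in S, and the π-system extends this to all measurable sets.
  · let m' : MeasurableSpace (FiniteMeasure X) := ⨆ i, MeasurableSpace.comap (G i) inferInstance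
    have hGm : ∀ h : H, Measurable[m'] fun μ : FiniteMeasure X =>
        ∫⁻ x, h.1 x ∂(μ : Measure X) := by
      intro h
      have h1 : Measurable[m'] (G h) := by
        rw [measurable_iff_comap_le]
        exact le_iSup (fun i => MeasurableSpace.comap (G i) inferInstance) h
      have h2 : (fun μ : FiniteMeasure X => ∫⁻ x, h.1 x ∂(μ : Measure X)) =
          fun μ => ((G h μ : ℝ≥0) : ℝ≥0∞) := by
        ext μ
        exact (ENNReal.coe_toNNReal (hfin h μ)).symm
      rw [h2]
      exact measurable_coe_nnreal_ennreal.comp h1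
    have hSmeas : ∀ U ∈ S, Measurable[m'] fun μ : FiniteMeasure X => (μ : Measure X) U := by
      intro U hU
      obtain ⟨h, hH, h1, hlim⟩ := happrox U hU
      refine @measurable_of_tendsto_metrizable (FiniteMeasure X) ℝ≥0∞ m' _ _ _ _
        (fun n μ => ∫⁻ x, h n x ∂(μ : Measure X)) _ (fun n => hGm ⟨h n, hH n⟩) ?_
      rw [tendsto_pi_nhds]
      intro μ
      rw [← lintegral_indicator_one (hSm U hU)]
      refine tendsto_lintegral_of_dominated_convergence (fun _ => 1) (fun n => hmeas _ (hH n))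
        (fun n => .of_forall (h1 n)) ?_ (.of_forall hlim)
      simp [measure_ne_top]
    have hcoe : Measurable[m'] fun μ : FiniteMeasure X => (μ : Measure X) :=
      @Measurable.measure_of_isPiSystem _ _ m' _ (fun μ : FiniteMeasure X => (μ : Measure X)) _ S
        hgen hpi hSmeas (hSmeas univ huniv)
    exact (measurable_iff_comap_le.1 hcoe)
  · intro s n
    -- A joint Laplace transform at integer points is the Laplace functional at a single element of
    -- H, as H is closed under sums.
    have hsum : ∀ (t : Finset s), (fun x => ∑ i ∈ t, (n i : ℝ≥0∞) * i.1.1 x) ∈ H := by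
      classical
      intro t
      induction t using Finset.induction_on with
      | empty => simp only [Finset.sum_empty]; exact h0
      | insert i t hi ih =>
        have hn : ∀ k : ℕ, (fun x => (k : ℝ≥0∞) * i.1.1 x) ∈ H := by
          intro k
          induction k with
          | zero => simp only [Nat.cast_zero, zero_mul]; exact h0
          | succ k ihk =>
            have := hadd _ ihk _ i.1.2
            convert this using 1
            ext x
            simp [add_mul]
        have := hadd _ (hn (n i)) _ ih
        convert this using 1
        ext x
        simp [Finset.sum_insert hi]
    have hkey : ∀ μ : FiniteMeasure X, ∑ i, (n i : ℝ) * (G i μ : ℝ) =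
        (∫⁻ x, ∑ i : s, (n i : ℝ≥0∞) * i.1.1 x ∂(μ : Measure X)).toReal := by
      intro μ
      rw [lintegral_finsetSum _ (fun i _ => (hmeas _ i.1.2).const_mul _), ENNReal.toReal_sum]
      · refine Finset.sum_congr rfl fun i _ => ?_
        rw [lintegral_const_mul _ (hmeas _ i.1.2), ENNReal.toReal_mul]
        simp [G, ENNReal.coe_toNNReal_eq_toReal]
      · intro i _
        rw [lintegral_const_mul _ (hmeas _ i.1.2)]
        exact ENNReal.mul_ne_top (by simp) (hfin _ _)
    have hmeas' : Measurable fun μ : FiniteMeasure X =>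
        Real.exp (-∑ i, (n i : ℝ) * (G i μ : ℝ)) := by
      have := hG
      fun_prop
    rw [integral_eq_lintegral_of_nonneg_ae (.of_forall fun _ => (Real.exp_pos _).le)
        hmeas'.aestronglyMeasurable,
      integral_eq_lintegral_of_nonneg_ae (.of_forall fun _ => (Real.exp_pos _).le)
        hmeas'.aestronglyMeasurable]
    have := heq _ (hsum Finset.univ)
    simp only [expNeg] at this
    simp only [hkey, this]

/-- Finite measures on the space of finite measures on `X` are determined by their Laplace
functionals on bounded measurable functions. -/
theorem ext_of_laplace_bounded {P P' : Measure (FiniteMeasure X)} [IsFiniteMeasure P]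
    [IsFiniteMeasure P']
    (heq : ∀ h : X → ℝ≥0∞, Measurable h → (∃ C : ℝ≥0, ∀ x, h x ≤ C) →
      ∫⁻ μ, expNeg (∫⁻ x, h x ∂(μ : Measure X)) ∂P =
        ∫⁻ μ, expNeg (∫⁻ x, h x ∂(μ : Measure X)) ∂P') : P = P' := by
  refine ext_of_laplace {h | Measurable h ∧ ∃ C : ℝ≥0, ∀ x, h x ≤ C}
    ⟨measurable_zero, 0, by simp⟩ ?_ (fun h hh => hh.1) (fun h hh => hh.2) {s | MeasurableSet s}
    (by simp) MeasurableSpace.isPiSystem_measurableSet MeasurableSet.univ ?_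
    (fun h hh => heq h hh.1 hh.2)
  · rintro h ⟨hm, C, hC⟩ h' ⟨hm', C', hC'⟩
    refine ⟨hm.add hm', C + C', fun x => ?_⟩
    push_cast
    exact add_le_add (hC x) (hC' x)
  · intro U hU
    have h1 : ∀ x, U.indicator (1 : X → ℝ≥0∞) x ≤ 1 := fun x =>
      Set.indicator_le_self' (fun _ _ => zero_le_one) x
    exact ⟨fun _ => U.indicator 1, fun n => ⟨measurable_one.indicator hU, 1, by simpa using h1⟩,
      fun _ => h1, fun x => tendsto_const_nhds⟩

end MeasureTheory.FiniteMeasure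

/-! ### The Beta distribution -/

/-- Moves Beta integrals to the real line, where the changes of variables below take place;
`projIcc` merely extends the integrand off the unit interval. -/
theorem lintegral_betaOne (β : ℝ) {f : unitInterval → ℝ≥0∞} (hf : Measurable f) :
    ∫⁻ t, f t ∂betaOne β = ∫⁻ t in Icc (0 : ℝ) 1,
      ENNReal.ofReal (β * (1 - t) ^ (β - 1)) * f (projIcc 0 1 zero_le_one t) := by
  have hm : Measurable fun t : unitInterval => ENNReal.ofReal (β * (1 - (t : ℝ)) ^ (β - 1)) := by
    fun_prop
  rw [betaOne, lintegral_withDensity_eq_lintegral_mul _ hm hf,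
    ← lintegral_subtype_comap measurableSet_Icc]
  refine lintegral_congr fun t => ?_
  simp

theorem lintegral_one_sub_rpow {p : ℝ} (hp : -1 < p) {c : ℝ} (hc : 0 ≤ c) :
    ∫⁻ t in Icc (0 : ℝ) 1, ENNReal.ofReal (c * (1 - t) ^ p) = ENNReal.ofReal (c / (p + 1)) := by
  have hint : IntervalIntegrable (fun t : ℝ => c * (1 - t) ^ p) volume 0 1 := by
    have := ((intervalIntegral.intervalIntegrable_rpow' (a := 0) (b := 1) hp).comp_sub_left 1).symm
    simpa using this.const_mul c
  rw [← ofReal_integral_eq_lintegral_ofReal, integral_Icc_eq_integral_Ioc,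
    ← intervalIntegral.integral_of_le zero_le_one, intervalIntegral.integral_const_mul,
    intervalIntegral.integral_comp_sub_left (fun t => t ^ p), integral_rpow (Or.inl hp)]
  · have : p + 1 ≠ 0 := by linarith
    simp [Real.zero_rpow this, div_eq_mul_inv]
  · exact (intervalIntegrable_iff_integrableOn_Icc_of_le zero_le_one).1 hint
  · filter_upwards [ae_restrict_mem measurableSet_Icc] with t ht
    have : 0 ≤ 1 - t := by linarith [ht.2]
    positivity

theorem isProbabilityMeasure_betaOne {β : ℝ} (hβ : 0 < β) : IsProbabilityMeasure (betaOne β) := by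
  constructor
  rw [← lintegral_one, lintegral_betaOne β measurable_const]
  simp only [mul_one]
  rw [lintegral_one_sub_rpow (by linarith) hβ.le]
  simp [hβ.ne']

/-- The mean remainder is β / (β + 1). It is the contraction factor both for the missing mass of
stick breaking and for the iteration that yields the Mecke identity. -/
theorem lintegral_one_sub_betaOne_lt_one {β : ℝ} (hβ : 0 < β) :
    ∫⁻ t, ENNReal.ofReal (1 - (t : ℝ)) ∂betaOne β < 1 := by
  rw [lintegral_betaOne β (by fun_prop)]
  have : ∀ t ∈ Icc (0 : ℝ) 1, ENNReal.ofReal (β * (1 - t) ^ (β - 1)) *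
      ENNReal.ofReal (1 - (projIcc 0 1 zero_le_one t : ℝ)) = ENNReal.ofReal (β * (1 - t) ^ β) := by
    intro t ht
    have h0 : 0 ≤ 1 - t := by linarith [ht.2]
    rw [projIcc_of_mem _ ht, ← ENNReal.ofReal_mul (by positivity)]
    congr 1
    rcases h0.eq_or_lt with h | h
    · simp [← h, Real.zero_rpow hβ.ne']
    · rw [Real.rpow_sub_one h.ne']
      field_simp
  rw [setLIntegral_congr_fun measurableSet_Icc this, lintegral_one_sub_rpow (by linarith) hβ.le,
    ENNReal.ofReal_lt_one, div_lt_one (by linarith)]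
  linarith

/-! ### Mixtures with Dirac masses -/

section Mix

variable {X : Type*} [MeasurableSpace X]

theorem MeasureTheory.ProbabilityMeasure.measurable_toMeasure :
    Measurable (fun μ : ProbabilityMeasure X => (μ : Measure X)) :=
  measurable_subtype_coe

theorem MeasureTheory.ProbabilityMeasure.measurable_of_measurable_apply {Ω : Type*}
    [MeasurableSpace Ω] {Φ : Ω → ProbabilityMeasure X}
    (h : ∀ s, MeasurableSet s → Measurable fun z => (Φ z : Measure X) s) : Measurable Φ :=
  (Measure.measurable_of_measurable_coe (fun z => (Φ z : Measure X)) h).subtype_mk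

theorem MeasureTheory.ProbabilityMeasure.measurable_lintegral_param {F : ProbabilityMeasure X → X → ℝ≥0∞}
    (hF : Measurable (Function.uncurry F)) :
    Measurable fun η : ProbabilityMeasure X => ∫⁻ x, F η x ∂(η : Measure X) := by
  let κ : ProbabilityTheory.Kernel (ProbabilityMeasure X) X :=
    ⟨fun μ => (μ : Measure X), measurable_toMeasure⟩
  have : ProbabilityTheory.IsMarkovKernel κ := ⟨fun μ => inferInstanceAs (IsProbabilityMeasure (μ : Measure X))⟩
  exact hF.lintegral_kernel_prod_right (κ := κ)

theorem coe_mixDirac (η : ProbabilityMeasure X) (x : X) (t : unitInterval) :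
    (mixDirac η x t : Measure X) =
      ENNReal.ofReal (1 - (t : ℝ)) • (η : Measure X) + ENNReal.ofReal (t : ℝ) • Measure.dirac x :=
  rfl

theorem lintegral_mixDirac (η : ProbabilityMeasure X) (x : X) (t : unitInterval) {f : X → ℝ≥0∞}
    (hf : Measurable f) :
    ∫⁻ y, f y ∂(mixDirac η x t : Measure X) =
      ENNReal.ofReal (1 - (t : ℝ)) * ∫⁻ y, f y ∂(η : Measure X) + ENNReal.ofReal (t : ℝ) * f x := by
  rw [coe_mixDirac, lintegral_add_measure, lintegral_smul_measure, lintegral_smul_measure,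
    lintegral_dirac' _ hf, smul_eq_mul, smul_eq_mul]

theorem measurable_mixDirac :
    Measurable fun p : ProbabilityMeasure X × X × unitInterval => mixDirac p.1 p.2.1 p.2.2 := by
  refine ProbabilityMeasure.measurable_of_measurable_apply fun s hs => ?_
  have h1 : Measurable fun p : ProbabilityMeasure X × X × unitInterval => (p.1 : Measure X) s :=
    (Measure.measurable_coe hs).comp (ProbabilityMeasure.measurable_toMeasure.comp measurable_fst)
  have h2 : Measurable fun p : ProbabilityMeasure X × X × unitInterval =>
      s.indicator (1 : X → ℝ≥0∞) p.2.1 :=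
    (measurable_one.indicator hs).comp (by fun_prop)
  simp only [coe_mixDirac, Measure.add_apply, Measure.smul_apply, smul_eq_mul,
    Measure.dirac_apply' _ hs]
  fun_prop

/-! ### Stick breaking -/

/-- The weights of the stick breaking construction. -/
noncomputable def stickWeight {Y : Type*} (z : ℕ → Y × unitInterval) (k : ℕ) : ℝ≥0∞ :=
  ENNReal.ofReal ((z k).2 : ℝ) * ∏ j ∈ Finset.range k, ENNReal.ofReal (1 - ((z j).2 : ℝ))

/-- The random measure of the stick breaking construction. -/
noncomputable def stickMeasure (z : ℕ → X × unitInterval) : Measure X :=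
  Measure.sum fun k => stickWeight z k • Measure.dirac (z k).1

/-- The sequence with first term `y` followed by `z`. -/
def consSeq {Y : Type*} (y : Y) (z : ℕ → Y) : ℕ → Y
  | 0 => y
  | k + 1 => z k

theorem ofReal_one_sub_add (t : unitInterval) :
    ENNReal.ofReal (1 - (t : ℝ)) + ENNReal.ofReal (t : ℝ) = 1 := by
  rw [← ENNReal.ofReal_add (by linarith [t.2.2]) t.2.1]; simp

theorem stickWeight_consSeq_succ {Y : Type*} (y : Y × unitInterval) (z : ℕ → Y × unitInterval)
    (k : ℕ) :
    stickWeight (consSeq y z) (k + 1) = ENNReal.ofReal (1 - (y.2 : ℝ)) * stickWeight z k := by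
  simp only [stickWeight, consSeq, Finset.prod_range_succ']
  ring

/-- Self-similarity: once the first stick is removed, the rest is broken by the remaining sequence
in the same way, scaled by `1 - y.2`. -/
theorem stickMeasure_consSeq (y : X × unitInterval) (z : ℕ → X × unitInterval) :
    stickMeasure (consSeq y z) = ENNReal.ofReal (1 - (y.2 : ℝ)) • stickMeasure z +
      ENNReal.ofReal (y.2 : ℝ) • Measure.dirac y.1 := by
  ext s hs
  simp only [stickMeasure, Measure.sum_apply _ hs, Measure.add_apply, Measure.smul_apply,
    smul_eq_mul]
  rw [tsum_eq_zero_add' ENNReal.summable, add_comm, ← ENNReal.tsum_mul_left]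
  simp only [stickWeight_consSeq_succ, consSeq, mul_assoc]
  simp [stickWeight, consSeq]

theorem stickMeasure_univ_le_one (z : ℕ → X × unitInterval) : stickMeasure z univ ≤ 1 := by
  -- The pieces broken off in n steps and the remaining stick add up to one.
  have h : ∀ n, ∑ k ∈ Finset.range n, stickWeight z k +
      ∏ j ∈ Finset.range n, ENNReal.ofReal (1 - ((z j).2 : ℝ)) = 1 := by
    intro n
    induction n with
    | zero => simp
    | succ n ih =>
      rw [Finset.sum_range_succ, Finset.prod_range_succ, ← ih, stickWeight, add_assoc,
        mul_comm (∏ j ∈ Finset.range n, _), ← add_mul, add_comm (ENNReal.ofReal _),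
        ofReal_one_sub_add, one_mul]
  simp only [stickMeasure, Measure.sum_apply _ MeasurableSet.univ, Measure.smul_apply, smul_eq_mul,
    measure_univ, mul_one]
  rw [ENNReal.tsum_eq_iSup_nat]
  exact iSup_le fun n => (h n) ▸ le_self_add

theorem measurable_stickMeasure : Measurable (stickMeasure (X := X)) := by
  refine Measure.measurable_of_measurable_coe _ fun s hs => ?_
  simp only [stickMeasure, Measure.sum_apply _ hs, Measure.smul_apply, smul_eq_mul,
    Measure.dirac_apply' _ hs, stickWeight]
  refine Measurable.tsum fun k => ?_
  have h2 : Measurable fun z : ℕ → X × unitInterval => s.indicator (1 : X → ℝ≥0∞) (z k).1 :=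
    (measurable_one.indicator hs).comp (by fun_prop)
  fun_prop

theorem measurable_consSeq {Y : Type*} [MeasurableSpace Y] :
    Measurable fun p : Y × (ℕ → Y) => consSeq p.1 p.2 := by
  refine measurable_pi_lambda _ fun k => ?_
  cases k with
  | zero => exact measurable_fst
  | succ k => exact (measurable_pi_apply k).comp measurable_snd

/-- On a cylinder, coordinate 0 constrains only the new term and coordinate k + 1 only the old term
k, so the product formula splits off one factor. All stationarity below comes from this invariance.
-/
theorem map_consSeq_infinitePi {Y : Type*} [MeasurableSpace Y] (μ : Measure Y)
    [IsProbabilityMeasure μ] :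
    (μ.prod (Measure.infinitePi fun _ : ℕ => μ)).map (fun p => consSeq p.1 p.2) =
      Measure.infinitePi fun _ : ℕ => μ := by
  classical
  refine Measure.eq_infinitePi _ fun s t ht => ?_
  rw [Measure.map_apply measurable_consSeq
    (MeasurableSet.pi s.countable_toSet fun i _ => ht i)]
  let s' : Finset ℕ := s.preimage Nat.succ (Nat.succ_injective.injOn)
  have hs' : ∀ k, k ∈ s' ↔ k + 1 ∈ s := fun k => by simp [s']
  let t0 : Set Y := if 0 ∈ s then t 0 else univ
  have hpre : (fun p : Y × (ℕ → Y) => consSeq p.1 p.2) ⁻¹' (Set.pi s t) =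
      t0 ×ˢ Set.pi s' (fun k => t (k + 1)) := by
    ext ⟨y, z⟩
    simp only [mem_preimage, Set.mem_pi, Finset.mem_coe, mem_prod, hs', t0]
    constructor
    · intro h
      refine ⟨?_, fun k hk => h (k + 1) hk⟩
      split_ifs with h0
      · exact h 0 h0
      · trivial
    · rintro ⟨h1, h2⟩ (_ | k) hk
      · rw [if_pos hk] at h1; exact h1
      · exact h2 k hk
  rw [hpre, Measure.prod_prod, Measure.infinitePi_pi _ (fun k _ => ht (k + 1))]
  have hprod : ∏ k ∈ s', μ (t (k + 1)) = ∏ k ∈ s.erase 0, μ (t k) := by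
    refine Finset.prod_bij (fun k _ => k + 1) ?_ ?_ ?_ ?_
    · intro k hk; simpa using (hs' k).1 hk
    · intro a _ b _ h; simpa using h
    · intro b hb
      obtain ⟨h0, hb⟩ := Finset.mem_erase.1 hb
      obtain ⟨k, rfl⟩ := Nat.exists_eq_succ_of_ne_zero h0
      exact ⟨k, (hs' k).2 hb, rfl⟩
    · intro k _; rfl
  rw [hprod]
  by_cases h0 : 0 ∈ s
  · simp only [t0, if_pos h0]
    exact Finset.mul_prod_erase s (fun k => μ (t k)) h0
  · simp [t0, h0]

end Mix

/-! ### Existence of the Dirichlet--Ferguson measure -/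

section Existence

variable {X : Type*} [MeasurableSpace X]

/-- Breaking one more stick in front multiplies the missing mass by an independent factor of mean q
< 1, so the expected missing mass satisfies e = q * e. Being finite, it is zero. -/
theorem ae_stickMeasure_univ_eq_one {β : ℝ} (hβ : 0 < β) (ν : ProbabilityMeasure X) :
    ∀ᵐ z ∂(Measure.infinitePi fun _ : ℕ => (ν : Measure X).prod (betaOne β)),
      stickMeasure z univ = 1 := by
  have := isProbabilityMeasure_betaOne hβ
  set m := (ν : Measure X).prod (betaOne β) with hm
  set P := Measure.infinitePi fun _ : ℕ => m with hP
  have hmeas : Measurable fun z : ℕ → X × unitInterval => 1 - stickMeasure z univ :=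
    ((Measure.measurable_coe MeasurableSet.univ).comp measurable_stickMeasure).const_sub 1
  have hres : ∀ (y : X × unitInterval) (z : ℕ → X × unitInterval),
      1 - stickMeasure (consSeq y z) univ =
        ENNReal.ofReal (1 - (y.2 : ℝ)) * (1 - stickMeasure z univ) := by
    intro y z
    rw [stickMeasure_consSeq, ENNReal.mul_sub (by simp), mul_one, ← ofReal_one_sub_add y.2]
    simp only [Measure.add_apply, Measure.smul_apply, measure_univ, smul_eq_mul, mul_one]
    exact ENNReal.add_sub_add_eq_sub_right ENNReal.ofReal_ne_top
  set q := ∫⁻ t, ENNReal.ofReal (1 - (t : ℝ)) ∂betaOne β with hq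
  set e := ∫⁻ z, (1 - stickMeasure z univ) ∂P with he
  have hq' : ∫⁻ y, ENNReal.ofReal (1 - (y.2 : ℝ)) ∂m = q := by
    rw [hm, lintegral_prod _ (by fun_prop)]
    simp [hq]
  have heq : e = q * e := by
    calc e = ∫⁻ z, (1 - stickMeasure z univ) ∂((m.prod P).map fun p => consSeq p.1 p.2) := by
          rw [map_consSeq_infinitePi]
      _ = ∫⁻ y, ∫⁻ z, (1 - stickMeasure (consSeq y z) univ) ∂P ∂m := by
          have h1 : Measurable fun p : (X × unitInterval) × (ℕ → X × unitInterval) =>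
              1 - stickMeasure (consSeq p.1 p.2) univ := hmeas.comp measurable_consSeq
          rw [lintegral_map hmeas measurable_consSeq, lintegral_prod _ h1.aemeasurable]
      _ = q * e := by
          simp_rw [hres]
          rw [← hq', ← lintegral_mul_const _ (by fun_prop)]
          refine lintegral_congr fun y => ?_
          rw [lintegral_const_mul _ hmeas]
  have he1 : e ≤ 1 := by
    calc e ≤ ∫⁻ _, 1 ∂P := lintegral_mono fun z => tsub_le_self
      _ = 1 := by simp
  have he0 : e = 0 := by
    by_contra h0
    have hlt : q * e < 1 * e :=
      ENNReal.mul_lt_mul_left h0 (ne_top_of_le_ne_top ENNReal.one_ne_top he1)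
        (lintegral_one_sub_betaOne_lt_one hβ)
    rw [one_mul, ← heq] at hlt
    exact lt_irrefl _ hlt
  filter_upwards [(lintegral_eq_zero_iff hmeas).1 he0] with z hz
  exact le_antisymm (stickMeasure_univ_le_one z) (tsub_eq_zero_iff_le.1 hz)

open Classical in
/-- The random probability measure of the stick breaking construction. -/
noncomputable def stickProbability (z : ℕ → X × unitInterval) : ProbabilityMeasure X :=
  -- On the null set where mass is lost, a Dirac mass serves as default value.
  ⟨if stickMeasure z univ = 1 then stickMeasure z else Measure.dirac (z 0).1, by
    split_ifs with h
    · exact ⟨h⟩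
    · infer_instance⟩

open Classical in
theorem coe_stickProbability (z : ℕ → X × unitInterval) : (stickProbability z : Measure X) =
    if stickMeasure z univ = 1 then stickMeasure z else Measure.dirac (z 0).1 := rfl

theorem stickProbability_of_eq {z : ℕ → X × unitInterval} (h : stickMeasure z univ = 1) :
    (stickProbability z : Measure X) = stickMeasure z := by
  rw [coe_stickProbability, if_pos h]

theorem measurable_stickProbability : Measurable (stickProbability (X := X)) := by
  classical
  refine ProbabilityMeasure.measurable_of_measurable_apply fun s hs => ?_
  have hA : MeasurableSet {z : ℕ → X × unitInterval | stickMeasure z univ = 1} :=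
    ((Measure.measurable_coe MeasurableSet.univ).comp measurable_stickMeasure)
      (measurableSet_singleton 1)
  have hd : Measurable fun z : ℕ → X × unitInterval => Measure.dirac (z 0).1 :=
    Measure.measurable_dirac.comp (by fun_prop)
  simp only [coe_stickProbability]
  exact (Measure.measurable_coe hs).comp (Measurable.ite hA measurable_stickMeasure hd)

theorem stickProbability_consSeq {y : X × unitInterval} {z : ℕ → X × unitInterval}
    (h : stickMeasure z univ = 1) :
    stickProbability (consSeq y z) = mixDirac (stickProbability z) y.1 y.2 := by
  have h' : stickMeasure (consSeq y z) univ = 1 := by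
    rw [stickMeasure_consSeq, Measure.add_apply, Measure.smul_apply, h]
    simp [ofReal_one_sub_add]
  apply Subtype.ext
  change (stickProbability (consSeq y z) : Measure X) = _
  rw [stickProbability_of_eq h', stickMeasure_consSeq]
  change _ = (mixDirac (stickProbability z) y.1 y.2 : Measure X)
  rw [coe_mixDirac, stickProbability_of_eq h]

theorem measurable_mixDirac_right (η : ProbabilityMeasure X) :
    Measurable fun y : X × unitInterval => mixDirac η y.1 y.2 := by
  have h : Measurable fun y : X × unitInterval => (η, y.1, y.2) := by fun_prop
  have h' := measurable_mixDirac.comp h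
  exact h'

/-- There is a law on probability measures that is stationary under mixing with independent Dirac
masses. -/
theorem exists_stationary_mixDirac {β : ℝ} (hβ : 0 < β) (ν : ProbabilityMeasure X) :
    ∃ D : Measure (ProbabilityMeasure X), IsProbabilityMeasure D ∧
      ∀ G : ProbabilityMeasure X → ℝ≥0∞, Measurable G →
        ∫⁻ η, G η ∂D =
          ∫⁻ η, ∫⁻ t, ∫⁻ x, G (mixDirac η x t) ∂(ν : Measure X) ∂(betaOne β) ∂D := by
  have := isProbabilityMeasure_betaOne hβ
  set m := (ν : Measure X).prod (betaOne β) with hm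
  set P := Measure.infinitePi fun _ : ℕ => m with hP
  refine ⟨P.map stickProbability,
    Measure.isProbabilityMeasure_map measurable_stickProbability.aemeasurable, fun G hG => ?_⟩
  have hGm : Measurable fun p : ProbabilityMeasure X × X × unitInterval =>
      G (mixDirac p.1 p.2.1 p.2.2) := hG.comp measurable_mixDirac
  have hJ : ∀ η : ProbabilityMeasure X, ∫⁻ t, ∫⁻ x, G (mixDirac η x t) ∂(ν : Measure X) ∂(betaOne β)
      = ∫⁻ y, G (mixDirac η y.1 y.2) ∂m := by
    intro η
    have h1 : Measurable fun y : X × unitInterval => G (mixDirac η y.1 y.2) :=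
      hG.comp (measurable_mixDirac_right η)
    exact (lintegral_prod_symm _ h1.aemeasurable).symm
  simp_rw [hJ]
  have hJm : Measurable fun η : ProbabilityMeasure X => ∫⁻ y, G (mixDirac η y.1 y.2) ∂m :=
    hGm.lintegral_prod_right'
  rw [lintegral_map hG measurable_stickProbability,
    lintegral_map hJm measurable_stickProbability]
  calc ∫⁻ z, G (stickProbability z) ∂P
      = ∫⁻ z, G (stickProbability z) ∂((m.prod P).map fun p => consSeq p.1 p.2) := by
        rw [map_consSeq_infinitePi]
    _ = ∫⁻ y, ∫⁻ z, G (stickProbability (consSeq y z)) ∂P ∂m := by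
        have h0 : Measurable fun z : ℕ → X × unitInterval => G (stickProbability z) :=
          hG.comp measurable_stickProbability
        have h1 : Measurable fun p : (X × unitInterval) × (ℕ → X × unitInterval) =>
            G (stickProbability (consSeq p.1 p.2)) := h0.comp measurable_consSeq
        rw [lintegral_map h0 measurable_consSeq, lintegral_prod _ h1.aemeasurable]
    _ = ∫⁻ y, ∫⁻ z, G (mixDirac (stickProbability z) y.1 y.2) ∂P ∂m := by
        refine lintegral_congr fun y => lintegral_congr_ae ?_
        filter_upwards [ae_stickMeasure_univ_eq_one hβ ν] with z hz
        rw [stickProbability_consSeq hz]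
    _ = ∫⁻ z, ∫⁻ y, G (mixDirac (stickProbability z) y.1 y.2) ∂m ∂P := by
        refine lintegral_lintegral_swap ?_
        exact (hGm.comp ((measurable_stickProbability.comp measurable_snd).prodMk
          measurable_fst)).aemeasurable

end Existence

/-! ### The Mecke identity for the stationary law -/

theorem lintegral_Icc_comp_mul_left {c : ℝ} (hc : 0 < c) (k : ℝ → ℝ≥0∞) :
    ∫⁻ s in Icc (0 : ℝ) 1, ENNReal.ofReal c * k (c * s) = ∫⁻ b in Icc 0 c, k b := by
  have h := lintegral_image_eq_lintegral_abs_deriv_mul (f := fun s : ℝ => c * s)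
    (f' := fun _ => c) (s := Icc (0 : ℝ) 1) measurableSet_Icc
    (fun x _ => by simpa using ((hasDerivAt_id x).const_mul c).hasDerivWithinAt)
    (fun x _ y _ h => mul_left_cancel₀ hc.ne' h) k
  have himg : (fun s : ℝ => c * s) '' Icc 0 1 = Icc 0 c := by
    simp [Set.image_mul_left_Icc' hc]
  rw [himg, abs_of_pos hc] at h
  exact h.symm

/-- The density of the two first weights of a size-biased stick breaking. -/
noncomputable def simplexDensity (β a b : ℝ) : ℝ≥0∞ :=
  if 0 ≤ a ∧ 0 ≤ b ∧ a + b ≤ 1 then ENNReal.ofReal (β ^ 2 * (1 - a - b) ^ (β - 1)) else 0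

theorem simplexDensity_comm (β a b : ℝ) : simplexDensity β a b = simplexDensity β b a := by
  have h : (0 ≤ a ∧ 0 ≤ b ∧ a + b ≤ 1) ↔ (0 ≤ b ∧ 0 ≤ a ∧ b + a ≤ 1) := by
    rw [add_comm a b]; tauto
  simp only [simplexDensity, h]
  congr 4; ring

theorem measurable_simplexDensity (β : ℝ) :
    Measurable fun p : ℝ × ℝ => simplexDensity β p.1 p.2 := by
  have h : MeasurableSet {p : ℝ × ℝ | 0 ≤ p.1 ∧ 0 ≤ p.2 ∧ p.1 + p.2 ≤ 1} := by
    have h1 : MeasurableSet {p : ℝ × ℝ | 0 ≤ p.1} :=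
      measurableSet_le measurable_const measurable_fst
    have h2 : MeasurableSet {p : ℝ × ℝ | 0 ≤ p.2} :=
      measurableSet_le measurable_const measurable_snd
    have h3 : MeasurableSet {p : ℝ × ℝ | p.1 + p.2 ≤ 1} :=
      measurableSet_le (by fun_prop) measurable_const
    exact h1.inter (h2.inter h3)
  exact Measurable.ite h (by fun_prop) measurable_const

/-- The substitution b = (1 - a) s has Jacobian 1 - a, which is exactly the weight in the integrand;
the remaining powers combine to β² (1 - a - b)^(β - 1) on the simplex. -/
theorem lintegral_betaOne_betaOne {β : ℝ} (hβ : 0 < β) {h : ℝ → ℝ → ℝ≥0∞}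
    (hh : Measurable (Function.uncurry h)) :
    ∫⁻ t, ∫⁻ s, ENNReal.ofReal (1 - (t : ℝ)) * h t ((1 - (t : ℝ)) * s) ∂betaOne β ∂betaOne β =
      ∫⁻ a, ∫⁻ b, simplexDensity β a b * h a b := by
  have := isProbabilityMeasure_betaOne hβ
  have hin : Measurable fun t : unitInterval =>
      ∫⁻ s, ENNReal.ofReal (1 - (t : ℝ)) * h t ((1 - (t : ℝ)) * s) ∂betaOne β := by
    refine Measurable.lintegral_prod_right'
      (f := fun p : unitInterval × unitInterval =>
        ENNReal.ofReal (1 - (p.1 : ℝ)) * h p.1 ((1 - (p.1 : ℝ)) * p.2)) ?_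
    refine Measurable.mul (by fun_prop) ?_
    exact hh.comp (by fun_prop :
      Measurable fun p : unitInterval × unitInterval => ((p.1 : ℝ), (1 - (p.1 : ℝ)) * (p.2 : ℝ)))
  rw [lintegral_betaOne β hin, ← lintegral_indicator measurableSet_Icc]
  -- The fibre over a = 1 degenerates, but this is a null set.
  have hne : ∀ᵐ a : ℝ, a ≠ 1 := by simp [ae_iff]
  refine lintegral_congr_ae ?_
  filter_upwards [hne] with a ha1
  by_cases ha : a ∈ Icc (0 : ℝ) 1
  · rw [indicator_of_mem ha, projIcc_of_mem _ ha]
    have hc : 0 < 1 - a := by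
      have := lt_of_le_of_ne ha.2 ha1
      linarith
    have hhs : Measurable fun s : unitInterval =>
        ENNReal.ofReal (1 - a) * h a ((1 - a) * s) := by
      refine Measurable.mul (by fun_prop) ?_
      exact hh.comp (by fun_prop : Measurable fun s : unitInterval => (a, (1 - a) * (s : ℝ)))
    have hdm : Measurable fun b => h a b := hh.comp measurable_prodMk_left
    rw [lintegral_betaOne β hhs]
    have e1 : ∫⁻ s in Icc (0 : ℝ) 1, ENNReal.ofReal (β * (1 - s) ^ (β - 1)) *
        (ENNReal.ofReal (1 - a) * h a ((1 - a) * (projIcc 0 1 zero_le_one s : ℝ))) =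
        ∫⁻ b in Icc 0 (1 - a), ENNReal.ofReal (β * (1 - b / (1 - a)) ^ (β - 1)) * h a b := by
      rw [← lintegral_Icc_comp_mul_left hc]
      refine setLIntegral_congr_fun measurableSet_Icc fun s hs => ?_
      simp only [projIcc_of_mem _ hs]
      rw [mul_div_cancel_left₀ _ hc.ne']
      ring
    rw [e1, ← lintegral_const_mul _ (by fun_prop), ← lintegral_indicator measurableSet_Icc]
    refine lintegral_congr fun b => ?_
    by_cases hb : b ∈ Icc 0 (1 - a)
    · rw [indicator_of_mem hb, simplexDensity, if_pos ⟨ha.1, hb.1, by linarith [hb.2]⟩,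
        ← mul_assoc, ← ENNReal.ofReal_mul (by positivity)]
      congr 2
      have hb0 : 0 ≤ 1 - b / (1 - a) := by
        rw [sub_nonneg, div_le_one hc]; exact hb.2
      have : 1 - a - b = (1 - a) * (1 - b / (1 - a)) := by field_simp
      rw [this, Real.mul_rpow hc.le hb0]
      ring
    · rw [indicator_of_notMem hb, simplexDensity, if_neg, zero_mul]
      rintro ⟨-, h2, h3⟩
      exact hb ⟨h2, by linarith⟩
  · rw [indicator_of_notMem ha]
    symm
    rw [lintegral_eq_zero_iff' ]
    · refine .of_forall fun b => ?_
      simp only [simplexDensity, Pi.zero_apply]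
      rw [if_neg, zero_mul]
      rintro ⟨h1, h2, h3⟩
      exact ha ⟨h1, by linarith⟩
    · exact (((measurable_simplexDensity β).comp measurable_prodMk_left).mul
        (hh.comp measurable_prodMk_left)).aemeasurable

/-- Under the weight 1 - t the pair (t, (1 - t) s) has a symmetric density, so the two coordinates
may be exchanged. -/
theorem lintegral_betaOne_swap {β : ℝ} (hβ : 0 < β) {h : ℝ → ℝ → ℝ≥0∞}
    (hh : Measurable (Function.uncurry h)) :
    ∫⁻ t, ∫⁻ s, ENNReal.ofReal (1 - (t : ℝ)) * h t ((1 - (t : ℝ)) * s) ∂betaOne β ∂betaOne β =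
      ∫⁻ s, ∫⁻ t, ENNReal.ofReal (1 - (s : ℝ)) * h ((1 - (s : ℝ)) * t) s
        ∂betaOne β ∂betaOne β := by
  have h1 := lintegral_betaOne_betaOne hβ hh
  have h2 := lintegral_betaOne_betaOne hβ (h := fun a b => h b a) (hh.comp measurable_swap)
  rw [h1, h2, lintegral_lintegral_swap]
  · simp_rw [simplexDensity_comm β]
  · exact ((measurable_simplexDensity β).mul hh).aemeasurable

section Mecke

variable {X : Type*} [MeasurableSpace X]

theorem measurable_comp_mixDirac {Z : Type*} [MeasurableSpace Z] {e : Z → ProbabilityMeasure X}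
    {x : Z → X} {t : Z → unitInterval} (he : Measurable e) (hx : Measurable x)
    (ht : Measurable t) : Measurable fun z => mixDirac (e z) (x z) (t z) := by
  have h := measurable_mixDirac.comp (he.prodMk (hx.prodMk ht))
  exact h

/-- On both sides x has weight q = (1 - s) t, y has weight s = (1 - q) p, and η has the rest. -/
theorem mixDirac_mixDirac (η : ProbabilityMeasure X) (x y : X) {p q s t : unitInterval}
    (h1 : (q : ℝ) = (1 - s) * t) (h2 : (1 - (q : ℝ)) * p = s) :
    mixDirac (mixDirac η y p) x q = mixDirac (mixDirac η x t) y s := by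
  have hp := p.2; have hq := q.2; have hs := s.2; have ht := t.2
  apply Subtype.ext
  change (mixDirac (mixDirac η y p) x q : Measure X) = (mixDirac (mixDirac η x t) y s : Measure X)
  simp only [coe_mixDirac, smul_add, smul_smul]
  rw [← ENNReal.ofReal_mul (by linarith [hq.2]), ← ENNReal.ofReal_mul (by linarith [hq.2]),
    ← ENNReal.ofReal_mul (by linarith [hs.2]), ← ENNReal.ofReal_mul (by linarith [hs.2]),
    h2, ← h1, add_right_comm]
  congr 3
  congr 1
  rw [mul_sub, h2, h1]
  ring

/-- The double mixture depends on the parameters only through the weights a and b of the two atoms,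
so the exchange of weights applies. The inner parameter is recovered as b / (1 - a); where the
division fails, at t = 1, the factor 1 - t vanishes. -/
theorem lintegral_mixDirac_swap {β : ℝ} (hβ : 0 < β) (η : ProbabilityMeasure X)
    {f : ProbabilityMeasure X → ℝ≥0∞} (hf : Measurable f) (x y : X) :
    ∫⁻ t, ∫⁻ s, ENNReal.ofReal (1 - (t : ℝ)) * f (mixDirac (mixDirac η y s) x t)
        ∂betaOne β ∂betaOne β =
      ∫⁻ s, ∫⁻ t, ENNReal.ofReal (1 - (s : ℝ)) * f (mixDirac (mixDirac η x t) y s)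
        ∂betaOne β ∂betaOne β := by
  let h : ℝ → ℝ → ℝ≥0∞ := fun a b =>
    f (mixDirac (mixDirac η y (projIcc 0 1 zero_le_one (b / (1 - a)))) x
      (projIcc 0 1 zero_le_one a))
  have hproj : Measurable (projIcc (0 : ℝ) 1 zero_le_one) := continuous_projIcc.measurable
  have hh : Measurable (Function.uncurry h) := by
    refine hf.comp ?_
    refine measurable_comp_mixDirac (measurable_comp_mixDirac measurable_const measurable_const ?_)
      measurable_const ?_
    · exact hproj.comp (by fun_prop)
    · exact hproj.comp measurable_fst
  have key := lintegral_betaOne_swap hβ hh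
  convert key using 3 with t t
  · refine lintegral_congr fun s => ?_
    rcases t.2.2.eq_or_lt with h1 | h1
    · simp [h1]
    · have h0 : (1 - (t : ℝ)) ≠ 0 := by linarith
      simp only [h, mul_div_cancel_left₀ _ h0, projIcc_val]
  · refine lintegral_congr fun s => ?_
    congr 1
    simp only [h]
    have hs := s.2; have ht := t.2
    have ha : (1 - (t : ℝ)) * s ∈ Icc (0 : ℝ) 1 :=
      ⟨mul_nonneg (by linarith [ht.2]) hs.1, mul_le_one₀ (by linarith [ht.1]) hs.1 hs.2⟩
    have hst : (t : ℝ) ≤ 1 - (1 - (t : ℝ)) * s := by nlinarith [hs.2, ht.2]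
    have hb : (t : ℝ) / (1 - (1 - (t : ℝ)) * s) ∈ Icc (0 : ℝ) 1 :=
      ⟨div_nonneg ht.1 (ht.1.trans hst), div_le_one_of_le₀ hst (ht.1.trans hst)⟩
    rw [projIcc_of_mem _ ha, projIcc_of_mem _ hb]
    refine congrArg f (mixDirac_mixDirac η x y rfl ?_).symm
    change (1 - (1 - (t : ℝ)) * s) * (t / (1 - (1 - (t : ℝ)) * s)) = t
    -- A vanishing denominator forces t = 0, so the value of the division is irrelevant.
    rcases eq_or_ne (1 - (1 - (t : ℝ)) * s) 0 with h0 | h0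
    · rw [h0] at hst
      rw [h0, zero_mul]
      linarith [ht.1]
    · field_simp

end Mecke

/-! ### The recursion satisfied by both sides of the Mecke identity -/

section Mecke

variable {X : Type*} [MeasurableSpace X]

/-- Averaging over one step of stick breaking, weighted by the mass of the remainder. -/
noncomputable def mixTransfer (m : Measure (X × unitInterval)) (F : ProbabilityMeasure X → X → ℝ≥0∞)
    (η : ProbabilityMeasure X) (x : X) : ℝ≥0∞ :=
  ∫⁻ y, ENNReal.ofReal (1 - (y.2 : ℝ)) * F (mixDirac η y.1 y.2) x ∂m

theorem measurable_mixTransfer (m : Measure (X × unitInterval)) [SFinite m]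
    {F : ProbabilityMeasure X → X → ℝ≥0∞} (hF : Measurable (Function.uncurry F)) :
    Measurable (Function.uncurry (mixTransfer m F)) := by
  refine Measurable.lintegral_prod_right' (f := fun p : (ProbabilityMeasure X × X) × X × unitInterval =>
    ENNReal.ofReal (1 - (p.2.2 : ℝ)) * F (mixDirac p.1.1 p.2.1 p.2.2) p.1.2) ?_
  refine Measurable.mul (by fun_prop) ?_
  have h := hF.comp ((measurable_comp_mixDirac (Z := (ProbabilityMeasure X × X) × X × unitInterval)
    (measurable_fst.comp measurable_fst) (measurable_fst.comp measurable_snd)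
    (measurable_snd.comp measurable_snd)).prodMk (measurable_snd.comp measurable_fst))
  exact h

variable {D : Measure (ProbabilityMeasure X)} {m : Measure (X × unitInterval)}

/-- Stationarity is applied to η ↦ ∫ F(η, x) dη(x). In the mixture, the part (1 - t) η produces
`mixTransfer` and the atom produces the remainder. -/
theorem lintegral_campbell_step [SFinite D] [SFinite m]
    (hD : ∀ G : ProbabilityMeasure X → ℝ≥0∞, Measurable G →
      ∫⁻ η, G η ∂D = ∫⁻ η, ∫⁻ y, G (mixDirac η y.1 y.2) ∂m ∂D)
    {F : ProbabilityMeasure X → X → ℝ≥0∞} (hF : Measurable (Function.uncurry F)) :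
    ∫⁻ η, ∫⁻ x, F η x ∂(η : Measure X) ∂D =
      ∫⁻ η, ∫⁻ x, mixTransfer m F η x ∂(η : Measure X) ∂D +
        ∫⁻ η, ∫⁻ y, ENNReal.ofReal (y.2 : ℝ) * F (mixDirac η y.1 y.2) y.1 ∂m ∂D := by
  have hF2 : ∀ η : ProbabilityMeasure X, Measurable (Function.uncurry
      fun (x : X) (y : X × unitInterval) =>
        ENNReal.ofReal (1 - (y.2 : ℝ)) * F (mixDirac η y.1 y.2) x) := by
    intro η
    refine Measurable.mul (by fun_prop) ?_
    have h := hF.comp ((measurable_comp_mixDirac (Z := X × X × unitInterval)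
      (measurable_const (a := η)) (measurable_fst.comp measurable_snd)
      (measurable_snd.comp measurable_snd)).prodMk measurable_fst)
    exact h
  have hF3 : Measurable fun p : ProbabilityMeasure X × X × unitInterval =>
      ENNReal.ofReal (p.2.2 : ℝ) * F (mixDirac p.1 p.2.1 p.2.2) p.2.1 := by
    refine Measurable.mul (by fun_prop) ?_
    have h := hF.comp (measurable_mixDirac.prodMk (measurable_fst.comp measurable_snd))
    exact h
  rw [hD _ (ProbabilityMeasure.measurable_lintegral_param hF)]
  rw [← lintegral_add_right]
  · refine lintegral_congr fun η => ?_
    have e1 : ∀ y : X × unitInterval,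
        ∫⁻ x, F (mixDirac η y.1 y.2) x ∂(mixDirac η y.1 y.2 : Measure X) =
          ∫⁻ x, ENNReal.ofReal (1 - (y.2 : ℝ)) * F (mixDirac η y.1 y.2) x ∂(η : Measure X) +
            ENNReal.ofReal (y.2 : ℝ) * F (mixDirac η y.1 y.2) y.1 := by
      intro y
      have hm : Measurable (F (mixDirac η y.1 y.2)) := hF.comp measurable_prodMk_left
      rw [lintegral_mixDirac _ _ _ hm, lintegral_const_mul _ hm]
    simp_rw [e1]
    rw [lintegral_add_right]
    · congr 1
      simp only [mixTransfer]
      exact lintegral_lintegral_swap (μ := m) (ν := (η : Measure X))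
        (f := fun y x => ENNReal.ofReal (1 - (y.2 : ℝ)) * F (mixDirac η y.1 y.2) x)
        ((hF2 η).comp measurable_swap).aemeasurable
    · have h := hF3.comp (measurable_prodMk_left (x := η))
      exact h
  · exact hF3.lintegral_prod_right'

/-- Writing 1 = (1 - t) + t splits off the same remainder as in `lintegral_campbell_step`. In the
other part stationarity replaces η by one more mixture, and exchanging the two atoms turns the
result into `mixTransfer`. -/
theorem lintegral_mecke_step {β : ℝ} (hβ : 0 < β) (ν : ProbabilityMeasure X) [SFinite D]
    (hm : m = (ν : Measure X).prod (betaOne β))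
    (hD : ∀ G : ProbabilityMeasure X → ℝ≥0∞, Measurable G →
      ∫⁻ η, G η ∂D = ∫⁻ η, ∫⁻ y, G (mixDirac η y.1 y.2) ∂m ∂D)
    {F : ProbabilityMeasure X → X → ℝ≥0∞} (hF : Measurable (Function.uncurry F)) :
    ∫⁻ η, ∫⁻ y, F (mixDirac η y.1 y.2) y.1 ∂m ∂D =
      ∫⁻ η, ∫⁻ y, mixTransfer m F (mixDirac η y.1 y.2) y.1 ∂m ∂D +
        ∫⁻ η, ∫⁻ y, ENNReal.ofReal (y.2 : ℝ) * F (mixDirac η y.1 y.2) y.1 ∂m ∂D := by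
  have := isProbabilityMeasure_betaOne hβ
  have : SFinite m := by rw [hm]; infer_instance
  have hF1 : Measurable fun p : ProbabilityMeasure X × X × unitInterval =>
      F (mixDirac p.1 p.2.1 p.2.2) p.2.1 := by
    have h := hF.comp (measurable_mixDirac.prodMk (measurable_fst.comp measurable_snd))
    exact h
  have hF3 : Measurable fun p : ProbabilityMeasure X × X × unitInterval =>
      ENNReal.ofReal (p.2.2 : ℝ) * F (mixDirac p.1 p.2.1 p.2.2) p.2.1 :=
    Measurable.mul (by fun_prop) hF1
  have hF4 : Measurable fun p : ProbabilityMeasure X × X × unitInterval =>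
      ENNReal.ofReal (1 - (p.2.2 : ℝ)) * F (mixDirac p.1 p.2.1 p.2.2) p.2.1 :=
    Measurable.mul (by fun_prop) hF1
  have e1 : ∫⁻ η, ∫⁻ y, F (mixDirac η y.1 y.2) y.1 ∂m ∂D =
      ∫⁻ η, ∫⁻ y, ENNReal.ofReal (1 - (y.2 : ℝ)) * F (mixDirac η y.1 y.2) y.1 ∂m ∂D +
        ∫⁻ η, ∫⁻ y, ENNReal.ofReal (y.2 : ℝ) * F (mixDirac η y.1 y.2) y.1 ∂m ∂D := by
    rw [← lintegral_add_right _ hF3.lintegral_prod_right']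
    refine lintegral_congr fun η => ?_
    rw [← lintegral_add_right _ (by
      have h := hF3.comp (measurable_prodMk_left (x := η)); exact h)]
    refine lintegral_congr fun y => ?_
    rw [← add_mul, ofReal_one_sub_add, one_mul]
  rw [e1]
  congr 1
  rw [hD _ hF4.lintegral_prod_right']
  refine lintegral_congr fun η => ?_
  simp only [mixTransfer]
  have hq : Measurable fun q : (X × unitInterval) × (X × unitInterval) =>
      ENNReal.ofReal (1 - (q.2.2 : ℝ)) *
        F (mixDirac (mixDirac η q.1.1 q.1.2) q.2.1 q.2.2) q.2.1 := by
    refine Measurable.mul (by fun_prop) ?_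
    have h := hF.comp ((measurable_comp_mixDirac
      (Z := (X × unitInterval) × (X × unitInterval))
      (measurable_comp_mixDirac (measurable_const (a := η)) (measurable_fst.comp measurable_fst)
        (measurable_snd.comp measurable_fst)) (measurable_fst.comp measurable_snd)
      (measurable_snd.comp measurable_snd)).prodMk (measurable_fst.comp measurable_snd))
    exact h
  have hq' : Measurable fun q : (X × unitInterval) × (X × unitInterval) =>
      ENNReal.ofReal (1 - (q.2.2 : ℝ)) *
        F (mixDirac (mixDirac η q.1.1 q.1.2) q.2.1 q.2.2) q.1.1 := by
    refine Measurable.mul (by fun_prop) ?_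
    have h := hF.comp ((measurable_comp_mixDirac
      (Z := (X × unitInterval) × (X × unitInterval))
      (measurable_comp_mixDirac (measurable_const (a := η)) (measurable_fst.comp measurable_fst)
        (measurable_snd.comp measurable_fst)) (measurable_fst.comp measurable_snd)
      (measurable_snd.comp measurable_snd)).prodMk (measurable_fst.comp measurable_fst))
    exact h
  -- Puts the two positions outside and the two Beta parameters inside, which is the form in which
  -- the weights can be exchanged.
  have split : ∀ f : (X × unitInterval) × (X × unitInterval) → ℝ≥0∞, Measurable f →
      ∫⁻ w, ∫⁻ y, f (w, y) ∂m ∂m =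
        ∫⁻ a, ∫⁻ b, ∫⁻ s, ∫⁻ t, f ((a, s), (b, t)) ∂betaOne β ∂betaOne β
          ∂(ν : Measure X) ∂(ν : Measure X) := by
    intro f hf
    rw [hm, lintegral_prod _ hf.lintegral_prod_right'.aemeasurable]
    refine lintegral_congr fun a => ?_
    have e : ∀ s, ∫⁻ y, f ((a, s), y) ∂(ν : Measure X).prod (betaOne β) =
        ∫⁻ b, ∫⁻ t, f ((a, s), (b, t)) ∂betaOne β ∂(ν : Measure X) := fun s =>
      lintegral_prod _ (hf.comp measurable_prodMk_left).aemeasurable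
    simp_rw [e]
    refine lintegral_lintegral_swap
      (f := fun s b => ∫⁻ t, f ((a, s), (b, t)) ∂betaOne β) ?_
    refine Measurable.aemeasurable ?_
    refine Measurable.lintegral_prod_right'
      (f := fun p : (unitInterval × X) × unitInterval => f ((a, p.1.1), (p.1.2, p.2))) ?_
    exact hf.comp (by fun_prop)
  have h1 := split _ hq
  have h2 := split _ hq'
  refine h1.trans (Eq.trans ?_ h2.symm)
  rw [lintegral_lintegral_swap]
  · refine lintegral_congr fun x => lintegral_congr fun y => ?_
    have h3 := lintegral_mixDirac_swap hβ η (f := fun η' => F η' x)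
      (hF.comp measurable_prodMk_right) x y
    refine Eq.trans ?_ (h3.trans ?_)
    · refine lintegral_lintegral_swap (Measurable.aemeasurable ?_)
      have h := hq.comp (by fun_prop : Measurable fun p : unitInterval × unitInterval =>
        ((y, p.1), (x, p.2)))
      exact h
    · refine lintegral_lintegral_swap (Measurable.aemeasurable ?_)
      have h := hq'.comp (by fun_prop : Measurable fun p : unitInterval × unitInterval =>
        ((x, p.2), (y, p.1)))
      exact h
  · refine Measurable.aemeasurable ?_
    refine Measurable.lintegral_prod_right' (f := fun p : (X × X) × unitInterval =>
      ∫⁻ t, ENNReal.ofReal (1 - (t : ℝ)) *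
        F (mixDirac (mixDirac η p.1.1 p.2) p.1.2 t) p.1.2 ∂betaOne β) ?_
    refine Measurable.lintegral_prod_right' (f := fun p : ((X × X) × unitInterval) × unitInterval =>
      ENNReal.ofReal (1 - (p.2 : ℝ)) *
        F (mixDirac (mixDirac η p.1.1.1 p.1.2) p.1.1.2 p.2) p.1.1.2) ?_
    have h := hq.comp (by fun_prop : Measurable fun p : ((X × X) × unitInterval) × unitInterval =>
      ((p.1.1.1, p.1.2), (p.1.1.2, p.2)))
    exact h

theorem lintegral_eq_iSup_lintegral_min {Z : Type*} [MeasurableSpace Z] (μ : Measure Z)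
    {f : Z → ℝ≥0∞} (hf : Measurable f) :
    ∫⁻ z, f z ∂μ = ⨆ n : ℕ, ∫⁻ z, min (f z) (n : ℝ≥0∞) ∂μ := by
  have hmono : ∀ a : ℝ≥0∞, Monotone fun n : ℕ => min a (n : ℝ≥0∞) :=
    fun a i j hij => min_le_min_left _ (by exact_mod_cast hij)
  rw [← lintegral_iSup (f := fun (n : ℕ) z => min (f z) (n : ℝ≥0∞))
    (fun n => hf.min measurable_const) (fun i j hij z => hmono _ hij)]
  refine lintegral_congr fun z => ?_
  have h : Filter.Tendsto (fun n : ℕ => min (f z) (n : ℝ≥0∞)) Filter.atTop (𝓝 (min (f z) ⊤)) :=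
    tendsto_const_nhds.min ENNReal.tendsto_nat_nhds_top
  rw [min_top_right] at h
  exact tendsto_nhds_unique h (tendsto_atTop_iSup (hmono _))

/-- A law that is stationary under mixing with independent Dirac masses satisfies the Mecke
identity. -/
theorem mecke_of_stationary {β : ℝ} (hβ : 0 < β) (ν : ProbabilityMeasure X)
    [IsProbabilityMeasure D] (hm : m = (ν : Measure X).prod (betaOne β))
    (hD : ∀ G : ProbabilityMeasure X → ℝ≥0∞, Measurable G →
      ∫⁻ η, G η ∂D = ∫⁻ η, ∫⁻ y, G (mixDirac η y.1 y.2) ∂m ∂D)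
    {F : ProbabilityMeasure X → X → ℝ≥0∞} (hF : Measurable (Function.uncurry F)) :
    ∫⁻ η, ∫⁻ x, F η x ∂(η : Measure X) ∂D = ∫⁻ η, ∫⁻ y, F (mixDirac η y.1 y.2) y.1 ∂m ∂D := by
  have := isProbabilityMeasure_betaOne hβ
  have : IsProbabilityMeasure m := by rw [hm]; infer_instance
  set q := ∫⁻ t, ENNReal.ofReal (1 - (t : ℝ)) ∂betaOne β with hq
  have hq1 : q < 1 := lintegral_one_sub_betaOne_lt_one hβ
  have hqm : ∫⁻ y, ENNReal.ofReal (1 - (y.2 : ℝ)) ∂m = q := by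
    rw [hm, lintegral_prod _ (by fun_prop)]
    simp [hq]
  -- Both sides satisfy Φ(F) = Φ(mixTransfer m F) + R(F) with the same R, and `mixTransfer` shrinks
  -- a bound C to q * C; after n steps they differ by at most C * q ^ n.
  have bound : ∀ (n : ℕ) (F : ProbabilityMeasure X → X → ℝ≥0∞),
      Measurable (Function.uncurry F) → ∀ C : ℝ≥0∞, (∀ η x, F η x ≤ C) →
      (∫⁻ η, ∫⁻ x, F η x ∂(η : Measure X) ∂D ≤
          ∫⁻ η, ∫⁻ y, F (mixDirac η y.1 y.2) y.1 ∂m ∂D + C * q ^ n) ∧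
        (∫⁻ η, ∫⁻ y, F (mixDirac η y.1 y.2) y.1 ∂m ∂D ≤
          ∫⁻ η, ∫⁻ x, F η x ∂(η : Measure X) ∂D + C * q ^ n) := by
    intro n
    induction n with
    | zero =>
      intro F hF C hC
      have h1 : ∫⁻ η, ∫⁻ x, F η x ∂(η : Measure X) ∂D ≤ C := by
        calc _ ≤ ∫⁻ η, ∫⁻ x, C ∂((η : ProbabilityMeasure X) : Measure X) ∂D :=
              lintegral_mono fun η => lintegral_mono fun x => hC η x
          _ = C := by simp
      have h2 : ∫⁻ η, ∫⁻ y, F (mixDirac η y.1 y.2) y.1 ∂m ∂D ≤ C := by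
        calc _ ≤ ∫⁻ η, ∫⁻ y, C ∂m ∂D :=
              lintegral_mono fun η => lintegral_mono fun x => hC _ _
          _ = C := by simp
      rw [pow_zero, mul_one]
      exact ⟨h1.trans le_add_self, h2.trans le_add_self⟩
    | succ n ih =>
      intro F hF C hC
      have hT : ∀ η x, mixTransfer m F η x ≤ q * C := by
        intro η x
        rw [← hqm, ← lintegral_mul_const _ (by fun_prop)]
        exact lintegral_mono fun y => mul_le_mul_right (hC _ _) _
      obtain ⟨i1, i2⟩ := ih _ (measurable_mixTransfer m hF) _ hT
      rw [lintegral_campbell_step hD hF, lintegral_mecke_step hβ ν hm hD hF,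
        show C * q ^ (n + 1) = q * C * q ^ n by ring, add_right_comm, add_right_comm _ _ (_ * _)]
      exact ⟨add_le_add_left i1 _, add_le_add_left i2 _⟩
  have hlim : ∀ C : ℝ≥0∞, C ≠ ⊤ → ∀ a : ℝ≥0∞,
      Filter.Tendsto (fun n : ℕ => a + C * q ^ n) Filter.atTop (𝓝 a) := by
    intro C hC a
    have h := (ENNReal.Tendsto.const_mul (ENNReal.tendsto_pow_atTop_nhds_zero_of_lt_one hq1)
      (Or.inr hC)).const_add a
    simpa using h
  have hbdd : ∀ F : ProbabilityMeasure X → X → ℝ≥0∞,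
      Measurable (Function.uncurry F) → ∀ C : ℝ≥0∞, C ≠ ⊤ → (∀ η x, F η x ≤ C) →
      ∫⁻ η, ∫⁻ x, F η x ∂(η : Measure X) ∂D =
        ∫⁻ η, ∫⁻ y, F (mixDirac η y.1 y.2) y.1 ∂m ∂D := by
    intro F hF C hC hFC
    exact le_antisymm (ge_of_tendsto' (hlim C hC _) fun n => (bound n F hF C hFC).1)
      (ge_of_tendsto' (hlim C hC _) fun n => (bound n F hF C hFC).2)
  -- Truncation at n and monotone convergence remove the bound on F.
  have hmin : ∀ n : ℕ, Measurable (Function.uncurry fun η x => min (F η x) (n : ℝ≥0∞)) :=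
    fun n => hF.min measurable_const
  have hmono : ∀ a : ℝ≥0∞, Monotone fun n : ℕ => min a (n : ℝ≥0∞) :=
    fun a i j hij => min_le_min_left _ (by exact_mod_cast hij)
  have hF1 : ∀ n : ℕ, Measurable fun p : ProbabilityMeasure X × X × unitInterval =>
      min (F (mixDirac p.1 p.2.1 p.2.2) p.2.1) (n : ℝ≥0∞) := by
    intro n
    have h := (hmin n).comp (measurable_mixDirac.prodMk (measurable_fst.comp measurable_snd))
    exact h
  have eL : ∫⁻ η, ∫⁻ x, F η x ∂(η : Measure X) ∂D =
      ⨆ n : ℕ, ∫⁻ η, ∫⁻ x, min (F η x) (n : ℝ≥0∞) ∂(η : Measure X) ∂D := by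
    rw [← lintegral_iSup (fun n => ProbabilityMeasure.measurable_lintegral_param (hmin n))
      (fun i j hij η => lintegral_mono fun x => hmono _ hij)]
    exact lintegral_congr fun η =>
      lintegral_eq_iSup_lintegral_min _ (hF.comp measurable_prodMk_left)
  have eR : ∫⁻ η, ∫⁻ y, F (mixDirac η y.1 y.2) y.1 ∂m ∂D =
      ⨆ n : ℕ, ∫⁻ η, ∫⁻ y, min (F (mixDirac η y.1 y.2) y.1) (n : ℝ≥0∞) ∂m ∂D := by
    rw [← lintegral_iSup (fun n => (hF1 n).lintegral_prod_right')
      (fun i j hij η => lintegral_mono fun x => hmono _ hij)]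
    refine lintegral_congr fun η => lintegral_eq_iSup_lintegral_min _ ?_
    have h := hF.comp ((measurable_mixDirac_right η).prodMk measurable_fst)
    exact h
  rw [eL, eR]
  exact iSup_congr fun n =>
    hbdd _ (hmin n) n (ENNReal.natCast_ne_top n) fun η x => min_le_right _ _

/-- Only existence is needed. Everything below uses `dirichletFerguson` through this property alone,
so uniqueness of the solution plays no role. -/
theorem isDirichletFerguson_dirichletFerguson {β : ℝ} (hβ : 0 < β) (ν : ProbabilityMeasure X) :
    IsDirichletFerguson β ν (dirichletFerguson β ν) := by
  refine Classical.epsilon_spec_aux ⟨0⟩ _ ?_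
  have := isProbabilityMeasure_betaOne hβ
  obtain ⟨D, hD, hstat⟩ := exists_stationary_mixDirac hβ ν
  have hprod : ∀ f : X × unitInterval → ℝ≥0∞, Measurable f →
      ∫⁻ t, ∫⁻ x, f (x, t) ∂(ν : Measure X) ∂(betaOne β) =
        ∫⁻ y, f y ∂(ν : Measure X).prod (betaOne β) := fun f hf =>
    (lintegral_prod_symm _ hf.aemeasurable).symm
  refine ⟨D, hD, fun F hF => ?_⟩
  rw [mecke_of_stationary hβ ν rfl (fun G hG => ?_) hF]
  · refine lintegral_congr fun η => (hprod (fun y => F (mixDirac η y.1 y.2) y.1) ?_).symm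
    have h := hF.comp ((measurable_mixDirac_right η).prodMk measurable_fst)
    exact h
  · rw [hstat G hG]
    refine lintegral_congr fun η => hprod (fun y => G (mixDirac η y.1 y.2)) ?_
    exact hG.comp (measurable_mixDirac_right η)

end Mecke

/-! ### Exponential functionals of finite measures along rays of multipliers -/

/-- The solution of the Volterra equation `A 0 = A t + l ∫₀ᵗ A`. -/
theorem eq_mul_exp_of_volterra {A : ℝ → ℝ≥0∞} (hA : Measurable A) {l : ℝ≥0} (h0 : A 0 ≠ ⊤)
    (h : ∀ t, 0 ≤ t → A 0 = A t + ∫⁻ s in Ioc 0 t, l * A s) {t : ℝ} (ht : 0 ≤ t) :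
    A t = A 0 * ENNReal.ofReal (Real.exp (-(l * t))) := by
  -- The integral term is nonnegative, so A is bounded by A 0 on the half-line and the equation can
  -- be read in ℝ.
  have hle : ∀ s, 0 ≤ s → A s ≤ A 0 := fun s hs => by rw [h s hs]; exact le_self_add
  have hfin : ∀ s, 0 ≤ s → A s ≠ ⊤ := fun s hs => ne_top_of_le_ne_top h0 (hle s hs)
  let a : ℝ → ℝ := fun s => (A s).toReal
  have ham : Measurable a := hA.ennreal_toReal
  have hint : ∀ u v : ℝ, 0 ≤ u → 0 ≤ v → IntervalIntegrable a volume u v := by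
    intro u v hu hv
    rw [intervalIntegrable_iff]
    refine Measure.integrableOn_of_bounded (M := (A 0).toReal) (by simp)
      ham.aestronglyMeasurable ?_
    filter_upwards [ae_restrict_mem measurableSet_uIoc] with s hs
    have hs0 : 0 ≤ s := by
      rcases le_total u v with huv | huv
      · rw [uIoc_of_le huv] at hs; exact hu.trans hs.1.le
      · rw [uIoc_of_ge huv] at hs; exact hv.trans hs.1.le
    rw [Real.norm_eq_abs, abs_of_nonneg ENNReal.toReal_nonneg]
    exact ENNReal.toReal_mono h0 (hle s hs0)
  have heq : ∀ s, 0 ≤ s → a s = a 0 - l * ∫ u in (0 : ℝ)..s, a u := by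
    intro s hs
    have e : (∫⁻ u in Ioc 0 s, l * A u).toReal = l * ∫ u in (0 : ℝ)..s, a u := by
      rw [intervalIntegral.integral_of_le hs, ← integral_const_mul,
        integral_eq_lintegral_of_nonneg_ae (f := fun u => (l : ℝ) * a u)
          (.of_forall fun u => mul_nonneg l.2 ENNReal.toReal_nonneg)
          (ham.const_mul _).aestronglyMeasurable]
      congr 1
      refine setLIntegral_congr_fun measurableSet_Ioc fun u hu => ?_
      simp only [a]
      rw [ENNReal.ofReal_mul l.coe_nonneg, ENNReal.ofReal_toReal (hfin u hu.1.le)]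
      simp
    have hI : ∫⁻ u in Ioc 0 s, l * A u ≠ ⊤ :=
      ne_top_of_le_ne_top h0 (by rw [h s hs]; exact le_add_self)
    have h1 : a 0 = a s + (∫⁻ u in Ioc 0 s, l * A u).toReal := by
      simp only [a]
      rw [← ENNReal.toReal_add (hfin s hs) hI, ← h s hs]
    rw [← e]; linarith
  -- A is only assumed measurable; the integral equation itself makes it continuous and then right
  -- differentiable.
  have hcont : ContinuousOn a (Icc 0 t) := by
    have hI : ContinuousOn (fun s => ∫ u in (0 : ℝ)..s, a u) (Icc 0 t) :=
      intervalIntegral.continuousOn_primitive_interval'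
        (hint 0 t le_rfl ht) (by simp [ht]) |>.mono (by rw [uIcc_of_le ht])
    exact (continuousOn_const.sub (continuousOn_const.mul hI)).congr fun s hs => heq s hs.1
  have hderiv : ∀ s ∈ Ico 0 t, HasDerivWithinAt a (-(l * a s)) (Ici s) s := by
    intro s hs
    have hc : ContinuousWithinAt a (Ici s) s := by
      have := hcont s ⟨hs.1, hs.2.le⟩
      refine (this.mono_of_mem_nhdsWithin ?_)
      refine Filter.mem_of_superset (inter_mem_nhdsWithin _ (Iio_mem_nhds hs.2)) ?_
      rintro u ⟨h1, h2⟩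
      exact ⟨hs.1.trans h1, le_of_lt h2⟩
    have hd : HasDerivWithinAt (fun s => ∫ u in (0 : ℝ)..s, a u) (a s) (Ici s) s :=
      intervalIntegral.integral_hasDerivWithinAt_right (hint 0 s le_rfl hs.1)
        (ham.stronglyMeasurable.stronglyMeasurableAtFilter) (hc.mono Ioi_subset_Ici_self)
    have := (hd.const_mul (l : ℝ)).const_sub (a 0)
    exact this.congr (fun u hu => heq u (hs.1.trans hu)) (heq s hs.1)
  -- The integrating factor e^(l s) turns a' = -l a into a vanishing right derivative.
  have hconst : ∀ s ∈ Icc 0 t, Real.exp (l * s) * a s = Real.exp (l * 0) * a 0 := by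
    refine constant_of_has_deriv_right_zero (f := fun s => Real.exp (l * s) * a s) (by fun_prop)
      fun s hs => ?_
    have h1 : HasDerivWithinAt (fun s : ℝ => Real.exp (l * s)) (Real.exp (l * s) * l) (Ici s) s := by
      have := ((hasDerivAt_id s).const_mul (l : ℝ)).exp
      simpa using this.hasDerivWithinAt
    have h2 := h1.mul (hderiv s hs)
    rw [show Real.exp (l * s) * l * a s + Real.exp (l * s) * -(l * a s) = 0 by ring] at h2
    exact h2
  have hfinal := hconst t ⟨ht, le_rfl⟩
  have hat : a t = a 0 * Real.exp (-(l * t)) := by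
    rw [Real.exp_neg, ← div_eq_mul_inv, eq_div_iff (Real.exp_pos _).ne']
    simp only [mul_zero, Real.exp_zero, one_mul] at hfinal
    linarith
  rw [← ENNReal.ofReal_toReal (hfin t ht), ← ENNReal.ofReal_toReal h0,
    ← ENNReal.ofReal_mul ENNReal.toReal_nonneg]
  exact congrArg _ hat

section Ray

variable {X : Type*} [MeasurableSpace X]

/-- The integral of `e ^ (s a)`. -/
noncomputable def expMass (a : X → ℝ) (s : ℝ) (μ : FiniteMeasure X) : ℝ≥0∞ :=
  ∫⁻ x, ENNReal.ofReal (Real.exp (s * a x)) ∂(μ : Measure X)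

theorem integrable_of_abs_le {f : X → ℝ} (hf : Measurable f) {C : ℝ} (hC : ∀ x, |f x| ≤ C)
    (μ : FiniteMeasure X) : Integrable f (μ : Measure X) :=
  Integrable.of_bound hf.aestronglyMeasurable C (.of_forall hC)

theorem abs_exp_mul_le {Y : Type*} {a : Y → ℝ} {C : ℝ} (h0 : ∀ x, 0 ≤ a x) (hC : ∀ x, a x ≤ C)
    {s r : ℝ} (hs : |s| ≤ r) (x : Y) : |Real.exp (s * a x)| ≤ Real.exp (r * C) := by
  rw [abs_of_pos (Real.exp_pos _), Real.exp_le_exp]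
  calc s * a x ≤ |s| * a x := mul_le_mul_of_nonneg_right (le_abs_self s) (h0 x)
    _ ≤ r * C := mul_le_mul hs (hC x) (h0 x) ((abs_nonneg s).trans hs)

theorem expMass_eq {a : X → ℝ} (ha : Measurable a) {C : ℝ} (h0 : ∀ x, 0 ≤ a x)
    (hC : ∀ x, a x ≤ C) (s : ℝ) (μ : FiniteMeasure X) :
    expMass a s μ = ENNReal.ofReal (∫ x, Real.exp (s * a x) ∂(μ : Measure X)) := by
  rw [ofReal_integral_eq_lintegral_ofReal
    (integrable_of_abs_le (by fun_prop) (abs_exp_mul_le h0 hC le_rfl) μ)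
    (.of_forall fun x => (Real.exp_pos _).le)]
  rfl

/-- Near s the derivative of the integrand is bounded by a constant, which is integrable because μ
is finite. -/
theorem hasDerivAt_integral_exp {a : X → ℝ} (ha : Measurable a) {C : ℝ} (h0 : ∀ x, 0 ≤ a x)
    (hC : ∀ x, a x ≤ C) (s : ℝ) (μ : FiniteMeasure X) :
    HasDerivAt (fun s => ∫ x, Real.exp (s * a x) ∂(μ : Measure X))
      (∫ x, a x * Real.exp (s * a x) ∂(μ : Measure X)) s := by
  refine (hasDerivAt_integral_of_dominated_loc_of_deriv_le (s := Metric.ball s 1)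
    (F := fun s x => Real.exp (s * a x)) (F' := fun s x => a x * Real.exp (s * a x))
    (bound := fun _ => C * Real.exp ((|s| + 1) * C)) (Metric.ball_mem_nhds s one_pos)
    (.of_forall fun t => by fun_prop)
    (integrable_of_abs_le (by fun_prop) (abs_exp_mul_le h0 hC le_rfl) μ)
    (by fun_prop) ?_ (integrable_const _) ?_).2
  · refine .of_forall fun x t ht => ?_
    have ht' : |t| ≤ |s| + 1 := by
      have h1 : |t - s| < 1 := by simpa [Real.dist_eq] using ht
      have h2 := abs_sub_abs_le_abs_sub t s
      linarith
    rw [norm_mul, Real.norm_eq_abs, Real.norm_eq_abs, abs_of_nonneg (h0 x)]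
    exact mul_le_mul (hC x) (abs_exp_mul_le h0 hC ht' x) (abs_nonneg _) ((h0 x).trans (hC x))
  · refine .of_forall fun x t _ => ?_
    have h := ((hasDerivAt_id t).mul_const (a x)).exp
    rw [one_mul, mul_comm (Real.exp _)] at h
    exact h

/-- The fundamental theorem of calculus for s ↦ G(μ(e^(s a))), whose derivative is -g(μ(e^(s a)))
μ(a e^(s a)). The sign of g gives integrability of this derivative without any continuity of g. -/
theorem ofReal_comp_expMass {a : X → ℝ} (ha : Measurable a) {C : ℝ} (h0 : ∀ x, 0 ≤ a x)
    (hC : ∀ x, a x ≤ C) {G g : ℝ → ℝ} (hG : ∀ z, HasDerivAt G (-g z) z)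
    (hg0 : ∀ z, 0 ≤ g z) (hG0 : ∀ z, 0 ≤ G z) (μ : FiniteMeasure X)
    {t : ℝ} (ht : 0 ≤ t) :
    ENNReal.ofReal (G (expMass a 0 μ).toReal) = ENNReal.ofReal (G (expMass a t μ).toReal) +
      ∫⁻ s in Ioc 0 t, ENNReal.ofReal (g (expMass a s μ).toReal) *
        ∫⁻ x, ENNReal.ofReal (a x * Real.exp (s * a x)) ∂(μ : Measure X) := by
  let z : ℝ → ℝ := fun s => ∫ x, Real.exp (s * a x) ∂(μ : Measure X)
  let z' : ℝ → ℝ := fun s => ∫ x, a x * Real.exp (s * a x) ∂(μ : Measure X)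
  have hz0 : ∀ s, 0 ≤ z s := fun s => integral_nonneg fun x => (Real.exp_pos _).le
  have hz0' : ∀ s, 0 ≤ z' s := fun s =>
    integral_nonneg fun x => mul_nonneg (h0 x) (Real.exp_pos _).le
  have hzt : ∀ s, (expMass a s μ).toReal = z s := fun s => by
    rw [expMass_eq ha h0 hC, ENNReal.toReal_ofReal (hz0 s)]
  have hz't : ∀ s, ∫⁻ x, ENNReal.ofReal (a x * Real.exp (s * a x)) ∂(μ : Measure X) =
      ENNReal.ofReal (z' s) := by
    intro s
    refine (ofReal_integral_eq_lintegral_ofReal (integrable_of_abs_le (by fun_prop)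
      (C := C * Real.exp (|s| * C)) (fun x => ?_) μ)
      (.of_forall fun x => mul_nonneg (h0 x) (Real.exp_pos _).le)).symm
    rw [abs_mul, abs_of_nonneg (h0 x)]
    exact mul_le_mul (hC x) (abs_exp_mul_le h0 hC le_rfl x) (abs_nonneg _) ((h0 x).trans (hC x))
  have hd : ∀ s, HasDerivAt (fun s => -G (z s)) (g (z s) * z' s) s := by
    intro s
    have h := ((hG (z s)).comp s (hasDerivAt_integral_exp ha h0 hC s μ)).neg
    rw [show -(-g (∫ x, Real.exp (s * a x) ∂(μ : Measure X)) *
      ∫ x, a x * Real.exp (s * a x) ∂(μ : Measure X)) = g (z s) * z' s by simp only [z, z']; ring]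
      at h
    exact h
  have hnn : ∀ s, 0 ≤ g (z s) * z' s := fun s => mul_nonneg (hg0 _) (hz0' s)
  have hcont : ContinuousOn (fun s => -G (z s)) (Icc 0 t) :=
    fun s _ => (hd s).continuousAt.continuousWithinAt
  have hint : IntegrableOn (fun s => g (z s) * z' s) (Ioc 0 t) :=
    intervalIntegral.integrableOn_deriv_of_nonneg hcont (fun s _ => hd s) (fun s _ => hnn s)
  have hftc : ∫ s in (0 : ℝ)..t, g (z s) * z' s = -G (z t) - -G (z 0) :=
    intervalIntegral.integral_eq_sub_of_hasDerivAt (fun s _ => hd s)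
      ((intervalIntegrable_iff_integrableOn_Ioc_of_le ht).2 hint)
  simp only [hzt, hz't, ← ENNReal.ofReal_mul (hg0 _)]
  rw [← ofReal_integral_eq_lintegral_ofReal hint (.of_forall hnn),
    ← intervalIntegral.integral_of_le ht, hftc, ← ENNReal.ofReal_add (hG0 _)]
  · congr 1; ring
  · have : 0 ≤ ∫ s in (0 : ℝ)..t, g (z s) * z' s :=
      intervalIntegral.integral_nonneg ht fun s _ => hnn s
    linarith

theorem measurable_expMass {a : X → ℝ} (ha : Measurable a) :
    Measurable fun p : ℝ × FiniteMeasure X => expMass a p.1 p.2 :=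
  FiniteMeasure.measurable_lintegral_param (F := fun s x => ENNReal.ofReal (Real.exp (s * a x)))
    (by fun_prop)

/-- If the logarithmic derivative along the ray `s ↦ e ^ (s a)` of a functional of a measure is
constant, the functional decays exponentially. -/
theorem lintegral_comp_expMass {a : X → ℝ} (ha : Measurable a) {C : ℝ} (h0 : ∀ x, 0 ≤ a x)
    (hC : ∀ x, a x ≤ C) {G g : ℝ → ℝ} (hG : ∀ z, HasDerivAt G (-g z) z)
    (hg0 : ∀ z, 0 ≤ g z) (hG0 : ∀ z, 0 ≤ G z) (hgm : Measurable g) (hGm : Measurable G)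
    (Q : Measure (FiniteMeasure X)) [SFinite Q] {l : ℝ≥0}
    (hfin : ∫⁻ μ, ENNReal.ofReal (G (expMass a 0 μ).toReal) ∂Q ≠ ⊤)
    (hl : ∀ s, 0 ≤ s → ∫⁻ μ, ENNReal.ofReal (g (expMass a s μ).toReal) *
        ∫⁻ x, ENNReal.ofReal (a x * Real.exp (s * a x)) ∂(μ : Measure X) ∂Q =
      l * ∫⁻ μ, ENNReal.ofReal (G (expMass a s μ).toReal) ∂Q) :
    ∫⁻ μ, ENNReal.ofReal (G (expMass a 1 μ).toReal) ∂Q =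
      (∫⁻ μ, ENNReal.ofReal (G (expMass a 0 μ).toReal) ∂Q) * ENNReal.ofReal (Real.exp (-l)) := by
  have hm := measurable_expMass ha
  have hm1 : Measurable fun p : ℝ × FiniteMeasure X =>
      ENNReal.ofReal (G (expMass a p.1 p.2).toReal) :=
    (hGm.comp hm.ennreal_toReal).ennreal_ofReal
  have hm2 : Measurable fun p : ℝ × FiniteMeasure X =>
      ENNReal.ofReal (g (expMass a p.1 p.2).toReal) *
        ∫⁻ x, ENNReal.ofReal (a x * Real.exp (p.1 * a x)) ∂(p.2 : Measure X) :=
    ((hgm.comp hm.ennreal_toReal).ennreal_ofReal).mul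
      (FiniteMeasure.measurable_lintegral_param
        (F := fun s x => ENNReal.ofReal (a x * Real.exp (s * a x))) (by fun_prop))
  have := eq_mul_exp_of_volterra (l := l)
    (A := fun s => ∫⁻ μ, ENNReal.ofReal (G (expMass a s μ).toReal) ∂Q)
    hm1.lintegral_prod_right' hfin ?_ zero_le_one
  · simpa using this
  · intro t ht
    -- By Tonelli, `hl` integrated over s becomes a Q-integral of the identity for a single μ in
    -- `ofReal_comp_expMass`.
    have e1 : ∫⁻ s in Ioc 0 t, l * ∫⁻ μ, ENNReal.ofReal (G (expMass a s μ).toReal) ∂Q =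
        ∫⁻ μ, (∫⁻ s in Ioc 0 t, ENNReal.ofReal (g (expMass a s μ).toReal) *
          ∫⁻ x, ENNReal.ofReal (a x * Real.exp (s * a x)) ∂(μ : Measure X)) ∂Q := by
      rw [setLIntegral_congr_fun measurableSet_Ioc fun s hs => (hl s hs.1.le).symm]
      exact lintegral_lintegral_swap hm2.aemeasurable
    simp only [e1]
    rw [← lintegral_add_left]
    · exact lintegral_congr fun μ => ofReal_comp_expMass ha h0 hC hG hg0 hG0 μ ht
    · have h := hm1.comp (measurable_prodMk_left (x := t))
      exact h

end Ray

/-! ### The multiplicative Lebesgue measure -/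

section MultLebesgue

variable {X : Type*} [MeasurableSpace X]

theorem measurable_smul_toFiniteMeasure :
    Measurable fun p : ProbabilityMeasure X × ℝ => Real.toNNReal p.2 • p.1.toFiniteMeasure := by
  refine FiniteMeasure.measurable_of_measurable_apply fun s hs => ?_
  have h1 : Measurable fun p : ProbabilityMeasure X × ℝ => (p.1 : Measure X) s :=
    (Measure.measurable_coe hs).comp (ProbabilityMeasure.measurable_toMeasure.comp measurable_fst)
  have h2 : Measurable fun p : ProbabilityMeasure X × ℝ => ENNReal.ofReal p.2 * (p.1 : Measure X) s :=
    Measurable.mul (by fun_prop) h1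
  exact h2

theorem lintegral_smul_toFiniteMeasure (η : ProbabilityMeasure X) (t : ℝ) (f : X → ℝ≥0∞) :
    ∫⁻ x, f x ∂((Real.toNNReal t • η.toFiniteMeasure : FiniteMeasure X) : Measure X) =
      ENNReal.ofReal t * ∫⁻ x, f x ∂(η : Measure X) := by
  have h : ((Real.toNNReal t • η.toFiniteMeasure : FiniteMeasure X) : Measure X) =
      ENNReal.ofReal t • (η : Measure X) := rfl
  rw [h, lintegral_smul_measure, smul_eq_mul]

/-- The density of `gammaLebesgue`. -/
noncomputable def gammaDensity (θ t : ℝ) : ℝ≥0∞ := ENNReal.ofReal (t ^ (θ - 1) / Real.Gamma θ)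

@[fun_prop]
theorem measurable_gammaDensity (θ : ℝ) : Measurable (gammaDensity θ) := by
  unfold gammaDensity; fun_prop

instance (θ : ℝ) : SFinite (gammaLebesgue θ) := by
  unfold gammaLebesgue; infer_instance

theorem lintegral_gammaLebesgue (θ : ℝ) {f : ℝ → ℝ≥0∞} (hf : Measurable f) :
    ∫⁻ t, f t ∂gammaLebesgue θ = ∫⁻ t in Ioi 0, gammaDensity θ t * f t := by
  exact lintegral_withDensity_eq_lintegral_mul _ (measurable_gammaDensity θ) hf

variable {θ : ℝ} {ν : ProbabilityMeasure X}

theorem lintegral_multLebesgue (hθ : 0 < θ) {G : FiniteMeasure X → ℝ≥0∞} (hG : Measurable G) :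
    ∫⁻ μ, G μ ∂multLebesgue θ ν = ∫⁻ t in Ioi 0, gammaDensity θ t *
      ∫⁻ η, G (Real.toNNReal t • η.toFiniteMeasure) ∂dirichletFerguson θ ν := by
  have := (isDirichletFerguson_dirichletFerguson hθ ν).isProbabilityMeasure
  have h : Measurable fun p : ProbabilityMeasure X × ℝ =>
      G (Real.toNNReal p.2 • p.1.toFiniteMeasure) := hG.comp measurable_smul_toFiniteMeasure
  rw [multLebesgue, lintegral_map hG measurable_smul_toFiniteMeasure,
    lintegral_prod_symm _ h.aemeasurable, lintegral_gammaLebesgue _ h.lintegral_prod_left']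

theorem sFinite_multLebesgue (hθ : 0 < θ) : SFinite (multLebesgue θ ν) := by
  have := (isDirichletFerguson_dirichletFerguson hθ ν).isProbabilityMeasure
  unfold multLebesgue
  infer_instance

/-- The total mass of `multLebesgue θ ν` is distributed as `gammaLebesgue θ`. -/
theorem lintegral_mass_multLebesgue (hθ : 0 < θ) {G : ℝ≥0∞ → ℝ≥0∞} (hG : Measurable G) :
    ∫⁻ μ : FiniteMeasure X, G ((μ : Measure X) univ) ∂multLebesgue θ ν =
      ∫⁻ t in Ioi 0, gammaDensity θ t * G (ENNReal.ofReal t) := by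
  have := (isDirichletFerguson_dirichletFerguson hθ ν).isProbabilityMeasure
  have hm : Measurable fun μ : FiniteMeasure X => G ((μ : Measure X) univ) :=
    hG.comp ((Measure.measurable_coe MeasurableSet.univ).comp FiniteMeasure.measurable_toMeasure)
  rw [lintegral_multLebesgue hθ hm]
  refine lintegral_congr fun t => ?_
  have e : ∀ η : ProbabilityMeasure X,
      ((Real.toNNReal t • η.toFiniteMeasure : FiniteMeasure X) : Measure X) univ =
        ENNReal.ofReal t := by
    intro η
    have := lintegral_smul_toFiniteMeasure η t 1
    simpa using this
  simp_rw [e]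
  simp

theorem lintegral_expNeg_mass_multLebesgue (hθ : 0 < θ) :
    ∫⁻ μ : FiniteMeasure X, expNeg ((μ : Measure X) univ) ∂multLebesgue θ ν = 1 := by
  rw [lintegral_mass_multLebesgue hθ measurable_expNeg]
  have e : ∀ t ∈ Ioi (0 : ℝ), gammaDensity θ t * expNeg (ENNReal.ofReal t) =
      ENNReal.ofReal ((Real.Gamma θ)⁻¹ * (Real.exp (-t) * t ^ (θ - 1))) := by
    intro t ht
    have ht : 0 < t := ht
    have hΓ := Real.Gamma_pos_of_pos hθ
    rw [gammaDensity, expNeg, ENNReal.toReal_ofReal ht.le, ← ENNReal.ofReal_mul (by positivity)]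
    congr 1
    ring
  have hΓ := Real.Gamma_pos_of_pos hθ
  rw [setLIntegral_congr_fun measurableSet_Ioi e, ← ofReal_integral_eq_lintegral_ofReal]
  · rw [integral_const_mul, ← Real.Gamma_eq_integral hθ, inv_mul_cancel₀ hΓ.ne', ENNReal.ofReal_one]
  · exact (Real.GammaIntegral_convergent hθ).const_mul _
  · filter_upwards [ae_restrict_mem measurableSet_Ioi] with t ht
    have ht : 0 < t := ht
    positivity

theorem multLebesgue_massBall (hθ : 0 < θ) (r : ℝ≥0) :
    multLebesgue θ ν (massBall X r) = ENNReal.ofReal ((r : ℝ) ^ θ / Real.Gamma (θ + 1)) := by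
  have hΓ := Real.Gamma_pos_of_pos hθ
  have hmeas : Measurable fun μ : FiniteMeasure X => (μ : Measure X) univ :=
    (Measure.measurable_coe MeasurableSet.univ).comp FiniteMeasure.measurable_toMeasure
  have hset : massBall X r = (fun μ : FiniteMeasure X => (μ : Measure X) univ) ⁻¹' Iic (r : ℝ≥0∞) := by
    ext μ
    simp only [massBall, mem_ofPred_eq, mem_preimage, mem_Iic]
    rw [← FiniteMeasure.ennreal_mass, ENNReal.coe_le_coe]
  have hB : MeasurableSet (massBall X r) := hset ▸ hmeas measurableSet_Iic
  rw [← lintegral_indicator_one hB]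
  have e0 : ∀ μ : FiniteMeasure X, (massBall X r).indicator (1 : FiniteMeasure X → ℝ≥0∞) μ =
      (Iic (r : ℝ≥0∞)).indicator (1 : ℝ≥0∞ → ℝ≥0∞) ((μ : Measure X) univ) := by
    intro μ
    rw [hset]; rfl
  simp_rw [e0]
  rw [lintegral_mass_multLebesgue hθ (measurable_one.indicator measurableSet_Iic)]
  have e1 : ∀ t : ℝ, gammaDensity θ t * (Iic (r : ℝ≥0∞)).indicator 1 (ENNReal.ofReal t) =
      (Iic (r : ℝ)).indicator (gammaDensity θ) t := by
    intro t
    have : ENNReal.ofReal t ∈ Iic (r : ℝ≥0∞) ↔ t ∈ Iic (r : ℝ) := by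
      simp only [mem_Iic]
      rw [← ENNReal.ofReal_coe_nnreal, ENNReal.ofReal_le_ofReal_iff r.coe_nonneg]
    by_cases h : t ∈ Iic (r : ℝ)
    · rw [indicator_of_mem h, indicator_of_mem (this.2 h)]; simp
    · rw [indicator_of_notMem h, indicator_of_notMem (fun h' => h (this.1 h'))]; simp
  simp_rw [e1]
  rw [lintegral_indicator measurableSet_Iic, Measure.restrict_restrict measurableSet_Iic,
    inter_comm, Ioi_inter_Iic]
  unfold gammaDensity
  rw [← ofReal_integral_eq_lintegral_ofReal, ← intervalIntegral.integral_of_le r.coe_nonneg,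
    intervalIntegral.integral_div, integral_rpow (Or.inl (by linarith))]
  · rw [sub_add_cancel, Real.zero_rpow hθ.ne', sub_zero, Real.Gamma_add_one hθ.ne', div_div]
  · have h1 : IntervalIntegrable (fun t : ℝ => t ^ (θ - 1)) volume 0 r :=
      intervalIntegral.intervalIntegrable_rpow' (by linarith)
    exact ((intervalIntegrable_iff_integrableOn_Ioc_of_le r.coe_nonneg).1 h1).div_const _
  · filter_upwards [ae_restrict_mem measurableSet_Ioc] with t ht
    have ht : 0 < t := ht.1
    positivity

/-- The Beta-Gamma change of variables `r = t (1 - u)`, `v = t u`. -/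
theorem lintegral_gamma_betaOne (hθ : 0 < θ) {h : ℝ → ℝ → ℝ≥0∞}
    (hh : Measurable (Function.uncurry h)) :
    ∫⁻ t in Ioi 0, gammaDensity θ t *
        ∫⁻ u, ENNReal.ofReal t * h (t * (1 - (u : ℝ))) (t * u) ∂betaOne θ =
      ENNReal.ofReal θ * ∫⁻ r in Ioi 0, gammaDensity θ r * ∫⁻ v in Ioi 0, h r v := by
  have hΓ := Real.Gamma_pos_of_pos hθ
  -- The integrand in the variables r and v, extended by zero off the quadrant. The left side
  -- becomes the double integral of K (t - v) v, and translation in t removes the shift.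
  let K : ℝ → ℝ → ℝ≥0∞ := fun r v =>
    (Ioi (0 : ℝ)).indicator (fun r => (Ioi (0 : ℝ)).indicator
      (fun v => ENNReal.ofReal θ * (gammaDensity θ r * h r v)) v) r
  have hK : Measurable (Function.uncurry K) := by
    have e : Function.uncurry K = (Ioi (0 : ℝ) ×ˢ Ioi (0 : ℝ)).indicator
        fun p : ℝ × ℝ => ENNReal.ofReal θ * (gammaDensity θ p.1 * h p.1 p.2) := by
      ext ⟨r, v⟩
      by_cases hr : r ∈ Ioi (0 : ℝ) <;> by_cases hv : v ∈ Ioi (0 : ℝ) <;>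
        simp [Function.uncurry, K, Set.indicator, hr, hv] <;> simp_all
    rw [e]
    refine Measurable.indicator ?_ (measurableSet_Ioi.prod measurableSet_Ioi)
    exact measurable_const.mul (((measurable_gammaDensity θ).comp measurable_fst).mul hh)
  have hL : ∀ t ∈ Ioi (0 : ℝ), gammaDensity θ t *
      ∫⁻ u, ENNReal.ofReal t * h (t * (1 - (u : ℝ))) (t * u) ∂betaOne θ =
        ∫⁻ v, K (t - v) v := by
    intro t ht
    have ht : 0 < t := ht
    have hm : Measurable fun u : unitInterval =>
        ENNReal.ofReal t * h (t * (1 - (u : ℝ))) (t * u) :=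
      measurable_const.mul (hh.comp (by fun_prop :
        Measurable fun u : unitInterval => (t * (1 - (u : ℝ)), t * (u : ℝ))))
    rw [lintegral_betaOne θ hm]
    have e1 : ∫⁻ u in Icc (0 : ℝ) 1, ENNReal.ofReal (θ * (1 - u) ^ (θ - 1)) *
        (ENNReal.ofReal t * h (t * (1 - (projIcc 0 1 zero_le_one u : ℝ)))
          (t * (projIcc 0 1 zero_le_one u : ℝ))) =
        ∫⁻ v in Icc 0 t, ENNReal.ofReal (θ * (1 - v / t) ^ (θ - 1)) * h (t - v) v := by
      rw [← lintegral_Icc_comp_mul_left ht]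
      refine setLIntegral_congr_fun measurableSet_Icc fun u hu => ?_
      simp only [projIcc_of_mem _ hu]
      rw [mul_div_cancel_left₀ _ ht.ne', mul_sub, mul_one]
      ring
    have hm2 : Measurable fun v => h (t - v) v :=
      hh.comp (by fun_prop : Measurable fun v : ℝ => (t - v, v))
    rw [e1, ← lintegral_const_mul _ (by fun_prop), ← restrict_Ioo_eq_restrict_Icc,
      ← lintegral_indicator measurableSet_Ioo]
    refine lintegral_congr fun v => ?_
    simp only [K]
    by_cases hv : v ∈ Ioo 0 t
    · have hr : 0 < t - v := by linarith [hv.2]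
      rw [indicator_of_mem hv, indicator_of_mem (show t - v ∈ Ioi (0 : ℝ) from hr),
        indicator_of_mem (show v ∈ Ioi (0 : ℝ) from hv.1), ← mul_assoc, ← mul_assoc]
      congr 1
      have hb0 : 0 ≤ 1 - v / t := by
        rw [sub_nonneg, div_le_one ht]; exact hv.2.le
      have : t - v = t * (1 - v / t) := by field_simp
      rw [gammaDensity, gammaDensity, this, Real.mul_rpow ht.le hb0,
        ← ENNReal.ofReal_mul (by positivity), ← ENNReal.ofReal_mul hθ.le]
      congr 1
      ring
    · rw [indicator_of_notMem hv]
      symm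
      by_cases hr : t - v ∈ Ioi (0 : ℝ)
      · rw [indicator_of_mem hr, indicator_of_notMem]
        intro hv'
        have hr' : 0 < t - v := hr
        exact hv ⟨hv', by linarith⟩
      · rw [indicator_of_notMem hr]
  rw [setLIntegral_congr_fun measurableSet_Ioi hL]
  have hL' : ∫⁻ t in Ioi (0 : ℝ), ∫⁻ v, K (t - v) v = ∫⁻ t : ℝ, ∫⁻ v, K (t - v) v := by
    rw [← lintegral_indicator measurableSet_Ioi]
    refine lintegral_congr fun t => ?_
    by_cases ht : t ∈ Ioi (0 : ℝ)
    · rw [indicator_of_mem ht]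
    · rw [indicator_of_notMem ht]
      symm
      have : ∀ v, K (t - v) v = 0 := by
        intro v
        simp only [K]
        by_cases hr : t - v ∈ Ioi (0 : ℝ)
        · rw [indicator_of_mem hr, indicator_of_notMem]
          intro hv
          have h1 : 0 < t - v := hr
          have h2 : 0 < v := hv
          exact ht (show (0 : ℝ) < t by linarith)
        · rw [indicator_of_notMem hr]
      simp [this]
  have hKs : Measurable fun p : ℝ × ℝ => K (p.1 - p.2) p.2 :=
    hK.comp (by fun_prop : Measurable fun p : ℝ × ℝ => (p.1 - p.2, p.2))
  rw [hL', lintegral_lintegral_swap hKs.aemeasurable]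
  have hshift : ∀ v : ℝ, ∫⁻ t, K (t - v) v = ∫⁻ r, K r v := fun v =>
    lintegral_sub_right_eq_self (fun r => K r v) v
  simp_rw [hshift]
  rw [lintegral_lintegral_swap (f := fun v r => K r v) (hK.comp measurable_swap).aemeasurable,
    ← lintegral_const_mul (ENNReal.ofReal θ) (f := fun r => gammaDensity θ r * ∫⁻ v in Ioi 0, h r v)
      ((measurable_gammaDensity θ).mul hh.lintegral_prod_right'),
    ← lintegral_indicator measurableSet_Ioi]
  refine lintegral_congr fun r => ?_
  by_cases hr : r ∈ Ioi (0 : ℝ)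
  · have hm3 : Measurable fun v => h r v := hh.comp measurable_prodMk_left
    rw [indicator_of_mem hr, ← lintegral_const_mul _ hm3,
      ← lintegral_const_mul _ (hm3.const_mul _), ← lintegral_indicator measurableSet_Ioi]
    refine lintegral_congr fun v => ?_
    simp only [K, indicator_of_mem hr]
  · simp [K, indicator_of_notMem hr]

/-- The Mecke identity for the multiplicative Lebesgue measure, on exponential functionals. -/
theorem lintegral_mul_expNeg_multLebesgue (hθ : 0 < θ) {f k : X → ℝ≥0∞} (hf : Measurable f)
    (hk : Measurable k) {C : ℝ≥0} (hfC : ∀ x, f x ≤ C) (hf0 : ∀ x, f x ≠ 0) :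
    ∫⁻ μ : FiniteMeasure X, expNeg (∫⁻ x, f x ∂(μ : Measure X)) *
        ∫⁻ x, k x * f x ∂(μ : Measure X) ∂multLebesgue θ ν =
      ENNReal.ofReal θ * (∫⁻ x, k x ∂(ν : Measure X)) *
        ∫⁻ μ : FiniteMeasure X, expNeg (∫⁻ x, f x ∂(μ : Measure X)) ∂multLebesgue θ ν := by
  have hDF := isDirichletFerguson_dirichletFerguson hθ ν
  have := hDF.isProbabilityMeasure
  have := isProbabilityMeasure_betaOne hθ
  have hfη : ∀ η : ProbabilityMeasure X, ∫⁻ x, f x ∂(η : Measure X) ≠ ⊤ := fun η =>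
    FiniteMeasure.lintegral_ne_top_of_le hfC η.toFiniteMeasure
  have hft : ∀ x, f x ≠ ⊤ := fun x => ne_top_of_le_ne_top ENNReal.coe_ne_top (hfC x)
  have hI : Measurable fun η : ProbabilityMeasure X => ∫⁻ x, f x ∂(η : Measure X) :=
    (Measure.measurable_lintegral hf).comp ProbabilityMeasure.measurable_toMeasure
  have hE := FiniteMeasure.measurable_lintegral hf
  have hG1 : Measurable fun μ : FiniteMeasure X => expNeg (∫⁻ x, f x ∂(μ : Measure X)) :=
    measurable_expNeg.comp hE
  have hG2 : Measurable fun μ : FiniteMeasure X => expNeg (∫⁻ x, f x ∂(μ : Measure X)) *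
      ∫⁻ x, k x * f x ∂(μ : Measure X) :=
    hG1.mul (FiniteMeasure.measurable_lintegral (hk.mul hf))
  rw [lintegral_multLebesgue hθ hG2, lintegral_multLebesgue hθ hG1]
  simp only [lintegral_smul_toFiniteMeasure]
  -- the inner identity, for fixed `η` and `x`
  have key : ∀ c b : ℝ≥0∞, c ≠ ⊤ → b ≠ ⊤ → b ≠ 0 →
      ∫⁻ t in Ioi 0, gammaDensity θ t * ∫⁻ u, ENNReal.ofReal t *
        (b * expNeg (ENNReal.ofReal (t * (1 - (u : ℝ))) * c + ENNReal.ofReal (t * u) * b))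
          ∂betaOne θ =
      ENNReal.ofReal θ * ∫⁻ r in Ioi 0, gammaDensity θ r * expNeg (ENNReal.ofReal r * c) := by
    intro c b hc hb hb0
    have h1 := lintegral_gamma_betaOne (θ := θ) hθ (h := fun r v =>
      b * expNeg (ENNReal.ofReal r * c + ENNReal.ofReal v * b)) (by
        refine measurable_const.mul (measurable_expNeg.comp ?_)
        fun_prop)
    rw [h1]
    congr 1
    refine lintegral_congr fun r => ?_
    congr 1
    have hbpos : 0 < b.toReal := ENNReal.toReal_pos hb0 hb
    have e : ∀ v ∈ Ioi (0 : ℝ), b * expNeg (ENNReal.ofReal r * c + ENNReal.ofReal v * b) =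
        expNeg (ENNReal.ofReal r * c) *
          ENNReal.ofReal (b.toReal * Real.exp (-(b.toReal * v))) := by
      intro v hv
      have hv : 0 < v := hv
      rw [expNeg_add (ENNReal.mul_ne_top ENNReal.ofReal_ne_top hc)
        (ENNReal.mul_ne_top ENNReal.ofReal_ne_top hb), ENNReal.ofReal_mul hbpos.le,
        ENNReal.ofReal_toReal hb]
      have : expNeg (ENNReal.ofReal v * b) = ENNReal.ofReal (Real.exp (-(b.toReal * v))) := by
        rw [expNeg, ENNReal.toReal_mul, ENNReal.toReal_ofReal hv.le, mul_comm]
      rw [this]; ring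
    rw [setLIntegral_congr_fun measurableSet_Ioi e, lintegral_const_mul _ (by fun_prop)]
    -- An exponential density integrates to one; this is where f must not vanish.
    have hexp : ∫⁻ v in Ioi (0 : ℝ), ENNReal.ofReal (b.toReal * Real.exp (-(b.toReal * v))) = 1 := by
      rw [← ofReal_integral_eq_lintegral_ofReal]
      · rw [integral_const_mul]
        have := integral_exp_mul_Ioi (a := -b.toReal) (by linarith) 0
        simp only [neg_mul] at this
        rw [this]
        simp [hbpos.ne']
      · have := integrableOn_exp_mul_Ioi (a := -b.toReal) (by linarith) 0
        simp only [neg_mul] at this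
        exact this.const_mul _
      · exact .of_forall fun v => by positivity
    rw [hexp, mul_one]
  have hLm : Measurable fun p : ℝ × ProbabilityMeasure X =>
      expNeg (ENNReal.ofReal p.1 * ∫⁻ x, f x ∂(p.2 : Measure X)) :=
    measurable_expNeg.comp ((by fun_prop : Measurable fun p : ℝ × ProbabilityMeasure X =>
      ENNReal.ofReal p.1).mul (hI.comp measurable_snd))
  let W : ℝ → ProbabilityMeasure X → X → ℝ≥0∞ := fun t η x => ∫⁻ u, ENNReal.ofReal t * (f x *
    expNeg (ENNReal.ofReal (t * (1 - (u : ℝ))) * ∫⁻ x, f x ∂(η : Measure X) +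
      ENNReal.ofReal (t * u) * f x)) ∂betaOne θ
  have hW4 : Measurable fun q : (ℝ × ProbabilityMeasure X × X) × unitInterval =>
      ENNReal.ofReal q.1.1 * (f q.1.2.2 *
        expNeg (ENNReal.ofReal (q.1.1 * (1 - (q.2 : ℝ))) * ∫⁻ x, f x ∂(q.1.2.1 : Measure X) +
          ENNReal.ofReal (q.1.1 * q.2) * f q.1.2.2)) := by
    have a1 : Measurable fun q : (ℝ × ProbabilityMeasure X × X) × unitInterval => f q.1.2.2 :=
      hf.comp (by fun_prop)
    have a3 : Measurable fun q : (ℝ × ProbabilityMeasure X × X) × unitInterval =>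
        ∫⁻ x, f x ∂(q.1.2.1 : Measure X) := hI.comp (by fun_prop)
    fun_prop
  have hW : Measurable fun q : ℝ × ProbabilityMeasure X × X => W q.1 q.2.1 q.2.2 :=
    hW4.lintegral_prod_right'
  have step1 : ∀ t ∈ Ioi (0 : ℝ), gammaDensity θ t *
      ∫⁻ η : ProbabilityMeasure X, expNeg (ENNReal.ofReal t * ∫⁻ x, f x ∂(η : Measure X)) *
        (ENNReal.ofReal t * ∫⁻ x, k x * f x ∂(η : Measure X)) ∂dirichletFerguson θ ν =
      ∫⁻ η, ∫⁻ x, gammaDensity θ t * (k x * W t η x) ∂(ν : Measure X)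
        ∂dirichletFerguson θ ν := by
    intro t ht
    have ht : 0 < t := ht
    -- The Mecke identity is used at each fixed t. The new atom at x of weight u turns exp(-t η(f))
    -- into exp(-(t (1 - u) η(f) + t u f(x))).
    let F : ProbabilityMeasure X → X → ℝ≥0∞ := fun η x =>
      k x * (ENNReal.ofReal t * (f x * expNeg (ENNReal.ofReal t * ∫⁻ x, f x ∂(η : Measure X))))
    have hF : Measurable (Function.uncurry F) := by
      refine (hk.comp measurable_snd).mul (measurable_const.mul ((hf.comp measurable_snd).mul ?_))
      exact measurable_expNeg.comp (measurable_const.mul (hI.comp measurable_fst))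
    have e1 : ∫⁻ η : ProbabilityMeasure X,
        expNeg (ENNReal.ofReal t * ∫⁻ x, f x ∂(η : Measure X)) *
        (ENNReal.ofReal t * ∫⁻ x, k x * f x ∂(η : Measure X)) ∂dirichletFerguson θ ν =
        ∫⁻ η, ∫⁻ x, F η x ∂(η : Measure X) ∂dirichletFerguson θ ν := by
      refine lintegral_congr fun η => ?_
      have hkf : Measurable fun x => k x * f x := hk.mul hf
      rw [← lintegral_const_mul _ hkf, ← lintegral_const_mul _ (by fun_prop)]
      refine lintegral_congr fun x => ?_
      simp only [F]; ring
    have hkW : Measurable fun p : ProbabilityMeasure X × X => k p.2 * W t p.1 p.2 := by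
      have h := hW.comp (by fun_prop :
        Measurable fun p : ProbabilityMeasure X × X => (t, p.1, p.2))
      exact (hk.comp measurable_snd).mul h
    rw [e1, hDF.mecke F hF, ← lintegral_const_mul]
    · refine lintegral_congr fun η => ?_
      rw [lintegral_lintegral_swap]
      · rw [← lintegral_const_mul]
        · refine lintegral_congr fun x => ?_
          congr 1
          simp only [W]
          rw [← lintegral_const_mul]
          · refine lintegral_congr fun u => ?_
            simp only [F]
            rw [lintegral_mixDirac _ _ _ hf, mul_add, ← mul_assoc (ENNReal.ofReal t)
              (ENNReal.ofReal (1 - (u : ℝ))), ← mul_assoc (ENNReal.ofReal t)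
              (ENNReal.ofReal (u : ℝ)), ← ENNReal.ofReal_mul ht.le, ← ENNReal.ofReal_mul ht.le]
          · have h := hW4.comp (by fun_prop :
              Measurable fun u : unitInterval => ((t, η, x), u))
            exact h
        · refine Measurable.lintegral_prod_right' (f := fun p : X × unitInterval =>
            F (mixDirac η p.1 p.2) p.1) ?_
          have h := hF.comp ((measurable_comp_mixDirac (Z := X × unitInterval)
            (measurable_const (a := η)) measurable_fst measurable_snd).prodMk measurable_fst)
          exact h
      · refine Measurable.aemeasurable ?_
        have h := hF.comp ((measurable_comp_mixDirac (Z := unitInterval × X)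
          (measurable_const (a := η)) measurable_snd measurable_fst).prodMk measurable_snd)
        exact h
    · refine Measurable.lintegral_prod_right' (f := fun p : ProbabilityMeasure X × unitInterval =>
        ∫⁻ x, F (mixDirac p.1 x p.2) x ∂(ν : Measure X)) ?_
      refine Measurable.lintegral_prod_right'
        (f := fun p : (ProbabilityMeasure X × unitInterval) × X =>
          F (mixDirac p.1.1 p.2 p.1.2) p.2) ?_
      have h := hF.comp ((measurable_comp_mixDirac
        (Z := (ProbabilityMeasure X × unitInterval) × X)
        (measurable_fst.comp measurable_fst) measurable_snd
        (measurable_snd.comp measurable_fst)).prodMk measurable_snd)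
      exact h
  have hgkW : Measurable fun q : ℝ × ProbabilityMeasure X × X =>
      gammaDensity θ q.1 * (k q.2.2 * W q.1 q.2.1 q.2.2) :=
    ((measurable_gammaDensity θ).comp measurable_fst).mul
      ((hk.comp (by fun_prop)).mul hW)
  have step2 : ∀ η : ProbabilityMeasure X,
      ∫⁻ t in Ioi 0, ∫⁻ x, gammaDensity θ t * (k x * W t η x) ∂(ν : Measure X) =
        ENNReal.ofReal θ * (∫⁻ x, k x ∂(ν : Measure X)) *
          ∫⁻ r in Ioi 0, gammaDensity θ r *
            expNeg (ENNReal.ofReal r * ∫⁻ x, f x ∂(η : Measure X)) := by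
    intro η
    rw [lintegral_lintegral_swap]
    · rw [mul_right_comm, ← lintegral_const_mul _ hk]
      refine lintegral_congr fun x => ?_
      rw [← key _ _ (hfη η) (hft x) (hf0 x), mul_comm _ (k x), ← lintegral_const_mul]
      · refine lintegral_congr fun t => ?_
        simp only [W]; ring
      · have h := hW.comp (by fun_prop : Measurable fun t : ℝ => (t, η, x))
        exact (measurable_gammaDensity θ).mul h
    · refine Measurable.aemeasurable ?_
      have h := hgkW.comp (by fun_prop : Measurable fun p : ℝ × X => (p.1, η, p.2))
      exact h
  rw [setLIntegral_congr_fun measurableSet_Ioi step1, lintegral_lintegral_swap]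
  · simp_rw [step2]
    rw [lintegral_const_mul]
    · congr 1
      rw [lintegral_lintegral_swap]
      · refine lintegral_congr fun t => ?_
        rw [lintegral_const_mul]
        have h := hLm.comp (measurable_prodMk_left (x := t))
        exact h
      · refine Measurable.aemeasurable ?_
        have h := hLm.comp (measurable_swap (α := ProbabilityMeasure X) (β := ℝ))
        exact ((measurable_gammaDensity θ).comp measurable_snd).mul h
    · refine Measurable.lintegral_prod_right' (f := fun p : ProbabilityMeasure X × ℝ =>
        gammaDensity θ p.2 * expNeg (ENNReal.ofReal p.2 * ∫⁻ x, f x ∂(p.1 : Measure X))) ?_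
      have h := hLm.comp (measurable_swap (α := ProbabilityMeasure X) (β := ℝ))
      exact ((measurable_gammaDensity θ).comp measurable_snd).mul h
  · refine Measurable.aemeasurable ?_
    refine Measurable.lintegral_prod_right' (f := fun p : (ℝ × ProbabilityMeasure X) × X =>
      gammaDensity θ p.1.1 * (k p.2 * W p.1.1 p.1.2 p.2)) ?_
    have h := hgkW.comp (by fun_prop : Measurable fun p : (ℝ × ProbabilityMeasure X) × X =>
      (p.1.1, p.1.2, p.2))
    exact h

end MultLebesgue

/-! ### The Laplace functional of the multiplicative Lebesgue measure and invariance under shifts -/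

section Laplace

variable {X : Type*} [MeasurableSpace X]

theorem expMass_zero (a : X → ℝ) (μ : FiniteMeasure X) :
    expMass a 0 μ = (μ : Measure X) univ := by
  simp [expMass]

theorem measurable_expMass_right {a : X → ℝ} (ha : Measurable a) (s : ℝ) :
    Measurable (expMass a s) :=
  FiniteMeasure.measurable_lintegral (f := fun x => ENNReal.ofReal (Real.exp (s * a x)))
    (by fun_prop)

/-- The Laplace functional of the multiplicative Lebesgue measure. -/
theorem lintegral_expNeg_expMass_multLebesgue {θ : ℝ} (hθ : 0 < θ) {ν : ProbabilityMeasure X}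
    {a : X → ℝ} (ha : Measurable a) {C : ℝ} (h0 : ∀ x, 0 ≤ a x) (hC : ∀ x, a x ≤ C) :
    ∫⁻ μ, expNeg (expMass a 1 μ) ∂multLebesgue θ ν =
      ENNReal.ofReal (Real.exp (-(θ * ∫ x, a x ∂(ν : Measure X)))) := by
  have := sFinite_multLebesgue (ν := ν) hθ
  have hint : Integrable a (ν : Measure X) :=
    integrable_of_abs_le ha (fun x => by rw [abs_of_nonneg (h0 x)]; exact hC x)
      ν.toFiniteMeasure
  have hI : ENNReal.ofReal (∫ x, a x ∂(ν : Measure X)) =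
      ∫⁻ x, ENNReal.ofReal (a x) ∂(ν : Measure X) :=
    ofReal_integral_eq_lintegral_ofReal hint (.of_forall h0)
  have hI0 : 0 ≤ ∫ x, a x ∂(ν : Measure X) := integral_nonneg h0
  let l : ℝ≥0 := ⟨θ * ∫ x, a x ∂(ν : Measure X), mul_nonneg hθ.le hI0⟩
  have hl : (l : ℝ≥0∞) = ENNReal.ofReal θ * ∫⁻ x, ENNReal.ofReal (a x) ∂(ν : Measure X) := by
    rw [← hI, ← ENNReal.ofReal_mul hθ.le, ← ENNReal.ofReal_coe_nnreal]
    rfl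
  have hz : ∫⁻ μ, expNeg (expMass a 0 μ) ∂multLebesgue θ ν = 1 := by
    simp_rw [expMass_zero]
    exact lintegral_expNeg_mass_multLebesgue hθ
  -- For G = g = exp(-z), the Mecke identity with f = e^(s a) and k = a says that minus the
  -- logarithmic derivative along the ray is θ ∫ a dν for every s.
  have key := lintegral_comp_expMass ha h0 hC (G := fun z => Real.exp (-z))
    (g := fun z => Real.exp (-z)) (fun z => by
      have := (hasDerivAt_neg z).exp
      rwa [mul_neg_one] at this)
    (fun z => (Real.exp_pos _).le) (fun z => (Real.exp_pos _).le) (by fun_prop) (by fun_prop)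
    (multLebesgue θ ν) (l := l)
    (by
      change ∫⁻ μ, expNeg (expMass a 0 μ) ∂multLebesgue θ ν ≠ ⊤
      rw [hz]; exact ENNReal.one_ne_top)
    (by
      intro s hs
      rw [hl]
      have hC0 : ∀ x, ENNReal.ofReal (Real.exp (s * a x)) ≤ (Real.toNNReal (Real.exp (s * C)) : ℝ≥0) :=
        fun x => ENNReal.ofReal_le_ofReal
          (Real.exp_le_exp.2 (mul_le_mul_of_nonneg_left (hC x) hs))
      have := lintegral_mul_expNeg_multLebesgue (ν := ν) hθ
        (f := fun x => ENNReal.ofReal (Real.exp (s * a x))) (k := fun x => ENNReal.ofReal (a x))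
        (by fun_prop) (by fun_prop) hC0 (fun x => by simp [Real.exp_pos])
      simp_rw [← ENNReal.ofReal_mul (h0 _)] at this
      exact this)
  change ∫⁻ μ, expNeg (expMass a 1 μ) ∂multLebesgue θ ν =
    (∫⁻ μ, expNeg (expMass a 0 μ) ∂multLebesgue θ ν) * _ at key
  rw [key, hz, one_mul]
  rfl

/-- The exponential tilting of a measure on the finite measures on `X`. -/
noncomputable def expTilt (Q : Measure (FiniteMeasure X)) : Measure (FiniteMeasure X) :=
  Q.withDensity fun μ => expNeg ((μ : Measure X) univ)

theorem measurable_expNeg_mass :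
    Measurable fun μ : FiniteMeasure X => expNeg ((μ : Measure X) univ) :=
  measurable_expNeg.comp
    ((Measure.measurable_coe MeasurableSet.univ).comp FiniteMeasure.measurable_toMeasure)

/-- The density exp(-μ(1)) is nowhere 0 or ∞ and can be divided out again. -/
theorem expTilt_injective : Function.Injective (expTilt (X := X)) := by
  intro Q Q' h
  have e : ∀ Q : Measure (FiniteMeasure X), (expTilt Q).withDensity
      (fun μ => expNeg ((μ : Measure X) univ))⁻¹ = Q := fun Q =>
    withDensity_inv_same measurable_expNeg_mass (.of_forall fun μ => expNeg_ne_zero _)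
      (.of_forall fun μ => expNeg_ne_top _)
  rw [← e Q, ← e Q', h]

/-- Since exp(-μ(1)) exp(-μ(h)) = exp(-μ(1 + h)) and 1 + h = e^(log(1 + h)), Laplace functionals of
the tilted measure are exponential functionals of Q. -/
theorem lintegral_expNeg_expTilt (Q : Measure (FiniteMeasure X)) {h : X → ℝ≥0∞}
    (hh : Measurable h) {C : ℝ≥0} (hC : ∀ x, h x ≤ C) :
    ∫⁻ μ, expNeg (∫⁻ x, h x ∂(μ : Measure X)) ∂expTilt Q =
      ∫⁻ μ, expNeg (expMass (fun x => Real.log (1 + (h x).toReal)) 1 μ) ∂Q := by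
  have hm : Measurable fun μ : FiniteMeasure X => expNeg (∫⁻ x, h x ∂(μ : Measure X)) :=
    measurable_expNeg.comp (FiniteMeasure.measurable_lintegral hh)
  rw [expTilt, lintegral_withDensity_eq_lintegral_mul _ measurable_expNeg_mass hm]
  refine lintegral_congr fun μ => ?_
  rw [Pi.mul_apply, ← expNeg_add (measure_ne_top _ _)
    (FiniteMeasure.lintegral_ne_top_of_le hC μ)]
  congr 1
  rw [expMass, ← lintegral_one, ← lintegral_add_left measurable_const]
  refine lintegral_congr fun x => ?_
  have hx : h x ≠ ⊤ := ne_top_of_le_ne_top ENNReal.coe_ne_top (hC x)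
  have h0 : 0 ≤ (h x).toReal := ENNReal.toReal_nonneg
  rw [one_mul, Real.exp_log (by positivity), ENNReal.ofReal_add zero_le_one h0,
    ENNReal.ofReal_toReal hx, ENNReal.ofReal_one]

theorem isFiniteMeasure_expTilt {Q : Measure (FiniteMeasure X)}
    (hQ : ∫⁻ μ : FiniteMeasure X, expNeg ((μ : Measure X) univ) ∂Q ≠ ⊤) :
    IsFiniteMeasure (expTilt Q) :=
  isFiniteMeasure_withDensity hQ

/-- Measures on the finite measures on `X` are determined by their exponential functionals at
nonnegative bounded functions. -/
theorem ext_of_lintegral_expNeg_expMass {Q Q' : Measure (FiniteMeasure X)}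
    (hQ : ∫⁻ μ : FiniteMeasure X, expNeg ((μ : Measure X) univ) ∂Q ≠ ⊤)
    (heq : ∀ (a : X → ℝ) (C : ℝ), Measurable a → (∀ x, 0 ≤ a x) → (∀ x, a x ≤ C) →
      ∫⁻ μ, expNeg (expMass a 1 μ) ∂Q = ∫⁻ μ, expNeg (expMass a 1 μ) ∂Q') : Q = Q' := by
  apply expTilt_injective
  have h00 := heq (fun _ => 0) 0 measurable_const (fun _ => le_rfl) (fun _ => le_rfl)
  have e0 : ∀ Q : Measure (FiniteMeasure X), ∫⁻ μ, expNeg (expMass (fun _ => 0) 1 μ) ∂Q =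
      ∫⁻ μ : FiniteMeasure X, expNeg ((μ : Measure X) univ) ∂Q := fun Q => by simp [expMass]
  rw [e0, e0] at h00
  have := isFiniteMeasure_expTilt hQ
  have := isFiniteMeasure_expTilt (Q := Q') (h00 ▸ hQ)
  refine FiniteMeasure.ext_of_laplace_bounded fun h hh ⟨C, hC⟩ => ?_
  rw [lintegral_expNeg_expTilt Q hh hC, lintegral_expNeg_expTilt Q' hh hC]
  have h0 : ∀ x, 0 ≤ (h x).toReal := fun x => ENNReal.toReal_nonneg
  refine heq _ (Real.log (1 + C)) (by fun_prop) (fun x => Real.log_nonneg (by linarith [h0 x]))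
    (fun x => Real.log_le_log (by linarith [h0 x]) ?_)
  have : (h x).toReal ≤ C := by simpa using ENNReal.toReal_mono ENNReal.coe_ne_top (hC x)
  linarith

theorem measurable_finiteMeasure_map {ψ : X → X} (hψ : Measurable ψ) :
    Measurable fun μ : FiniteMeasure X => μ.map ψ := by
  refine FiniteMeasure.measurable_of_measurable_apply fun s hs => ?_
  have e : ∀ μ : FiniteMeasure X, ((μ.map ψ : FiniteMeasure X) : Measure X) s =
      (μ : Measure X) (ψ ⁻¹' s) := fun μ => Measure.map_apply hψ hs
  simp_rw [e]
  exact (Measure.measurable_coe (hψ hs)).comp FiniteMeasure.measurable_toMeasure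

theorem expMass_map {ψ : X → X} (hψ : Measurable ψ) {a : X → ℝ} (ha : Measurable a) (s : ℝ)
    (μ : FiniteMeasure X) : expMass a s (μ.map ψ) = expMass (a ∘ ψ) s μ := by
  have : ((μ.map ψ : FiniteMeasure X) : Measure X) = (μ : Measure X).map ψ := rfl
  rw [expMass, this, lintegral_map (by fun_prop) hψ]
  rfl

theorem lintegral_expNeg_expMass_map {ψ : X → X} (hψ : Measurable ψ) {a : X → ℝ}
    (ha : Measurable a) (Q : Measure (FiniteMeasure X)) :
    ∫⁻ μ, expNeg (expMass a 1 μ) ∂(Q.map fun μ => μ.map ψ) =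
      ∫⁻ μ, expNeg (expMass (a ∘ ψ) 1 μ) ∂Q := by
  have hm : Measurable fun μ : FiniteMeasure X => expNeg (expMass a 1 μ) :=
    measurable_expNeg.comp (measurable_expMass_right ha 1)
  rw [lintegral_map hm (measurable_finiteMeasure_map hψ)]
  simp_rw [expMass_map hψ ha]

/-- The multiplicative Lebesgue measure is invariant under exactly those transformations that
preserve its intensity. -/
theorem invariantUnderShift_multLebesgue_iff {θ : ℝ} (hθ : 0 < θ) (ν : ProbabilityMeasure X)
    {ψ : X → X} (hψ : Measurable ψ) :
    InvariantUnderShift (multLebesgue θ ν) ψ ↔ (ν : Measure X).map ψ = ν := by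
  constructor
  · intro h
    ext s hs
    rw [Measure.map_apply hψ hs]
    -- At a = 1_s the exponential functional is exp(-θ ν(s)), from which ν(s) can be read off.
    have hm : Measurable (s.indicator (1 : X → ℝ)) := measurable_one.indicator hs
    have h0 : ∀ x, 0 ≤ s.indicator (1 : X → ℝ) x := fun x =>
      indicator_nonneg (fun _ _ => zero_le_one) x
    have h1 : ∀ x, s.indicator (1 : X → ℝ) x ≤ 1 := fun x =>
      indicator_le_self' (fun _ _ => zero_le_one) x
    have e1 := lintegral_expNeg_expMass_map hψ hm (multLebesgue θ ν)
    have h' : (multLebesgue θ ν).map (fun μ : FiniteMeasure X => μ.map ψ) = multLebesgue θ ν := h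
    rw [h', lintegral_expNeg_expMass_multLebesgue hθ hm h0 h1,
      lintegral_expNeg_expMass_multLebesgue hθ (hm.comp hψ) (fun x => h0 _) (fun x => h1 _)] at e1
    have e2 := (ENNReal.ofReal_eq_ofReal_iff (Real.exp_pos _).le (Real.exp_pos _).le).1 e1
    have e3 := mul_left_cancel₀ hθ.ne' (neg_injective (Real.exp_injective e2))
    have e4 : (s.indicator (1 : X → ℝ)) ∘ ψ = (ψ ⁻¹' s).indicator 1 := rfl
    rw [e4, integral_indicator_one hs, integral_indicator_one (hψ hs)] at e3
    exact ((measureReal_eq_measureReal_iff).1 e3).symm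
  · intro h
    refine ext_of_lintegral_expNeg_expMass ?_ fun a C ha h0 hC => ?_
    · have := lintegral_expNeg_expMass_map hψ (measurable_const (a := (0 : ℝ)))
        (multLebesgue θ ν)
      simp only [expMass, mul_zero, Real.exp_zero, ENNReal.ofReal_one, lintegral_one,
        Function.comp_def] at this
      rw [this, lintegral_expNeg_mass_multLebesgue hθ]
      exact ENNReal.one_ne_top
    · rw [lintegral_expNeg_expMass_map hψ ha, lintegral_expNeg_expMass_multLebesgue hθ ha h0 hC,
        lintegral_expNeg_expMass_multLebesgue hθ (ha.comp hψ) (fun x => h0 _) (fun x => hC _)]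
      conv_rhs => rw [← h, integral_map hψ.aemeasurable ha.aestronglyMeasurable]
      rfl

end Laplace

/-! ### Locally translation invariant measures -/

/-- A measure that is invariant under small translations near a point is, near that point,
proportional to the Haar measure. -/
theorem MeasureTheory.Measure.mul_eq_mul_of_locally_translation_invariant {E : Type*}
    [NormedAddCommGroup E] [MeasurableSpace E] [BorelSpace E] [SecondCountableTopology E]
    (m vol : Measure E) [SFinite m] [SFinite vol] [vol.IsAddLeftInvariant] [vol.IsNegInvariant]
    (y₀ : E) {ρ : ℝ}
    (h : ∀ v : E, ‖v‖ < ρ → ∀ s ⊆ Metric.ball y₀ ρ, MeasurableSet s →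
      m ((fun y => y - v) ⁻¹' s) = m s)
    {s : Set E} (hs : MeasurableSet s) (hsB : s ⊆ Metric.ball y₀ (ρ / 4)) :
    m s * vol (Metric.ball y₀ (ρ / 4)) = m (Metric.ball y₀ (ρ / 4)) * vol s := by
  -- Both products are double integrals over (x, w): pairs with x ∈ s and x + w ∈ B on the left,
  -- with x ∈ B and x - w ∈ s on the right. For fixed w the second set of points x is the first one
  -- translated by w.
  set B := Metric.ball y₀ (ρ / 4) with hB
  have hBm : MeasurableSet B := Metric.isOpen_ball.measurableSet
  have h1 : Measurable (s.indicator (1 : E → ℝ≥0∞)) := measurable_one.indicator hs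
  have h2 : Measurable (B.indicator (1 : E → ℝ≥0∞)) := measurable_one.indicator hBm
  have hK : Measurable fun p : E × E =>
      s.indicator (1 : E → ℝ≥0∞) p.1 * B.indicator (1 : E → ℝ≥0∞) (p.1 + p.2) :=
    (h1.comp measurable_fst).mul (h2.comp (by fun_prop))
  have hK' : Measurable fun p : E × E =>
      B.indicator (1 : E → ℝ≥0∞) p.1 * s.indicator (1 : E → ℝ≥0∞) (p.1 - p.2) :=
    (h2.comp measurable_fst).mul (h1.comp (by fun_prop))
  have eL : m s * vol B = ∫⁻ x, ∫⁻ w, s.indicator (1 : E → ℝ≥0∞) x *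
      B.indicator (1 : E → ℝ≥0∞) (x + w) ∂vol ∂m := by
    have e : ∀ x, ∫⁻ w, s.indicator (1 : E → ℝ≥0∞) x * B.indicator (1 : E → ℝ≥0∞) (x + w) ∂vol =
        s.indicator (1 : E → ℝ≥0∞) x * vol B := by
      intro x
      have hm : Measurable fun w => B.indicator (1 : E → ℝ≥0∞) (x + w) :=
        h2.comp (by fun_prop : Measurable fun w => x + w)
      rw [lintegral_const_mul _ hm, lintegral_add_left_eq_self (fun y => B.indicator (1 : E → ℝ≥0∞) y),
        lintegral_indicator_one hBm]
    simp_rw [e]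
    rw [lintegral_mul_const _ h1, lintegral_indicator_one hs]
  have eR : m B * vol s = ∫⁻ x, ∫⁻ w, B.indicator (1 : E → ℝ≥0∞) x *
      s.indicator (1 : E → ℝ≥0∞) (x - w) ∂vol ∂m := by
    have e : ∀ x, ∫⁻ w, B.indicator (1 : E → ℝ≥0∞) x * s.indicator (1 : E → ℝ≥0∞) (x - w) ∂vol =
        B.indicator (1 : E → ℝ≥0∞) x * vol s := by
      intro x
      have hm : Measurable fun w => s.indicator (1 : E → ℝ≥0∞) (x - w) :=
        h1.comp (by fun_prop : Measurable fun w => x - w)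
      rw [lintegral_const_mul _ hm, lintegral_sub_left_eq_self (fun y => s.indicator (1 : E → ℝ≥0∞) y),
        lintegral_indicator_one hs]
    simp_rw [e]
    rw [lintegral_mul_const _ h2, lintegral_indicator_one hBm]
  rw [eL, eR, lintegral_lintegral_swap (f := fun x w => s.indicator (1 : E → ℝ≥0∞) x *
      B.indicator (1 : E → ℝ≥0∞) (x + w)) hK.aemeasurable,
    lintegral_lintegral_swap (f := fun x w => B.indicator (1 : E → ℝ≥0∞) x *
      s.indicator (1 : E → ℝ≥0∞) (x - w)) hK'.aemeasurable]
  refine lintegral_congr fun w => ?_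
  set t := s ∩ {x | x + w ∈ B} with ht
  have htm : MeasurableSet t := hs.inter ((by fun_prop : Measurable fun x => x + w) hBm)
  have e1 : ∀ x, s.indicator (1 : E → ℝ≥0∞) x * B.indicator (1 : E → ℝ≥0∞) (x + w) =
      t.indicator (1 : E → ℝ≥0∞) x := by
    intro x
    by_cases hx : x ∈ s <;> by_cases hxB : x + w ∈ B <;> simp [ht, Set.indicator, hx, hxB]
  have e2 : ∀ x, B.indicator (1 : E → ℝ≥0∞) x * s.indicator (1 : E → ℝ≥0∞) (x - w) =
      ((fun y => y - w) ⁻¹' t).indicator (1 : E → ℝ≥0∞) x := by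
    intro x
    by_cases hx : x - w ∈ s <;> by_cases hxB : x ∈ B <;> simp [ht, Set.indicator, hx, hxB]
  simp_rw [e1, e2]
  rw [lintegral_indicator_one htm,
    lintegral_indicator_one ((by fun_prop : Measurable fun x => x - w) htm)]
  by_cases hw : ‖w‖ < ρ
  · refine (h w hw t (fun x hx => ?_) htm).symm
    have h3 := hsB hx.1
    rw [hB, Metric.mem_ball] at h3
    rw [Metric.mem_ball]
    have : 0 ≤ ρ := (norm_nonneg w).trans hw.le
    linarith
  -- Both s and B lie within ρ / 4 of y₀, so no shift of norm at least ρ leads from one to the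
  -- other.
  · have : t = ∅ := by
      rw [Set.eq_empty_iff_forall_notMem]
      rintro x ⟨hx, hxw⟩
      have h3 := hsB hx
      have h4 : x + w ∈ B := hxw
      rw [hB, Metric.mem_ball, dist_eq_norm] at h3 h4
      apply hw
      have h5 : ‖w‖ ≤ ‖x + w - y₀‖ + ‖x - y₀‖ := by
        have : w = (x + w - y₀) - (x - y₀) := by abel
        conv_lhs => rw [this]
        exact norm_sub_le _ _
      have : 0 ≤ ρ := by
        by_contra hneg
        linarith [norm_nonneg (x - y₀)]
      linarith [norm_nonneg w]
    simp [this]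

theorem ContinuousLinearMap.det_comp_eq {E : Type*} [NormedAddCommGroup E] [NormedSpace ℝ E]
    (f g : E →L[ℝ] E) : (f.comp g).det = f.det * g.det :=
  LinearMap.det_comp _ _

/-! ### Twist maps -/

section Twist

variable {E : Type*} [NormedAddCommGroup E] [InnerProductSpace ℝ E]

open scoped RealInnerProductSpace

/-- The rotation of angle `s` in the oriented plane spanned by `u` and `w`. -/
noncomputable def planeRotation (u w : E) (s : ℝ) : E →L[ℝ] E :=
  ContinuousLinearMap.id ℝ E +
    (Real.cos s - 1) • ((innerSL ℝ u).smulRight u + (innerSL ℝ w).smulRight w) +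
    Real.sin s • ((innerSL ℝ u).smulRight w - (innerSL ℝ w).smulRight u)

theorem planeRotation_apply (u w : E) (s : ℝ) (x : E) :
    planeRotation u w s x = x + (Real.cos s - 1) • (⟪u, x⟫ • u + ⟪w, x⟫ • w) +
      Real.sin s • (⟪u, x⟫ • w - ⟪w, x⟫ • u) := by
  simp [planeRotation]

/-- The generator of the rotations in the oriented plane spanned by `u` and `w`. -/
noncomputable def planeGenerator (u w : E) (x : E) : E := ⟪u, x⟫ • w - ⟪w, x⟫ • u

theorem inner_planeGenerator_self (u w x : E) : ⟪x, planeGenerator u w x⟫ = 0 := by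
  simp only [planeGenerator, inner_sub_right, inner_smul_right, real_inner_comm x]
  ring

theorem planeRotation_zero (u w x : E) : planeRotation u w 0 x = x := by
  simp [planeRotation_apply]

/-- Two orthogonal unit vectors. -/
structure IsOrthonormalPair (u w : E) : Prop where
  norm_left : ‖u‖ = 1
  norm_right : ‖w‖ = 1
  inner_eq : ⟪u, w⟫ = 0

variable {u w : E}

theorem inner_planeRotation_left (h : IsOrthonormalPair u w) (s : ℝ) (x : E) :
    ⟪u, planeRotation u w s x⟫ = Real.cos s * ⟪u, x⟫ - Real.sin s * ⟪w, x⟫ := by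
  simp only [planeRotation_apply, inner_add_right, inner_sub_right, inner_smul_right, h.inner_eq,
    real_inner_self_eq_norm_sq, h.norm_left]
  ring

theorem inner_planeRotation_right (h : IsOrthonormalPair u w) (s : ℝ) (x : E) :
    ⟪w, planeRotation u w s x⟫ = Real.cos s * ⟪w, x⟫ + Real.sin s * ⟪u, x⟫ := by
  have hwu : ⟪w, u⟫ = 0 := by rw [real_inner_comm, h.inner_eq]
  simp only [planeRotation_apply, inner_add_right, inner_sub_right, inner_smul_right, hwu,
    real_inner_self_eq_norm_sq, h.norm_right]
  ring

theorem planeRotation_planeRotation (h : IsOrthonormalPair u w) (s t : ℝ) (x : E) :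
    planeRotation u w s (planeRotation u w t x) = planeRotation u w (s + t) x := by
  rw [planeRotation_apply u w s, inner_planeRotation_left h,
    inner_planeRotation_right h, planeRotation_apply u w t, planeRotation_apply u w (s + t),
    Real.cos_add, Real.sin_add]
  module

theorem norm_planeRotation (h : IsOrthonormalPair u w) (s : ℝ) (x : E) :
    ‖planeRotation u w s x‖ = ‖x‖ := by
  have h1 : planeRotation u w s x = x +
      (((Real.cos s - 1) * ⟪u, x⟫ - Real.sin s * ⟪w, x⟫) • u +
        ((Real.cos s - 1) * ⟪w, x⟫ + Real.sin s * ⟪u, x⟫) • w) := by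
    rw [planeRotation_apply]
    module
  have hwu : ⟪w, u⟫ = 0 := by rw [real_inner_comm, h.inner_eq]
  have h2 : ‖planeRotation u w s x‖ ^ 2 = ‖x‖ ^ 2 := by
    rw [← real_inner_self_eq_norm_sq, ← real_inner_self_eq_norm_sq, h1]
    simp only [inner_add_right, inner_add_left, inner_smul_right, inner_smul_left, h.inner_eq, hwu,
      real_inner_self_eq_norm_sq, h.norm_left, h.norm_right, real_inner_comm u x,
      real_inner_comm w x, conj_trivial]
    linear_combination (⟪u, x⟫ ^ 2 + ⟪w, x⟫ ^ 2) * Real.sin_sq_add_cos_sq s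
  exact (sq_eq_sq₀ (norm_nonneg _) (norm_nonneg _)).1 h2

theorem planeRotation_pi_smul (h : IsOrthonormalPair u w) (r : ℝ) :
    planeRotation u w Real.pi (r • u) = -(r • u) := by
  have hwu : ⟪w, u⟫ = 0 := by rw [real_inner_comm, h.inner_eq]
  simp only [planeRotation_apply, inner_smul_right, hwu, real_inner_self_eq_norm_sq, h.norm_left,
    Real.cos_pi, Real.sin_pi]
  module

/-- An isometry has determinant ±1, and the rotation is the square of the rotation by half the
angle. -/
theorem det_planeRotation [FiniteDimensional ℝ E] (h : IsOrthonormalPair u w) (s : ℝ) :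
    (planeRotation u w s).det = 1 := by
  have h1 : |(planeRotation u w (s / 2)).det| = 1 := by
    let f : E →ₗᵢ[ℝ] E := ⟨(planeRotation u w (s / 2)).toLinearMap, norm_planeRotation h _⟩
    have := f.normDet_eq_one
    rwa [LinearMap.normDet_eq_abs_det] at this
  have h2 : planeRotation u w s = (planeRotation u w (s / 2)).comp (planeRotation u w (s / 2)) := by
    ext x
    rw [ContinuousLinearMap.comp_apply, planeRotation_planeRotation h, add_halves]
  have h3 : (planeRotation u w s).det =
      (planeRotation u w (s / 2)).det * (planeRotation u w (s / 2)).det := by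
    conv_lhs => rw [h2]
    exact LinearMap.det_comp _ _
  rw [h3, ← abs_mul_abs_self, h1, one_mul]

/-- The map that rotates each sphere of centre `c` by an angle that depends on its radius. -/
noncomputable def twist (u w : E) (α : ℝ → ℝ) (c x : E) : E :=
  c + planeRotation u w (α (‖x - c‖ ^ 2)) (x - c)

theorem norm_twist_sub (h : IsOrthonormalPair u w) (α : ℝ → ℝ) (c x : E) :
    ‖twist u w α c x - c‖ = ‖x - c‖ := by
  rw [twist, add_sub_cancel_left, norm_planeRotation h]

/-- The twist preserves the distance to c, so the second map sees the same radius and undoes the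
same angle. -/
theorem twist_neg_twist (h : IsOrthonormalPair u w) (α : ℝ → ℝ) (c x : E) :
    twist u w (fun r => -α r) c (twist u w α c x) = x := by
  rw [twist, norm_twist_sub h, twist, add_sub_cancel_left, planeRotation_planeRotation h,
    neg_add_cancel, planeRotation_zero, add_sub_cancel]

theorem twist_twist_neg (h : IsOrthonormalPair u w) (α : ℝ → ℝ) (c x : E) :
    twist u w α c (twist u w (fun r => -α r) c x) = x := by
  have := twist_neg_twist h (fun r => -α r) c x
  simpa using this

theorem twist_of_eq_zero {α : ℝ → ℝ} {c x : E} (hx : α (‖x - c‖ ^ 2) = 0) :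
    twist u w α c x = x := by
  rw [twist, hx, planeRotation_zero, add_sub_cancel]

theorem contDiff_twist (u w : E) {α : ℝ → ℝ} (hα : ContDiff ℝ ∞ α) (c : E) :
    ContDiff ℝ ∞ (twist u w α c) := by
  have h1 : ContDiff ℝ ∞ fun x : E => α (‖x - c‖ ^ 2) :=
    hα.comp ((contDiff_norm_sq ℝ).comp (contDiff_id.sub contDiff_const))
  have h2 : ContDiff ℝ ∞ fun x : E => ⟪u, x - c⟫ :=
    contDiff_const.inner ℝ (contDiff_id.sub contDiff_const)
  have h3 : ContDiff ℝ ∞ fun x : E => ⟪w, x - c⟫ :=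
    contDiff_const.inner ℝ (contDiff_id.sub contDiff_const)
  unfold twist
  simp only [planeRotation_apply]
  exact contDiff_const.add (((contDiff_id.sub contDiff_const).add
    (((Real.contDiff_cos.comp h1).sub contDiff_const).smul
      ((h2.smul contDiff_const).add (h3.smul contDiff_const)))).add
    ((Real.contDiff_sin.comp h1).smul ((h2.smul contDiff_const).sub (h3.smul contDiff_const))))

/-- The derivative of the rotation in its angle is the rotation applied to the generator, so the
rotation factors out on the left and leaves a rank-one perturbation of the identity. -/
theorem hasFDerivAt_twist (h : IsOrthonormalPair u w) {α : ℝ → ℝ} (hα : Differentiable ℝ α)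
    (c x : E) :
    HasFDerivAt (twist u w α c) ((planeRotation u w (α (‖x - c‖ ^ 2))).comp
      (ContinuousLinearMap.id ℝ E + ((2 * deriv α (‖x - c‖ ^ 2)) • innerSL ℝ (x - c)).smulRight
        (planeGenerator u w (x - c)))) x := by
  have h0 : HasFDerivAt (fun x : E => x - c) (ContinuousLinearMap.id ℝ E) x :=
    (hasFDerivAt_id x).sub_const c
  have h1 := (hα (‖x - c‖ ^ 2)).hasDerivAt.comp_hasFDerivAt x h0.norm_sq
  have h2 : HasFDerivAt (fun x : E => ⟪u, x - c⟫) (innerSL ℝ u) x :=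
    (innerSL ℝ u).hasFDerivAt.comp x h0
  have h3 : HasFDerivAt (fun x : E => ⟪w, x - c⟫) (innerSL ℝ w) x :=
    (innerSL ℝ w).hasFDerivAt.comp x h0
  have h4 := (h0.add ((h1.cos.sub_const 1).fun_smul
      ((h2.smul_const u).add (h3.smul_const w)))).add
    (h1.sin.fun_smul ((h2.smul_const w).sub (h3.smul_const u)))
  have h5 := h4.const_add c
  have e : twist u w α c = fun y => c + (y - c +
      (Real.cos (α (‖y - c‖ ^ 2)) - 1) • (⟪u, y - c⟫ • u + ⟪w, y - c⟫ • w) +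
      Real.sin (α (‖y - c‖ ^ 2)) • (⟪u, y - c⟫ • w - ⟪w, y - c⟫ • u)) := by
    ext y
    rw [twist, planeRotation_apply]
  rw [e]
  refine h5.congr_fderiv ?_
  ext v
  have hwu : ⟪w, u⟫ = 0 := by rw [real_inner_comm, h.inner_eq]
  simp [planeRotation_apply, planeGenerator, inner_sub_right, inner_smul_right,
    h.inner_eq, hwu, h.norm_left, h.norm_right]
  module

/-- The generator at x - c is orthogonal to x - c, so the rank-one perturbation is a transvection of
determinant one. -/
theorem det_fderiv_twist [FiniteDimensional ℝ E] (h : IsOrthonormalPair u w) {α : ℝ → ℝ}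
    (hα : Differentiable ℝ α) (c x : E) : (fderiv ℝ (twist u w α c) x).det = 1 := by
  rw [(hasFDerivAt_twist h hα c x).fderiv]
  have h1 : (ContinuousLinearMap.id ℝ E +
      ((2 * deriv α (‖x - c‖ ^ 2)) • innerSL ℝ (x - c)).smulRight
        (planeGenerator u w (x - c))).det = 1 := by
    have e : (ContinuousLinearMap.id ℝ E +
      ((2 * deriv α (‖x - c‖ ^ 2)) • innerSL ℝ (x - c)).smulRight
        (planeGenerator u w (x - c))).toLinearMap = LinearMap.transvection
          ((2 * deriv α (‖x - c‖ ^ 2)) • innerSL ℝ (x - c)).toLinearMap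
          (planeGenerator u w (x - c)) := by
      ext v
      simp [LinearMap.transvection]
    rw [ContinuousLinearMap.det, e, LinearMap.transvection.det]
    have e' : ((2 * deriv α (‖x - c‖ ^ 2)) • innerSL ℝ (x - c)) (planeGenerator u w (x - c)) =
        (2 * deriv α (‖x - c‖ ^ 2)) * ⟪x - c, planeGenerator u w (x - c)⟫ := rfl
    rw [inner_planeGenerator_self, mul_zero] at e'
    erw [e', add_zero]
  rw [ContinuousLinearMap.det_comp_eq, det_planeRotation h, h1, one_mul]

/-- In dimension at least two, small translations extend to volume-preserving diffeomorphisms with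
compact support. -/
theorem exists_contDiff_eq_translation [FiniteDimensional ℝ E] (hE : 2 ≤ Module.finrank ℝ E)
    (y₀ v : E) {ρ : ℝ} (hv : ‖v‖ < ρ) :
    ∃ T : E ≃ E, ContDiff ℝ ∞ T ∧ ContDiff ℝ ∞ T.symm ∧ (∀ x, (fderiv ℝ T x).det = 1) ∧
      (∀ x ∈ Metric.ball y₀ ρ, T x = x + v) ∧ ∀ x ∉ Metric.ball y₀ (4 * ρ), T x = x := by
  have hρ : 0 < ρ := (norm_nonneg v).trans_lt hv
  rcases eq_or_ne v 0 with rfl | hv0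
  · refine ⟨Equiv.refl E, contDiff_id, contDiff_id, fun x => ?_, fun x _ => ?_, fun x _ => rfl⟩
    · have : fderiv ℝ (Equiv.refl E) x = ContinuousLinearMap.id ℝ E := fderiv_id
      rw [this]
      exact LinearMap.det_id
    · simp
  -- Dimension at least two leaves room for a unit vector orthogonal to v.
  obtain ⟨w, hw⟩ : ∃ w : E, IsOrthonormalPair ((‖v‖⁻¹ : ℝ) • v) w := by
    have h1 : Module.finrank ℝ (ℝ ∙ v)ᗮ ≠ 0 := by
      have h2 := Submodule.finrank_add_finrank_orthogonal (ℝ ∙ v)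
      rw [finrank_span_singleton hv0] at h2
      omega
    have : Nontrivial (ℝ ∙ v)ᗮ := Module.nontrivial_of_finrank_pos (Nat.pos_of_ne_zero h1)
    obtain ⟨z, hz⟩ := exists_ne (0 : (ℝ ∙ v)ᗮ)
    have hz' : (z : E) ≠ 0 := by simpa using hz
    have hvz : ⟪v, (z : E)⟫ = 0 := Submodule.mem_orthogonal_singleton_iff_inner_right.1 z.2
    refine ⟨(‖(z : E)‖⁻¹ : ℝ) • (z : E), ?_, ?_, ?_⟩
    · rw [norm_smul, norm_inv, norm_norm, inv_mul_cancel₀ (norm_ne_zero_iff.2 hv0)]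
    · rw [norm_smul, norm_inv, norm_norm, inv_mul_cancel₀ (norm_ne_zero_iff.2 hz')]
    · rw [inner_smul_left, inner_smul_right, hvz, mul_zero, mul_zero]
  set u := (‖v‖⁻¹ : ℝ) • v with hu
  have hvu : ((‖v‖ / 2) : ℝ) • u = (2⁻¹ : ℝ) • v := by
    rw [hu, smul_smul]
    congr 1
    field_simp [norm_ne_zero_iff.2 hv0]
  -- Angle π up to radius 2ρ and angle 0 from radius 3ρ on; the argument of α is the squared radius.
  let α : ℝ → ℝ := fun r => Real.pi * (Real.smoothTransition ((9 * ρ ^ 2 - r) / (5 * ρ ^ 2)))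
  have hα : ContDiff ℝ ∞ α := contDiff_const.mul
    (Real.smoothTransition.contDiff.comp ((contDiff_const.sub contDiff_id).div_const _))
  have hα0 : ∀ r, 9 * ρ ^ 2 ≤ r → α r = 0 := by
    intro r hr
    have : (9 * ρ ^ 2 - r) / (5 * ρ ^ 2) ≤ 0 :=
      div_nonpos_of_nonpos_of_nonneg (by linarith) (by positivity)
    simp [α, Real.smoothTransition.zero_of_nonpos this]
  have hα1 : ∀ r, r ≤ 4 * ρ ^ 2 → α r = Real.pi := by
    intro r hr
    have : 1 ≤ (9 * ρ ^ 2 - r) / (5 * ρ ^ 2) := by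
      rw [le_div_iff₀ (by positivity)]
      linarith
    simp [α, Real.smoothTransition.one_of_one_le this]
  let tw : E → E ≃ E := fun c => ⟨twist u w α c, twist u w (fun r => -α r) c,
    twist_neg_twist hw α c, twist_twist_neg hw α c⟩
  have hαd : Differentiable ℝ α := hα.differentiable (by simp)
  -- The half-turns about y₀ and about y₀ + v / 2 compose to the translation by v: their linear
  -- parts cancel, and y₀ - c is a multiple of u, which a half-turn negates.
  set c := y₀ + (2⁻¹ : ℝ) • v with hc
  have hcn : ‖(2⁻¹ : ℝ) • v‖ = ‖v‖ / 2 := by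
    rw [norm_smul]
    norm_num
    ring
  have far : ∀ c' x : E, 3 * ρ ≤ ‖x - c'‖ → twist u w α c' x = x := by
    intro c' x hx
    refine twist_of_eq_zero (hα0 _ ?_)
    nlinarith
  have near : ∀ c' x : E, ‖x - c'‖ ≤ 2 * ρ →
      twist u w α c' x = c' + planeRotation u w Real.pi (x - c') := by
    intro c' x hx
    rw [twist, hα1]
    nlinarith [norm_nonneg (x - c')]
  refine ⟨(tw y₀).trans (tw c), ?_, ?_, ?_, ?_, ?_⟩
  · exact (contDiff_twist u w hα c).comp (contDiff_twist u w hα y₀)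
  · exact (contDiff_twist u w hα.neg y₀).comp (contDiff_twist u w hα.neg c)
  · intro x
    have e : fderiv ℝ ((tw y₀).trans (tw c)) x = (fderiv ℝ (twist u w α c) (twist u w α y₀ x)).comp
        (fderiv ℝ (twist u w α y₀) x) :=
      fderiv_comp x (hasFDerivAt_twist hw hαd _ _).differentiableAt
        (hasFDerivAt_twist hw hαd _ _).differentiableAt
    rw [e, ContinuousLinearMap.det_comp_eq, det_fderiv_twist hw hαd, det_fderiv_twist hw hαd,
      one_mul]
  · intro x hx
    rw [Metric.mem_ball, dist_eq_norm] at hx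
    change twist u w α c (twist u w α y₀ x) = x + v
    have h1 : ‖twist u w α y₀ x - c‖ ≤ 2 * ρ := by
      have : twist u w α y₀ x - c = (twist u w α y₀ x - y₀) - (2⁻¹ : ℝ) • v := by
        rw [hc]
        abel
      rw [this]
      refine (norm_sub_le _ _).trans ?_
      rw [norm_twist_sub hw, hcn]
      linarith
    rw [near c _ h1, near y₀ x (by linarith)]
    have h2 : y₀ + planeRotation u w Real.pi (x - y₀) - c =
        planeRotation u w Real.pi (x - y₀) - (‖v‖ / 2) • u := by
      rw [hvu, hc]
      abel
    rw [h2, map_sub, planeRotation_pi_smul hw, planeRotation_planeRotation hw, hvu]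
    have h3 : planeRotation u w (Real.pi + Real.pi) (x - y₀) = x - y₀ := by
      rw [planeRotation_apply, ← two_mul, Real.cos_two_pi, Real.sin_two_pi]
      simp
    rw [h3, hc]
    module
  · intro x hx
    rw [Metric.mem_ball, dist_eq_norm, not_lt] at hx
    change twist u w α c (twist u w α y₀ x) = x
    rw [far y₀ x (by linarith), far c x]
    have : ‖x - y₀‖ ≤ ‖x - c‖ + ‖(2⁻¹ : ℝ) • v‖ := by
      have e : x - y₀ = (x - c) + (2⁻¹ : ℝ) • v := by
        rw [hc]
        abel
      rw [e]
      exact norm_add_le _ _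
    rw [hcn] at this
    linarith

end Twist

/-! ### Local diffeomorphisms with prescribed Jacobian determinant -/

/-- A smooth compactly supported function is locally a directional derivative of a smooth
function. -/
theorem exists_contDiff_fderiv_apply_eq {E : Type*} [NormedAddCommGroup E] [NormedSpace ℝ E]
    [FiniteDimensional ℝ E] {e : E} (he : e ≠ 0) {g : E → ℝ} (hg : ContDiff ℝ ∞ g)
    (hgc : HasCompactSupport g) (y : E) (R : ℝ) :
    ∃ F : E → ℝ, ContDiff ℝ ∞ F ∧ ∀ x ∈ Metric.ball y R, fderiv ℝ F x e = g x := by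
  let _ : MeasurableSpace E := borel E
  have : BorelSpace E := ⟨rfl⟩
  obtain ⟨R', hR'⟩ := hgc.isCompact.isBounded.subset_closedBall y
  -- N is so large that, for x in the ball, x - N e lies outside the support of g.
  obtain ⟨N, hN⟩ : ∃ N : ℝ, R + R' < N * ‖e‖ := by
    refine ⟨(R + R' + 1) / ‖e‖, ?_⟩
    rw [div_mul_cancel₀ _ (norm_ne_zero_iff.2 he)]
    linarith
  have hem : Measurable fun t : ℝ => t • e := by fun_prop
  -- F₀ x will be the integral of g (x - t e) over t from 0 to N. As a convolution with a finite
  -- measure on a segment it inherits the smoothness of g.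
  let μ : Measure E := (volume.restrict (uIoc 0 N)).map (fun t : ℝ => t • e)
  have hμ : IsFiniteMeasure μ := by
    have : IsFiniteMeasure ((volume : Measure ℝ).restrict (uIoc 0 N)) :=
      ⟨by simp [uIoc, Real.volume_Ioc]⟩
    exact Measure.isFiniteMeasure_map _ _
  let F₀ : E → ℝ := convolution (fun _ => (1 : ℝ)) g (ContinuousLinearMap.mul ℝ ℝ) μ
  have hF₀ : ContDiff ℝ ∞ F₀ := hgc.contDiff_convolution_right (n := ⊤) _
    (locallyIntegrable_const (1 : ℝ)) hg
  refine ⟨F₀, hF₀, fun x hx => ?_⟩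
  have hR : 0 < R := (dist_nonneg).trans_lt (Metric.mem_ball.1 hx)
  have hgz : ∀ z, z ∉ Metric.closedBall y R' → g z = 0 := fun z hz =>
    image_eq_zero_of_notMem_tsupport fun h => hz (hR' h)
  rcases lt_or_ge R' 0 with hneg | hR0
  · have hg0 : g = 0 := by
      ext z
      exact hgz z fun h => absurd ((dist_nonneg).trans (Metric.mem_closedBall.1 h)) (by linarith)
    have : F₀ = 0 := by
      ext z
      simp [F₀, hg0]
    simp [this, hg0]
  have hN0 : 0 ≤ N := by
    by_contra hneg
    nlinarith [norm_pos_iff.2 he]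
  let k : ℝ → ℝ := fun u => g (x + u • e)
  have hk : Continuous k := hg.continuous.comp (by fun_prop)
  have hFk : ∀ h : ℝ, F₀ (x + h • e) = (∫ u in (0 : ℝ)..h, k u) - ∫ u in (0 : ℝ)..(h - N), k u := by
    intro h
    have h1 : F₀ (x + h • e) = ∫ t in (0 : ℝ)..N, k (h - t) := by
      rw [intervalIntegral.integral_of_le hN0]
      simp only [F₀, convolution_def, μ, uIoc_of_le hN0]
      rw [integral_map hem.aemeasurable]
      · refine integral_congr_ae (ae_of_all _ fun t => ?_)
        simp only [ContinuousLinearMap.mul_apply', one_mul, k]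
        congr 1
        module
      · refine Continuous.aestronglyMeasurable ?_
        simp only [ContinuousLinearMap.mul_apply', one_mul]
        exact hg.continuous.comp (by fun_prop)
    rw [h1, intervalIntegral.integral_comp_sub_left (fun u => k u), sub_zero,
      ← intervalIntegral.integral_interval_sub_left (hk.intervalIntegrable _ _)
        (hk.intervalIntegrable _ _)]
  have hd : HasDerivAt (fun h : ℝ => F₀ (x + h • e)) (k 0 - k (0 - N)) 0 := by
    have h1 : HasDerivAt (fun h : ℝ => ∫ u in (0 : ℝ)..h, k u) (k 0) 0 :=
      intervalIntegral.integral_hasDerivAt_right (hk.intervalIntegrable _ _)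
        (hk.stronglyMeasurableAtFilter _ _) hk.continuousAt
    have h2 : HasDerivAt (fun h : ℝ => ∫ u in (0 : ℝ)..h, k u) (k (0 - N)) (0 - N) :=
      intervalIntegral.integral_hasDerivAt_right (hk.intervalIntegrable _ _)
        (hk.stronglyMeasurableAtFilter _ _) hk.continuousAt
    have h3 := h2.comp_sub_const 0 N
    have e1 : (fun h : ℝ => F₀ (x + h • e)) =
        fun h => (∫ u in (0 : ℝ)..h, k u) - ∫ u in (0 : ℝ)..(h - N), k u := funext hFk
    rw [e1]
    exact h1.sub h3
  have hd' : HasDerivAt (fun h : ℝ => F₀ (x + h • e)) (fderiv ℝ F₀ x e) 0 := by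
    have h1 : HasFDerivAt F₀ (fderiv ℝ F₀ x) (x + (0 : ℝ) • e) := by
      rw [zero_smul, add_zero]
      exact (hF₀.differentiable (by simp) x).hasFDerivAt
    have h2 : HasDerivAt (fun h : ℝ => x + h • e) e 0 := by
      simpa using ((hasDerivAt_id (0 : ℝ)).smul_const e).const_add x
    exact h1.comp_hasDerivAt (0 : ℝ) h2
  rw [hd'.unique hd]
  have h1 : k (0 - N) = 0 := by
    refine hgz _ fun h => ?_
    rw [Metric.mem_closedBall, dist_eq_norm] at h
    rw [Metric.mem_ball, dist_eq_norm] at hx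
    have h2 : N * ‖e‖ ≤ ‖x - y‖ + ‖x + (0 - N) • e - y‖ := by
      have h3 : N • e = (x - y) - (x + (0 - N) • e - y) := by module
      calc N * ‖e‖ = ‖N • e‖ := by rw [norm_smul, Real.norm_of_nonneg hN0]
        _ ≤ _ := by
          rw [h3]
          exact norm_sub_le _ _
    linarith
  rw [h1, sub_zero]
  simp [k]

theorem ContinuousLinearMap.det_id_add_smulRight {E : Type*} [NormedAddCommGroup E] [NormedSpace ℝ E]
    [FiniteDimensional ℝ E] (f : E →L[ℝ] ℝ) (v : E) :
    (ContinuousLinearMap.id ℝ E + f.smulRight v).det = 1 + f v := by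
  have e : (ContinuousLinearMap.id ℝ E + f.smulRight v).toLinearMap =
      LinearMap.transvection f.toLinearMap v := by
    ext x
    simp [LinearMap.transvection]
  rw [ContinuousLinearMap.det, e, LinearMap.transvection.det]
  rfl

/-- Every smooth positive function is locally the Jacobian determinant of a diffeomorphism. -/
theorem exists_openPartialHomeomorph_det_fderiv_eq {d : ℕ}
    {U : Set (EuclideanSpace ℝ (Fin d))} (hU : IsOpen U) {y : EuclideanSpace ℝ (Fin d)}
    (hy : y ∈ U) {r : EuclideanSpace ℝ (Fin d) → ℝ} (hr : ContDiffOn ℝ ∞ r U)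
    (hpos : ∀ x ∈ U, 0 < r x) (h0 : d = 0 → r y = 1) :
    ∃ S : OpenPartialHomeomorph (EuclideanSpace ℝ (Fin d)) (EuclideanSpace ℝ (Fin d)),
      y ∈ S.source ∧ S.source ⊆ U ∧ ContDiffOn ℝ ∞ S S.source ∧
      ContDiffOn ℝ ∞ S.symm S.target ∧ ∀ x ∈ S.source, (fderiv ℝ S x).det = r x := by
  -- In dimension zero every determinant is 1, so the condition `h0` is unavoidable.
  rcases Nat.eq_zero_or_pos d with rfl | hd
  · refine ⟨OpenPartialHomeomorph.ofSet U hU, hy, subset_rfl, contDiff_id.contDiffOn,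
      contDiff_id.contDiffOn, fun x _ => ?_⟩
    rw [Subsingleton.elim x y, h0 rfl]
    have : fderiv ℝ (OpenPartialHomeomorph.ofSet U hU) y =
      ContinuousLinearMap.id ℝ (EuclideanSpace ℝ (Fin 0)) := fderiv_id
    rw [this]
    exact LinearMap.det_id
  obtain ⟨ε, hε, hεU⟩ := Metric.isOpen_iff.1 hU y hy
  let χ : ContDiffBump y := ⟨ε / 4, ε / 2, by positivity, by linarith⟩
  have hχU : tsupport χ ⊆ U := by
    rw [χ.tsupport_eq]
    exact (Metric.closedBall_subset_ball (by simp [χ]; linarith)).trans hεU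
  let g : EuclideanSpace ℝ (Fin d) → ℝ := fun x => χ x * r x
  have hg : ContDiff ℝ ∞ g := by
    refine contDiff_of_contDiffOn_union_of_isOpen (s := U) (t := (tsupport χ)ᶜ)
      (χ.contDiff.contDiffOn.mul hr) ?_ ?_ hU (isClosed_tsupport _).isOpen_compl
    · refine (contDiffOn_const (c := (0 : ℝ))).congr fun x hx => ?_
      simp [g, image_eq_zero_of_notMem_tsupport hx]
    · rw [eq_univ_iff_forall]
      intro x
      by_cases hx : x ∈ tsupport χ
      · exact Or.inl (hχU hx)
      · exact Or.inr hx
  let i₀ : Fin d := ⟨0, hd⟩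
  let e : EuclideanSpace ℝ (Fin d) := EuclideanSpace.single i₀ 1
  have he1 : ‖e‖ = 1 := by simp [e]
  have he : e ≠ 0 := by
    rw [← norm_ne_zero_iff, he1]
    exact one_ne_zero
  obtain ⟨F, hF, hFg⟩ := exists_contDiff_fderiv_apply_eq he hg χ.hasCompactSupport.mul_right y ε
  -- Only the coordinate along e is changed: it becomes F, whose derivative along e is r near y and
  -- is the whole Jacobian determinant.
  let T : EuclideanSpace ℝ (Fin d) → EuclideanSpace ℝ (Fin d) :=
    fun x => x + (F x - innerSL ℝ e x) • e
  have hT : ContDiff ℝ ∞ T :=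
    contDiff_id.add ((hF.sub (innerSL ℝ e).contDiff).smul contDiff_const)
  have hTd : ∀ x ∈ Metric.ball y (ε / 4), (fderiv ℝ T x).det = r x := by
    intro x hx
    have h1 : HasFDerivAt T (ContinuousLinearMap.id ℝ _ +
        (fderiv ℝ F x - innerSL ℝ e).smulRight e) x :=
      (hasFDerivAt_id x).add ((((hF.differentiable (by simp)) x).hasFDerivAt.sub
        (innerSL ℝ e).hasFDerivAt).smul_const e)
    have h2 : g x = r x := by
      have : χ x = 1 := χ.one_of_mem_closedBall (Metric.ball_subset_closedBall hx)
      simp [g, this]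
    rw [h1.fderiv, ContinuousLinearMap.det_id_add_smulRight]
    have h3 : (innerSL ℝ e) e = 1 := by
      rw [innerSL_apply_apply, real_inner_self_eq_norm_sq, he1, one_pow]
    rw [sub_apply, h3,
      hFg x (Metric.ball_subset_ball (by linarith) hx), h2]
    ring
  have hTe : ∀ x ∈ Metric.ball y (ε / 4), ∃ f' : EuclideanSpace ℝ (Fin d) ≃L[ℝ]
      EuclideanSpace ℝ (Fin d), HasFDerivAt T (f' : _ →L[ℝ] _) x := by
    intro x hx
    have h1 : (fderiv ℝ T x).det ≠ 0 := by
      rw [hTd x hx]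
      exact (hpos x (hεU (Metric.ball_subset_ball (by linarith) hx))).ne'
    refine ⟨(fderiv ℝ T x).toContinuousLinearEquivOfDetNeZero h1, ?_⟩
    rw [ContinuousLinearMap.coe_toContinuousLinearEquivOfDetNeZero]
    exact (hT.differentiable (by simp) x).hasFDerivAt
  have hyb : y ∈ Metric.ball y (ε / 4) := Metric.mem_ball_self (by positivity)
  obtain ⟨f', hf'⟩ := hTe y hyb
  let S := (hT.contDiffAt.toOpenPartialHomeomorph T hf' (by simp)).restr (Metric.ball y (ε / 4))
  have hS : (S : EuclideanSpace ℝ (Fin d) → EuclideanSpace ℝ (Fin d)) = T := rfl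
  have hSs : S.source = (hT.contDiffAt.toOpenPartialHomeomorph T hf' (by simp)).source ∩
      Metric.ball y (ε / 4) := OpenPartialHomeomorph.restr_source' _ _ Metric.isOpen_ball
  have hSb : S.source ⊆ Metric.ball y (ε / 4) := hSs ▸ inter_subset_right
  refine ⟨S, ?_, ?_, ?_, ?_, ?_⟩
  · rw [hSs]
    exact ⟨hT.contDiffAt.mem_toOpenPartialHomeomorph_source hf' (by simp), hyb⟩
  · exact hSb.trans ((Metric.ball_subset_ball (by linarith)).trans hεU)
  · rw [hS]
    exact hT.contDiffOn
  · intro z hz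
    obtain ⟨f'', hf''⟩ := hTe (S.symm z) (hSb (S.map_target hz))
    exact (S.contDiffAt_symm hz (hS ▸ hf'') (hS ▸ hT.contDiffAt)).contDiffWithinAt
  · intro x hx
    rw [hS]
    exact hTd x (hSb hx)

/-! ### The Gram matrix of a metric in a chart -/

/-- The Gram matrix of the images under `L` of the standard basis vectors. -/
noncomputable def gramMatrix {d : ℕ} {V : Type*} [AddCommGroup V] [Module ℝ V] [TopologicalSpace V]
    (b : V →L[ℝ] V →L[ℝ] ℝ) (L : EuclideanSpace ℝ (Fin d) →L[ℝ] V) : Matrix (Fin d) (Fin d) ℝ :=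
  Matrix.of fun i j => b (L (EuclideanSpace.single i 1)) (L (EuclideanSpace.single j 1))

/-- With P the matrix of D, the Gram matrix G becomes Pᵀ G P. -/
theorem det_gramMatrix_comp {d : ℕ} {V : Type*} [AddCommGroup V] [Module ℝ V] [TopologicalSpace V]
    (b : V →L[ℝ] V →L[ℝ] ℝ) (L : EuclideanSpace ℝ (Fin d) →L[ℝ] V)
    (D : EuclideanSpace ℝ (Fin d) →L[ℝ] EuclideanSpace ℝ (Fin d)) :
    (gramMatrix b (L.comp D)).det = D.det ^ 2 * (gramMatrix b L).det := by
  let B := (EuclideanSpace.basisFun (Fin d) ℝ).toBasis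
  let P : Matrix (Fin d) (Fin d) ℝ := LinearMap.toMatrix B B D.toLinearMap
  have hP : P.det = D.det := LinearMap.det_toMatrix B D.toLinearMap
  have hD : ∀ j, D (EuclideanSpace.single j 1) = ∑ k, P k j • EuclideanSpace.single k (1 : ℝ) := by
    intro j
    have h1 := B.sum_repr (D (EuclideanSpace.single j 1))
    rw [← h1]
    refine Finset.sum_congr rfl fun k _ => ?_
    simp [B, P, LinearMap.toMatrix_apply]
  have e : gramMatrix b (L.comp D) = P.transpose * gramMatrix b L * P := by
    ext i j
    simp only [gramMatrix, Matrix.of_apply, ContinuousLinearMap.comp_apply, hD, map_sum, map_smul,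
      Matrix.mul_apply, Matrix.transpose_apply, sum_apply,
      smul_apply, smul_eq_mul]
    refine Finset.sum_congr rfl fun l _ => ?_
    ring
  rw [e, Matrix.det_mul, Matrix.det_mul, Matrix.det_transpose, hP]
  ring

theorem det_gramMatrix_pos {d : ℕ} {V : Type*} [AddCommGroup V] [Module ℝ V] [TopologicalSpace V]
    {b : V →L[ℝ] V →L[ℝ] ℝ} (hs : ∀ v w, b v w = b w v) (hp : ∀ v, v ≠ 0 → 0 < b v v)
    {L : EuclideanSpace ℝ (Fin d) →L[ℝ] V} (hL : Function.Injective L) :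
    0 < (gramMatrix b L).det := by
  refine Matrix.PosDef.det_pos (Matrix.PosDef.of_dotProduct_mulVec_pos ?_ fun x hx => ?_)
  · ext i j
    simp [gramMatrix, hs (L (EuclideanSpace.single j 1))]
  · have h1 : WithLp.toLp 2 x = ∑ k, x k • EuclideanSpace.single k (1 : ℝ) := by
      ext i
      simp [Finset.sum_apply, Pi.single_apply]
    have h2 : star x ⬝ᵥ (gramMatrix b L).mulVec x = b (L (WithLp.toLp 2 x)) (L (WithLp.toLp 2 x)) := by
      rw [h1]
      simp only [dotProduct, Matrix.mulVec, gramMatrix, Matrix.of_apply, map_sum, map_smul,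
        sum_apply, smul_apply, smul_eq_mul, star_trivial,
        Finset.mul_sum]
      rw [Finset.sum_comm]
      refine Finset.sum_congr rfl fun l _ => Finset.sum_congr rfl fun k _ => ?_
      ring
    rw [h2]
    refine hp _ fun h => hx ?_
    have h3 : WithLp.toLp 2 x = 0 := hL (by rw [h, map_zero])
    simpa using h3

section Charts

theorem transition_mem_source {d : ℕ} {M : Type*} [TopologicalSpace M]
    {φ φ' : OpenPartialHomeomorph M (EuclideanSpace ℝ (Fin d))}
    {x : M} (hx : x ∈ φ.source) (hx' : x ∈ φ'.source) : φ x ∈ (φ.symm ≫ₕ φ').source := by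
  rw [OpenPartialHomeomorph.trans_source]
  refine ⟨φ.map_source hx, ?_⟩
  rw [mem_preimage, φ.left_inv hx]
  exact hx'

variable {d : ℕ} {M : Type*} [TopologicalSpace M] [ChartedSpace (EuclideanSpace ℝ (Fin d)) M]

theorem contDiffOn_transition {φ φ' : OpenPartialHomeomorph M (EuclideanSpace ℝ (Fin d))}
    (hφ : φ ∈ IsManifold.maximalAtlas (𝓡 d) ∞ M) (hφ' : φ' ∈ IsManifold.maximalAtlas (𝓡 d) ∞ M) :
    ContDiffOn ℝ ∞ (φ' ∘ φ.symm) (φ.symm ≫ₕ φ').source := by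
  rw [← contMDiffOn_iff_contDiffOn]
  refine (contMDiffOn_of_mem_maximalAtlas hφ').comp
    ((contMDiffOn_symm_of_mem_maximalAtlas hφ).mono ?_) ?_
  · intro y hy
    rw [OpenPartialHomeomorph.trans_source] at hy
    exact hy.1
  · intro y hy
    rw [OpenPartialHomeomorph.trans_source] at hy
    exact hy.2

theorem contDiffAt_transition {φ φ' : OpenPartialHomeomorph M (EuclideanSpace ℝ (Fin d))}
    (hφ : φ ∈ IsManifold.maximalAtlas (𝓡 d) ∞ M) (hφ' : φ' ∈ IsManifold.maximalAtlas (𝓡 d) ∞ M)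
    {x : M} (hx : x ∈ φ.source) (hx' : x ∈ φ'.source) :
    ContDiffAt ℝ ∞ (φ' ∘ φ.symm) (φ x) :=
  (contDiffOn_transition hφ hφ').contDiffAt
    ((φ.symm ≫ₕ φ').open_source.mem_nhds (transition_mem_source hx hx'))

theorem mdifferentiableAt_symm {φ : OpenPartialHomeomorph M (EuclideanSpace ℝ (Fin d))}
    (hφ : φ ∈ IsManifold.maximalAtlas (𝓡 d) ∞ M) {y : EuclideanSpace ℝ (Fin d)}
    (hy : y ∈ φ.target) : MDifferentiableAt (𝓡 d) (𝓡 d) φ.symm y :=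
  ((contMDiffOn_symm_of_mem_maximalAtlas hφ).contMDiffAt
    (φ.open_target.mem_nhds hy)).mdifferentiableAt (by simp)

theorem injective_mfderiv_symm {φ : OpenPartialHomeomorph M (EuclideanSpace ℝ (Fin d))}
    (hφ : φ ∈ IsManifold.maximalAtlas (𝓡 d) ∞ M) {y : EuclideanSpace ℝ (Fin d)}
    (hy : y ∈ φ.target) : Function.Injective (mfderiv (𝓡 d) (𝓡 d) φ.symm y) := by
  have h1 : MDifferentiableAt (𝓡 d) (𝓡 d) φ (φ.symm y) :=
    ((contMDiffOn_of_mem_maximalAtlas hφ).contMDiffAt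
      (φ.open_source.mem_nhds (φ.map_target hy))).mdifferentiableAt (by simp)
  have h2 := mfderiv_comp y h1 (mdifferentiableAt_symm hφ hy)
  have h3 : φ ∘ φ.symm =ᶠ[𝓝 y] id := by
    filter_upwards [φ.open_target.mem_nhds hy] with z hz
    exact φ.right_inv hz
  rw [h3.mfderiv_eq, mfderiv_id] at h2
  intro v w hvw
  have h4 := congrArg (fun L => L v) h2
  have h5 := congrArg (fun L => L w) h2
  simp only [ContinuousLinearMap.comp_apply] at h4 h5
  rw [hvw, ← h5] at h4
  exact h4

/-- The derivative of the inverse of a chart, in the model space. -/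
noncomputable def symmDeriv (φ : OpenPartialHomeomorph M (EuclideanSpace ℝ (Fin d)))
    (y : EuclideanSpace ℝ (Fin d)) : EuclideanSpace ℝ (Fin d) →L[ℝ] EuclideanSpace ℝ (Fin d) :=
  mfderiv (𝓡 d) (𝓡 d) φ.symm y

theorem symmDeriv_eq_comp {φ φ' : OpenPartialHomeomorph M (EuclideanSpace ℝ (Fin d))}
    (hφ : φ ∈ IsManifold.maximalAtlas (𝓡 d) ∞ M) (hφ' : φ' ∈ IsManifold.maximalAtlas (𝓡 d) ∞ M)
    {x : M} (hx : x ∈ φ.source) (hx' : x ∈ φ'.source) :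
    symmDeriv φ (φ x) = (symmDeriv φ' (φ' x)).comp (fderiv ℝ (φ' ∘ φ.symm) (φ x)) := by
  have h1 : φ.symm =ᶠ[𝓝 (φ x)] φ'.symm ∘ (φ' ∘ φ.symm) := by
    filter_upwards [(φ.symm ≫ₕ φ').open_source.mem_nhds (transition_mem_source hx hx')] with z hz
    rw [OpenPartialHomeomorph.trans_source] at hz
    exact (φ'.left_inv hz.2).symm
  have h2 : (φ' ∘ φ.symm) (φ x) = φ' x := by rw [Function.comp_apply, φ.left_inv hx]
  have h3 : MDifferentiableAt (𝓡 d) (𝓡 d) (φ' ∘ φ.symm) (φ x) :=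
    ((contDiffAt_transition hφ hφ' hx hx').differentiableAt (by simp)).mdifferentiableAt
  have h4 : MDifferentiableAt (𝓡 d) (𝓡 d) φ'.symm ((φ' ∘ φ.symm) (φ x)) := by
    rw [h2]
    exact mdifferentiableAt_symm hφ' (φ'.map_source hx')
  have h5 : symmDeriv φ (φ x) =
      (symmDeriv φ' ((φ' ∘ φ.symm) (φ x))).comp (fderiv ℝ (φ' ∘ φ.symm) (φ x)) := by
    rw [← mfderiv_eq_fderiv]
    exact (h1.mfderiv_eq).trans (mfderiv_comp (φ x) h4 h3)
  rw [h5, h2]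

variable [IsManifold (𝓡 d) ∞ M]

/-- The metric at a point, as a bilinear form on the model space. -/
noncomputable def metricForm (g : RiemMetric d M) (x : M) :
    EuclideanSpace ℝ (Fin d) →L[ℝ] EuclideanSpace ℝ (Fin d) →L[ℝ] ℝ :=
  g.inner x

theorem metricMatrix_eq_gramMatrix (g : RiemMetric d M)
    (φ : OpenPartialHomeomorph M (EuclideanSpace ℝ (Fin d))) (y : EuclideanSpace ℝ (Fin d)) :
    metricMatrix g φ y = gramMatrix (metricForm g (φ.symm y)) (symmDeriv φ y) := rfl

theorem det_metricMatrix_pos (g : RiemMetric d M)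
    {φ : OpenPartialHomeomorph M (EuclideanSpace ℝ (Fin d))}
    (hφ : φ ∈ IsManifold.maximalAtlas (𝓡 d) ∞ M) {y : EuclideanSpace ℝ (Fin d)}
    (hy : y ∈ φ.target) : 0 < (metricMatrix g φ y).det := by
  rw [metricMatrix_eq_gramMatrix]
  exact det_gramMatrix_pos (g.symm _) (g.pos _) (injective_mfderiv_symm hφ hy)

theorem det_metricMatrix_eq (g : RiemMetric d M)
    {φ φ' : OpenPartialHomeomorph M (EuclideanSpace ℝ (Fin d))}
    (hφ : φ ∈ IsManifold.maximalAtlas (𝓡 d) ∞ M) (hφ' : φ' ∈ IsManifold.maximalAtlas (𝓡 d) ∞ M)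
    {x : M} (hx : x ∈ φ.source) (hx' : x ∈ φ'.source) :
    (metricMatrix g φ (φ x)).det =
      (fderiv ℝ (φ' ∘ φ.symm) (φ x)).det ^ 2 * (metricMatrix g φ' (φ' x)).det := by
  rw [metricMatrix_eq_gramMatrix, metricMatrix_eq_gramMatrix, φ.left_inv hx, φ'.left_inv hx',
    symmDeriv_eq_comp hφ hφ' hx hx', det_gramMatrix_comp]

/-- The coordinate fields are images of constant fields under the tangent map of the inverse chart,
hence smooth, and pairing them with the smooth section g stays smooth. -/
theorem contDiffOn_metricMatrix (g : RiemMetric d M)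
    {φ : OpenPartialHomeomorph M (EuclideanSpace ℝ (Fin d))}
    (hφ : φ ∈ IsManifold.maximalAtlas (𝓡 d) ∞ M) (i j : Fin d) :
    ContDiffOn ℝ ∞ (fun y => metricMatrix g φ y i j) φ.target := by
  have : IsManifold (𝓡 d) 1 M := IsManifold.of_le (n := ∞) (by simp)
  have h1 : ∀ i : Fin d, ContMDiffOn (𝓡 d) (𝓡 d).tangent ∞
      (fun y => (⟨φ.symm y, coordVector φ y i⟩ : TangentBundle (𝓡 d) M)) φ.target := by
    intro i
    have h2 := (contMDiffOn_symm_of_mem_maximalAtlas hφ).contMDiffOn_tangentMapWithin (m := ∞)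
      le_rfl φ.open_target.uniqueMDiffOn
    have h3 : ContMDiff (𝓡 d) (𝓡 d).tangent ∞ (fun y : EuclideanSpace ℝ (Fin d) =>
        (⟨y, EuclideanSpace.single i (1 : ℝ)⟩ : TangentBundle (𝓡 d) (EuclideanSpace ℝ (Fin d)))) :=
      contMDiff_vectorSpace_iff_contDiff.2 contDiff_const
    refine (h2.comp h3.contMDiffOn fun y hy => hy).congr fun y hy => ?_
    simp only [Function.comp_apply, tangentMapWithin, coordVector,
      mfderivWithin_of_isOpen φ.open_target hy]
  have h4 : ContMDiffOn (𝓡 d) ((𝓡 d).prod 𝓘(ℝ, ℝ)) ∞ (fun y => Bundle.TotalSpace.mk' ℝ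
      (E := Bundle.Trivial M ℝ) (φ.symm y) (metricMatrix g φ y i j)) φ.target := by
    refine ContMDiffOn.clm_bundle_apply₂ (F₁ := EuclideanSpace ℝ (Fin d))
      (F₂ := EuclideanSpace ℝ (Fin d)) (E₁ := fun x : M => TangentSpace (𝓡 d) x)
      (E₂ := fun x : M => TangentSpace (𝓡 d) x) (E₃ := Bundle.Trivial M ℝ)
      (ψ := fun y => g.inner (φ.symm y)) ?_ (h1 i) (h1 j)
    exact g.contMDiff.comp_contMDiffOn (contMDiffOn_symm_of_mem_maximalAtlas hφ)
  rw [← contMDiffOn_iff_contDiffOn]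
  intro y hy
  have h5 := h4 y hy
  simp only [Bundle.contMDiffWithinAt_totalSpace] at h5
  exact h5.2

theorem contDiffOn_sqrt_det_metricMatrix (g : RiemMetric d M)
    {φ : OpenPartialHomeomorph M (EuclideanSpace ℝ (Fin d))}
    (hφ : φ ∈ IsManifold.maximalAtlas (𝓡 d) ∞ M) :
    ContDiffOn ℝ ∞ (fun y => √(metricMatrix g φ y).det) φ.target := by
  refine ContDiffOn.sqrt ?_ fun y hy => (det_metricMatrix_pos g hφ hy).ne'
  simp only [Matrix.det_apply]
  exact ContDiffOn.sum fun σ _ => (contDiffOn_prod fun i _ => contDiffOn_metricMatrix g hφ _ _).const_smul _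

end Charts

/-! ### The Riemannian volume in charts -/

/-- By second countability, countably many of the neighbourhoods cover X. -/
theorem MeasureTheory.Measure.ext_of_locally_eq {X : Type*} [TopologicalSpace X]
    [SecondCountableTopology X] [MeasurableSpace X] {μ ν : Measure X}
    (h : ∀ x, ∃ U ∈ 𝓝 x, MeasurableSet U ∧ ∀ s ⊆ U, MeasurableSet s → μ s = ν s) : μ = ν := by
  choose U hU hUm hUs using h
  obtain ⟨t, ht, htU⟩ := TopologicalSpace.countable_cover_nhds hU
  have : Countable t := ht.to_subtype
  refine Measure.ext_of_iUnion_eq_univ (s := fun x : t => U x) ?_ fun x => ?_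
  · rwa [iUnion_coe_set]
  · ext s hs
    rw [Measure.restrict_apply hs, Measure.restrict_apply hs]
    exact hUs x _ inter_subset_right (hs.inter (hUm x))

theorem OpenPartialHomeomorph.measurableSet_image {X Y : Type*} [TopologicalSpace X]
    [MeasurableSpace X] [BorelSpace X] [TopologicalSpace Y] [MeasurableSpace Y] [BorelSpace Y]
    (φ : OpenPartialHomeomorph X Y) {s : Set X} (hs : MeasurableSet s) (hsφ : s ⊆ φ.source) :
    MeasurableSet (φ '' s) := by
  classical
  rcases s.eq_empty_or_nonempty with rfl | ⟨x, -⟩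
  · simp
  rw [φ.image_eq_target_inter_inv_preimage hsφ]
  have h1 : Measurable (φ.target.piecewise φ.symm fun _ => x) :=
    φ.continuousOn_symm.measurable_piecewise continuousOn_const φ.open_target.measurableSet
  have h2 : φ.target ∩ φ.symm ⁻¹' s =
      φ.target ∩ (φ.target.piecewise φ.symm fun _ => x) ⁻¹' s := by
    ext y
    simp only [mem_inter_iff, mem_preimage]
    refine and_congr_right fun hy => ?_
    rw [piecewise_eq_of_mem _ _ _ hy]
  rw [h2]
  exact φ.open_target.measurableSet.inter (h1 hs)

section Volume

variable {d : ℕ} {M : Type*} [TopologicalSpace M] [ChartedSpace (EuclideanSpace ℝ (Fin d)) M]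
  [IsManifold (𝓡 d) ∞ M] [MeasurableSpace M] [BorelSpace M]

theorem chartVolume_apply (g : RiemMetric d M)
    (φ : OpenPartialHomeomorph M (EuclideanSpace ℝ (Fin d))) {s : Set M} (hs : MeasurableSet s)
    (hsφ : s ⊆ φ.source) :
    chartVolume g φ s = ∫⁻ y in φ '' s, ENNReal.ofReal √(metricMatrix g φ y).det := by
  have h1 : AEMeasurable φ.symm ((volume.restrict φ.target).withDensity
      (fun y => ENNReal.ofReal (Real.sqrt (metricMatrix g φ y).det))) :=
    (φ.continuousOn_symm.aemeasurable φ.open_target.measurableSet).mono_ac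
      (withDensity_absolutelyContinuous _ _)
  rw [chartVolume, Measure.map_apply_of_aemeasurable h1 hs, withDensity_apply',
    Measure.restrict_restrict' φ.open_target.measurableSet, inter_comm,
    φ.image_eq_target_inter_inv_preimage hsφ]

/-- Under the square root the squared Jacobian of `det_metricMatrix_eq` becomes |det|, the factor in
the change of variables formula. -/
theorem chartVolume_congr (g : RiemMetric d M)
    {φ φ' : OpenPartialHomeomorph M (EuclideanSpace ℝ (Fin d))}
    (hφ : φ ∈ IsManifold.maximalAtlas (𝓡 d) ∞ M) (hφ' : φ' ∈ IsManifold.maximalAtlas (𝓡 d) ∞ M)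
    {s : Set M} (hs : MeasurableSet s) (hsφ : s ⊆ φ.source) (hsφ' : s ⊆ φ'.source) :
    chartVolume g φ s = chartVolume g φ' s := by
  rw [chartVolume_apply g φ hs hsφ, chartVolume_apply g φ' hs hsφ']
  have e : φ' '' s = (φ' ∘ φ.symm) '' (φ '' s) := by
    rw [image_image]
    refine image_congr fun x hx => ?_
    rw [Function.comp_apply, φ.left_inv (hsφ hx)]
  rw [e, lintegral_image_eq_lintegral_abs_det_fderiv_mul volume (φ.measurableSet_image hs hsφ)
    (f' := fun y => fderiv ℝ (φ' ∘ φ.symm) y)]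
  · refine setLIntegral_congr_fun (φ.measurableSet_image hs hsφ) ?_
    rintro _ ⟨x, hx, rfl⟩
    simp only
    rw [det_metricMatrix_eq g hφ hφ' (hsφ hx) (hsφ' hx), Real.sqrt_mul (sq_nonneg _),
      Real.sqrt_sq_eq_abs, ENNReal.ofReal_mul (abs_nonneg _), Function.comp_apply,
      φ.left_inv (hsφ hx)]
  · rintro _ ⟨x, hx, rfl⟩
    exact ((contDiffAt_transition hφ hφ' (hsφ hx) (hsφ' hx)).differentiableAt
      (by simp)).hasFDerivAt.hasFDerivWithinAt
  · rintro _ ⟨x, hx, rfl⟩ _ ⟨z, hz, rfl⟩ h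
    simp only [Function.comp_apply, φ.left_inv (hsφ hx), φ.left_inv (hsφ hz)] at h
    rw [φ'.injOn (hsφ' hx) (hsφ' hz) h]

/-- Each piece of the disjointed cover can be measured in φ instead of its own chart, so the choices
in the definition of the volume drop out. -/
theorem riemannianVolume_apply [SecondCountableTopology M] [Nonempty M] (g : RiemMetric d M)
    {φ : OpenPartialHomeomorph M (EuclideanSpace ℝ (Fin d))}
    (hφ : φ ∈ IsManifold.maximalAtlas (𝓡 d) ∞ M) {s : Set M} (hs : MeasurableSet s)
    (hsφ : s ⊆ φ.source) : riemannianVolume g s = chartVolume g φ s := by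
  let c : ℕ → OpenPartialHomeomorph M (EuclideanSpace ℝ (Fin d)) := fun n =>
    chartAt (EuclideanSpace ℝ (Fin d)) ((exists_countable_chart_cover d M).choose n)
  let D : ℕ → Set M := disjointed fun k => (c k).source
  have hD : ∀ n, MeasurableSet (D n) := fun n =>
    MeasurableSet.disjointed (fun k => (c k).open_source.measurableSet) n
  have hDU : ⋃ n, D n = univ := by
    rw [iUnion_disjointed]
    exact (exists_countable_chart_cover d M).choose_spec
  have hDs : ∀ n, D n ⊆ (c n).source := fun n => disjointed_subset (fun k => (c k).source) n
  have e : riemannianVolume g = Measure.sum fun n => (chartVolume g (c n)).restrict (D n) := rfl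
  have hdisj : Pairwise (Function.onFun Disjoint fun n => s ∩ D n) := fun i j hij =>
    (disjoint_disjointed (fun k => (c k).source) hij).mono inter_subset_right inter_subset_right
  rw [e, Measure.sum_apply _ hs]
  conv_rhs => rw [← inter_univ s, ← hDU, inter_iUnion,
    measure_iUnion hdisj (fun n => hs.inter (hD n))]
  refine tsum_congr fun n => ?_
  rw [Measure.restrict_apply hs]
  exact chartVolume_congr g (IsManifold.chart_mem_maximalAtlas _) hφ (hs.inter (hD n))
    (inter_subset_right.trans (hDs n)) (inter_subset_left.trans hsφ)

end Volume

/-! ### Charts in which the volume is the Lebesgue measure -/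

section VolumeCharts

theorem det_transition_self {d : ℕ} {M : Type*} [TopologicalSpace M]
    {φ : OpenPartialHomeomorph M (EuclideanSpace ℝ (Fin d))} {x : M} (hx : x ∈ φ.source) : (fderiv ℝ (φ ∘ φ.symm) (φ x)).det = 1 := by
  have e : φ ∘ φ.symm =ᶠ[𝓝 (φ x)] id := by
    filter_upwards [φ.open_target.mem_nhds (φ.map_source hx)] with z hz
    exact φ.right_inv hz
  rw [e.fderiv_eq, fderiv_id]
  exact LinearMap.det_id

variable {d : ℕ} {M : Type*} [TopologicalSpace M] [ChartedSpace (EuclideanSpace ℝ (Fin d)) M]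

theorem contDiffAt_comp_symm {ψ : M → M} (hψ : ContMDiff (𝓡 d) (𝓡 d) ∞ ψ)
    {φ φ' : OpenPartialHomeomorph M (EuclideanSpace ℝ (Fin d))}
    (hφ : φ ∈ IsManifold.maximalAtlas (𝓡 d) ∞ M) (hφ' : φ' ∈ IsManifold.maximalAtlas (𝓡 d) ∞ M)
    {x : M} (hx : x ∈ φ.source) (hx' : ψ x ∈ φ'.source) :
    ContDiffAt ℝ ∞ (φ' ∘ ψ ∘ φ.symm) (φ x) := by
  rw [← contMDiffAt_iff_contDiffAt]
  have h1 : ContMDiffAt (𝓡 d) (𝓡 d) ∞ (ψ ∘ φ.symm) (φ x) :=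
    hψ.contMDiffAt.comp _ (contMDiffAt_symm_of_mem_maximalAtlas hφ (φ.map_source hx))
  refine ContMDiffAt.comp _ (contMDiffAt_of_mem_maximalAtlas hφ' ?_) h1
  rw [Function.comp_apply, φ.left_inv hx]
  exact hx'

/-- The chain rule through both changes of chart; it carries the sign or the value of the Jacobian
of ψ from one pair of charts to another. -/
theorem det_fderiv_comp_symm {ψ : M → M} (hψ : ContMDiff (𝓡 d) (𝓡 d) ∞ ψ)
    {φ φ' κ κ' : OpenPartialHomeomorph M (EuclideanSpace ℝ (Fin d))}
    (hφ : φ ∈ IsManifold.maximalAtlas (𝓡 d) ∞ M) (hφ' : φ' ∈ IsManifold.maximalAtlas (𝓡 d) ∞ M)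
    (hκ : κ ∈ IsManifold.maximalAtlas (𝓡 d) ∞ M) (hκ' : κ' ∈ IsManifold.maximalAtlas (𝓡 d) ∞ M)
    {x : M} (hx : x ∈ φ.source) (hx' : ψ x ∈ φ'.source) (hxκ : x ∈ κ.source)
    (hxκ' : ψ x ∈ κ'.source) :
    (fderiv ℝ (κ' ∘ ψ ∘ κ.symm) (κ x)).det = (fderiv ℝ (κ' ∘ φ'.symm) (φ' (ψ x))).det *
      (fderiv ℝ (φ' ∘ ψ ∘ φ.symm) (φ x)).det * (fderiv ℝ (φ ∘ κ.symm) (κ x)).det := by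
  have e : κ' ∘ ψ ∘ κ.symm =ᶠ[𝓝 (κ x)]
      (κ' ∘ φ'.symm) ∘ (φ' ∘ ψ ∘ φ.symm) ∘ (φ ∘ κ.symm) := by
    have hc : ContinuousAt κ.symm (κ x) := κ.continuousAt_symm (κ.map_source hxκ)
    have hm : κ.symm (κ x) = x := κ.left_inv hxκ
    have h1 : ∀ᶠ z in 𝓝 (κ x), κ.symm z ∈ φ.source :=
      hc.eventually_mem (by rw [hm]; exact φ.open_source.mem_nhds hx)
    have h2 : ∀ᶠ z in 𝓝 (κ x), ψ (κ.symm z) ∈ φ'.source :=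
      (hψ.continuous.continuousAt.comp hc).eventually_mem
        (by rw [Function.comp_apply, hm]; exact φ'.open_source.mem_nhds hx')
    filter_upwards [h1, h2] with z hz hz'
    simp only [Function.comp_apply, φ.left_inv hz, φ'.left_inv hz']
  have e1 : (φ ∘ κ.symm) (κ x) = φ x := by rw [Function.comp_apply, κ.left_inv hxκ]
  have e2 : (φ' ∘ ψ ∘ φ.symm) (φ x) = φ' (ψ x) := by
    rw [Function.comp_apply, Function.comp_apply, φ.left_inv hx]
  have d1 : DifferentiableAt ℝ (φ ∘ κ.symm) (κ x) :=
    (contDiffAt_transition hκ hφ hxκ hx).differentiableAt (by simp)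
  have d2 : DifferentiableAt ℝ (φ' ∘ ψ ∘ φ.symm) ((φ ∘ κ.symm) (κ x)) := by
    rw [e1]
    exact (contDiffAt_comp_symm hψ hφ hφ' hx hx').differentiableAt (by simp)
  have d3 : DifferentiableAt ℝ (κ' ∘ φ'.symm) ((φ' ∘ ψ ∘ φ.symm) ((φ ∘ κ.symm) (κ x))) := by
    rw [e1, e2]
    exact (contDiffAt_transition hφ' hκ' hx' hxκ').differentiableAt (by simp)
  have e3 := fderiv_comp (κ x) (g := κ' ∘ φ'.symm)
    (f := (φ' ∘ ψ ∘ φ.symm) ∘ (φ ∘ κ.symm)) d3 (d2.comp _ d1)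
  have e4 := fderiv_comp (κ x) (g := φ' ∘ ψ ∘ φ.symm) (f := φ ∘ κ.symm) d2 d1
  rw [e.fderiv_eq, e3, e4, ContinuousLinearMap.det_comp_eq, ContinuousLinearMap.det_comp_eq, Function.comp_apply,
    e1, e2, mul_assoc]

theorem det_transition_trans {φ κ κ' : OpenPartialHomeomorph M (EuclideanSpace ℝ (Fin d))}
    (hφ : φ ∈ IsManifold.maximalAtlas (𝓡 d) ∞ M) (hκ : κ ∈ IsManifold.maximalAtlas (𝓡 d) ∞ M)
    (hκ' : κ' ∈ IsManifold.maximalAtlas (𝓡 d) ∞ M) {x : M} (hx : x ∈ φ.source)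
    (hxκ : x ∈ κ.source) (hxκ' : x ∈ κ'.source) :
    (fderiv ℝ (κ' ∘ κ.symm) (κ x)).det =
      (fderiv ℝ (κ' ∘ φ.symm) (φ x)).det * (fderiv ℝ (φ ∘ κ.symm) (κ x)).det := by
  have d1 : DifferentiableAt ℝ (φ ∘ κ.symm) (κ x) :=
    (contDiffAt_transition hκ hφ hxκ hx).differentiableAt (by simp)
  have e1 : (φ ∘ κ.symm) (κ x) = φ x := by rw [Function.comp_apply, κ.left_inv hxκ]
  have d2 : DifferentiableAt ℝ (κ' ∘ φ.symm) ((φ ∘ κ.symm) (κ x)) := by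
    rw [e1]
    exact (contDiffAt_transition hφ hκ' hx hxκ').differentiableAt (by simp)
  have e : κ' ∘ κ.symm =ᶠ[𝓝 (κ x)] (κ' ∘ φ.symm) ∘ (φ ∘ κ.symm) := by
    have h1 : ∀ᶠ z in 𝓝 (κ x), κ.symm z ∈ φ.source :=
      (κ.continuousAt_symm (κ.map_source hxκ)).eventually_mem
        (by rw [κ.left_inv hxκ]; exact φ.open_source.mem_nhds hx)
    filter_upwards [h1] with z hz
    simp only [Function.comp_apply, φ.left_inv hz]
  rw [e.fderiv_eq, fderiv_comp _ d2 d1, ContinuousLinearMap.det_comp_eq, e1]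

variable [IsManifold (𝓡 d) ∞ M]

/-- Charts of the smooth structure that are positively oriented and in which the Riemannian volume
is the Lebesgue measure. -/
structure IsVolumeChart (A : Set (OpenPartialHomeomorph M (EuclideanSpace ℝ (Fin d))))
    (g : RiemMetric d M) (σ : OpenPartialHomeomorph M (EuclideanSpace ℝ (Fin d))) : Prop where
  mem_maximalAtlas : σ ∈ IsManifold.maximalAtlas (𝓡 d) ∞ M
  det_eq : ∀ φ ∈ A, ∀ x ∈ φ.source, x ∈ σ.source →
    (fderiv ℝ (σ ∘ φ.symm) (φ x)).det = √(metricMatrix g φ (φ x)).det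

variable {A : Set (OpenPartialHomeomorph M (EuclideanSpace ℝ (Fin d)))} {g : RiemMetric d M}
  {σ σ' : OpenPartialHomeomorph M (EuclideanSpace ℝ (Fin d))}

theorem IsVolumeChart.det_pos (hA : IsOrientedAtlas A) (hσ : IsVolumeChart A g σ)
    {φ : OpenPartialHomeomorph M (EuclideanSpace ℝ (Fin d))} (hφ : φ ∈ A) {x : M}
    (hx : x ∈ φ.source) (hxσ : x ∈ σ.source) : 0 < (fderiv ℝ (σ ∘ φ.symm) (φ x)).det := by
  rw [hσ.det_eq φ hφ x hx hxσ]
  exact Real.sqrt_pos.2 (det_metricMatrix_pos g (hA.subset_maximalAtlas hφ) (φ.map_source hx))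

theorem IsVolumeChart.det_symm_pos (hA : IsOrientedAtlas A) (hσ : IsVolumeChart A g σ)
    {φ : OpenPartialHomeomorph M (EuclideanSpace ℝ (Fin d))} (hφ : φ ∈ A) {x : M}
    (hx : x ∈ φ.source) (hxσ : x ∈ σ.source) : 0 < (fderiv ℝ (φ ∘ σ.symm) (σ x)).det := by
  have h1 := det_transition_trans hσ.mem_maximalAtlas (hA.subset_maximalAtlas hφ)
    (hA.subset_maximalAtlas hφ) hxσ hx hx
  rw [det_transition_self hx] at h1
  have h2 := hσ.det_pos hA hφ hx hxσ
  by_contra h3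
  nlinarith

/-- Against a chart of the oriented atlas both volume charts have the same positive Jacobian, so
their quotient is one. -/
theorem IsVolumeChart.det_transition (hA : IsOrientedAtlas A) (hσ : IsVolumeChart A g σ)
    (hσ' : IsVolumeChart A g σ') {x : M} (hx : x ∈ σ.source) (hx' : x ∈ σ'.source) :
    (fderiv ℝ (σ' ∘ σ.symm) (σ x)).det = 1 := by
  obtain ⟨φ, hφ, hxφ⟩ := hA.covers x
  have h1 := det_transition_trans hσ.mem_maximalAtlas (hA.subset_maximalAtlas hφ)
    hσ'.mem_maximalAtlas hx hxφ hx'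
  rw [hσ'.det_eq φ hφ x hxφ hx', ← hσ.det_eq φ hφ x hxφ hx] at h1
  have h2 := hσ.det_pos hA hφ hxφ hx
  exact (mul_eq_right₀ h2.ne').1 h1.symm

theorem IsVolumeChart.det_metricMatrix (hA : IsOrientedAtlas A) (hσ : IsVolumeChart A g σ)
    {y : EuclideanSpace ℝ (Fin d)} (hy : y ∈ σ.target) : (metricMatrix g σ y).det = 1 := by
  obtain ⟨φ, hφ, hx⟩ := hA.covers (σ.symm y)
  have hxσ := σ.map_target hy
  have h0 := det_metricMatrix_pos g (hA.subset_maximalAtlas hφ) (φ.map_source hx)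
  have h1 := det_metricMatrix_eq g (hA.subset_maximalAtlas hφ) hσ.mem_maximalAtlas hx hxσ
  rw [hσ.det_eq φ hφ _ hx hxσ, Real.sq_sqrt h0.le, σ.right_inv hy] at h1
  exact (mul_eq_left₀ h0.ne').1 h1.symm

/-- A chart φ of the oriented atlas is followed by a local diffeomorphism whose Jacobian is the
volume density √det g of φ. Compatibility with the other oriented charts is the transformation rule
of that density, positivity of transitions removing the absolute value. -/
theorem exists_isVolumeChart (hA : IsOrientedAtlas A) (g : RiemMetric d M) (x : M) :
    ∃ σ, IsVolumeChart A g σ ∧ x ∈ σ.source := by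
  obtain ⟨φ, hφ, hx⟩ := hA.covers x
  have hφm := hA.subset_maximalAtlas hφ
  obtain ⟨S, hxS, hSU, hS, hS', hdet⟩ := exists_openPartialHomeomorph_det_fderiv_eq
    (r := fun y => √(metricMatrix g φ y).det) φ.open_target
    (φ.map_source hx) (contDiffOn_sqrt_det_metricMatrix g hφm)
    (fun y hy => Real.sqrt_pos.2 (det_metricMatrix_pos g hφm hy)) (by
      rintro rfl
      simp)
  refine ⟨φ ≫ₕ S, ⟨?_, ?_⟩, ?_⟩
  · refine OpenPartialHomeomorph.mem_maximalAtlas_of_contMDiffOn _ ?_ ?_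
    · rw [OpenPartialHomeomorph.coe_trans, OpenPartialHomeomorph.trans_source]
      exact (contMDiffOn_iff_contDiffOn.2 hS).comp ((contMDiffOn_of_mem_maximalAtlas hφm).mono
        inter_subset_left) inter_subset_right
    · rw [OpenPartialHomeomorph.trans_symm_eq_symm_trans_symm, OpenPartialHomeomorph.coe_trans]
      have h1 : (φ ≫ₕ S).target ⊆ S.target := by
        rw [OpenPartialHomeomorph.trans_target]
        exact inter_subset_left
      exact (contMDiffOn_symm_of_mem_maximalAtlas hφm).comp
        ((contMDiffOn_iff_contDiffOn.2 hS').mono h1)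
        fun y hy => hSU (S.map_target (h1 hy))
  · intro φ' hφ' z hz hzσ
    rw [OpenPartialHomeomorph.trans_source] at hzσ
    have hzφ := hzσ.1
    have d1 : DifferentiableAt ℝ (φ ∘ φ'.symm) (φ' z) :=
      (contDiffAt_transition (hA.subset_maximalAtlas hφ') hφm hz hzφ).differentiableAt (by simp)
    have e1 : (φ ∘ φ'.symm) (φ' z) = φ z := by rw [Function.comp_apply, φ'.left_inv hz]
    have d2 : DifferentiableAt ℝ S ((φ ∘ φ'.symm) (φ' z)) := by
      rw [e1]
      exact (hS.contDiffAt (S.open_source.mem_nhds hzσ.2)).differentiableAt (by simp)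
    have e2 : (φ ≫ₕ S) ∘ φ'.symm = S ∘ (φ ∘ φ'.symm) := rfl
    rw [e2, fderiv_comp _ d2 d1, ContinuousLinearMap.det_comp_eq, e1, hdet _ hzσ.2,
      det_metricMatrix_eq g (hA.subset_maximalAtlas hφ') hφm hz hzφ, Real.sqrt_mul (sq_nonneg _),
      Real.sqrt_sq (hA.det_pos φ' hφ' φ hφ z ⟨hz, hzφ⟩).le, mul_comm]
  · rw [OpenPartialHomeomorph.trans_source]
    exact ⟨hx, hxS⟩

variable [MeasurableSpace M] [BorelSpace M] [SecondCountableTopology M] [Nonempty M]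

theorem IsVolumeChart.riemannianVolume_apply (hA : IsOrientedAtlas A) (hσ : IsVolumeChart A g σ)
    {s : Set M} (hs : MeasurableSet s) (hsσ : s ⊆ σ.source) :
    riemannianVolume g s = volume (σ '' s) := by
  rw [_root_.riemannianVolume_apply g hσ.mem_maximalAtlas hs hsσ, chartVolume_apply g σ hs hsσ,
    ← setLIntegral_one]
  refine setLIntegral_congr_fun (σ.measurableSet_image hs hsσ) ?_
  rintro _ ⟨x, hx, rfl⟩
  simp [hσ.det_metricMatrix hA (σ.map_source (hsσ hx))]

theorem riemannianVolume_pos_of_isOpen (hA : IsOrientedAtlas A) (g : RiemMetric d M) {U : Set M}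
    (hU : IsOpen U) (hne : U.Nonempty) : 0 < riemannianVolume g U := by
  obtain ⟨x, hx⟩ := hne
  obtain ⟨σ, hσ, hxσ⟩ := exists_isVolumeChart hA g x
  have h1 : IsOpen (U ∩ σ.source) := hU.inter σ.open_source
  refine lt_of_lt_of_le ?_ (measure_mono (inter_subset_left : U ∩ σ.source ⊆ U))
  rw [hσ.riemannianVolume_apply hA h1.measurableSet inter_subset_right]
  exact (σ.isOpen_image_of_subset_source h1 inter_subset_right).measure_pos _
    ⟨σ x, mem_image_of_mem σ ⟨hx, hxσ⟩⟩

/-- A diffeomorphism that has Jacobian determinant one in suitable volume charts preserves the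
orientation and the volume. -/
theorem mem_volumeDiffeos_of_det_eq_one (hA : IsOrientedAtlas A)
    (ψ : Diffeomorph (𝓡 d) (𝓡 d) M M ∞) (hψ : ∃ K : Set M, IsCompact K ∧ ∀ x ∉ K, ψ x = x)
    (h : ∀ x, ∃ σ σ', IsVolumeChart A g σ ∧ IsVolumeChart A g σ' ∧ x ∈ σ.source ∧
      ψ x ∈ σ'.source ∧ (fderiv ℝ (σ' ∘ ψ ∘ σ.symm) (σ x)).det = 1) :
    ψ ∈ volumeDiffeos A g := by
  refine ⟨hψ, ?_, ?_⟩
  · intro φ hφ φ' hφ' x hx hx'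
    obtain ⟨σ, σ', hσ, hσ', hxσ, hxσ', hdet⟩ := h x
    rw [det_fderiv_comp_symm ψ.contMDiff hσ.mem_maximalAtlas hσ'.mem_maximalAtlas
      (hA.subset_maximalAtlas hφ) (hA.subset_maximalAtlas hφ') hxσ hxσ' hx hx', hdet, mul_one]
    exact mul_pos (hσ'.det_symm_pos hA hφ' hx' hxσ') (hσ.det_pos hA hφ hx hxσ)
  · have hψm : Measurable ψ := ψ.continuous.measurable
    refine Measure.ext_of_locally_eq fun z => ?_
    obtain ⟨σ, σ', hσ, hσ', hxσ, hxσ', -⟩ := h (ψ.symm z)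
    have hz : z ∈ ψ.symm ⁻¹' σ.source ∩ σ'.source := ⟨hxσ, by simpa using hxσ'⟩
    have hU : IsOpen (ψ.symm ⁻¹' σ.source ∩ σ'.source) :=
      (σ.open_source.preimage ψ.symm.continuous).inter σ'.open_source
    refine ⟨_, hU.mem_nhds hz, hU.measurableSet, fun s hsU hs => ?_⟩
    have hsσ : ψ ⁻¹' s ⊆ σ.source := fun x hx => by simpa using (hsU hx).1
    have hsσ' : s ⊆ σ'.source := fun x hx => (hsU hx).2
    rw [Measure.map_apply hψm hs, hσ.riemannianVolume_apply hA (hψm hs) hsσ,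
      hσ'.riemannianVolume_apply hA hs hsσ']
    have e : σ' '' s = (σ' ∘ ψ ∘ σ.symm) '' (σ '' (ψ ⁻¹' s)) := by
      rw [image_image]
      ext y
      constructor
      · rintro ⟨x, hx, rfl⟩
        have h1 : ψ.symm x ∈ ψ ⁻¹' s := by simpa using hx
        refine ⟨ψ.symm x, h1, ?_⟩
        simp [σ.left_inv (hsσ h1)]
      · rintro ⟨x, hx, rfl⟩
        refine ⟨ψ x, hx, ?_⟩
        simp [σ.left_inv (hsσ hx)]
    have hm := σ.measurableSet_image (hψm hs) hsσ
    rw [e, ← setLIntegral_one ((σ' ∘ ψ ∘ σ.symm) '' (σ '' (ψ ⁻¹' s))),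
      lintegral_image_eq_lintegral_abs_det_fderiv_mul volume hm
      (f' := fun y => fderiv ℝ (σ' ∘ ψ ∘ σ.symm) y), ← setLIntegral_one]
    · refine setLIntegral_congr_fun hm ?_
      rintro _ ⟨x, hx, rfl⟩
      obtain ⟨τ, τ', hτ, hτ', hxτ, hxτ', hdet⟩ := h x
      have h1 : (fderiv ℝ (σ' ∘ ψ ∘ σ.symm) (σ x)).det = 1 := by
        rw [det_fderiv_comp_symm ψ.contMDiff hτ.mem_maximalAtlas hτ'.mem_maximalAtlas
          hσ.mem_maximalAtlas hσ'.mem_maximalAtlas hxτ hxτ' (hsσ hx) (hsσ' hx), hdet,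
          hτ'.det_transition hA hσ' hxτ' (hsσ' hx), hσ.det_transition hA hτ (hsσ hx) hxτ]
        norm_num
      simp [h1]
    · rintro _ ⟨x, hx, rfl⟩
      exact ((contDiffAt_comp_symm ψ.contMDiff hσ.mem_maximalAtlas hσ'.mem_maximalAtlas
        (hsσ hx) (hsσ' hx)).differentiableAt (by simp)).hasFDerivAt.hasFDerivWithinAt
    · rintro _ ⟨x, hx, rfl⟩ _ ⟨z, hz, rfl⟩ hxz
      simp only [Function.comp_apply, σ.left_inv (hsσ hx), σ.left_inv (hsσ hz)] at hxz
      rw [ψ.injective (σ'.injOn (hsσ' hx) (hsσ' hz) hxz)]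

end VolumeCharts

/-! ### Transplantation of compactly supported diffeomorphisms through a chart -/

section Transplant

variable {d : ℕ} {M : Type*} [TopologicalSpace M]

open scoped Classical in
/-- The map of `M` that is `T` in the chart `σ`, extended by the identity. -/
noncomputable def transplant (σ : OpenPartialHomeomorph M (EuclideanSpace ℝ (Fin d)))
    (T : EuclideanSpace ℝ (Fin d) → EuclideanSpace ℝ (Fin d)) (x : M) : M :=
  if x ∈ σ.source then σ.symm (T (σ x)) else x

variable {σ : OpenPartialHomeomorph M (EuclideanSpace ℝ (Fin d))}
  {T : EuclideanSpace ℝ (Fin d) ≃ EuclideanSpace ℝ (Fin d)} {K : Set (EuclideanSpace ℝ (Fin d))}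

theorem transplant_of_mem (T : EuclideanSpace ℝ (Fin d) → EuclideanSpace ℝ (Fin d)) {x : M}
    (hx : x ∈ σ.source) : transplant σ T x = σ.symm (T (σ x)) := if_pos hx

/-- If T y is outside K, then T fixes T y, and injectivity gives T y = y. -/
theorem Equiv.apply_mem_of_eq_self_off {E : Type*} {T : E ≃ E} {K V : Set E} (hKV : K ⊆ V)
    (hT : ∀ y ∉ K, T y = y) {y : E} (hy : y ∈ V) : T y ∈ V := by
  by_cases h : T y ∈ K
  · exact hKV h
  · have h1 := T.injective (hT _ h)
    rwa [h1]

theorem Equiv.symm_eq_self_off {E : Type*} {T : E ≃ E} {K : Set E}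
    (hT : ∀ y ∉ K, T y = y) : ∀ y ∉ K, T.symm y = y := fun y hy => by
  rw [T.symm_apply_eq, hT y hy]

theorem transplant_of_notMem (hT : ∀ y ∉ K, T y = y) {x : M} (hx : x ∉ σ.symm '' K) :
    transplant σ T x = x := by
  by_cases h : x ∈ σ.source
  · rw [transplant_of_mem _ h, hT, σ.left_inv h]
    exact fun hK => hx ⟨σ x, hK, σ.left_inv h⟩
  · exact if_neg h

theorem transplant_symm_transplant (hKσ : K ⊆ σ.target) (hT : ∀ y ∉ K, T y = y) (x : M) :
    transplant σ T.symm (transplant σ T x) = x := by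
  by_cases h : x ∈ σ.source
  · have h1 : T (σ x) ∈ σ.target := Equiv.apply_mem_of_eq_self_off hKσ hT (σ.map_source h)
    rw [transplant_of_mem T h, transplant_of_mem T.symm (σ.map_target h1), σ.right_inv h1,
      T.symm_apply_apply, σ.left_inv h]
  · simp [transplant, h]

theorem isClosed_image_symm [T2Space M] (hK : IsCompact K) (hKσ : K ⊆ σ.target) :
    IsClosed (σ.symm '' K) :=
  (hK.image_of_continuousOn (σ.continuousOn_symm.mono hKσ)).isClosed

variable [ChartedSpace (EuclideanSpace ℝ (Fin d)) M] [T2Space M]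

/-- The map is a composition of smooth maps on the chart domain and the identity off σ.symm '' K,
which is closed because M is Hausdorff; these two open sets cover M. -/
theorem contMDiff_transplant (hσ : σ ∈ IsManifold.maximalAtlas (𝓡 d) ∞ M) (hK : IsCompact K)
    (hKσ : K ⊆ σ.target) (hT : ∀ y ∉ K, T y = y) (hTs : ContDiff ℝ ∞ T) :
    ContMDiff (𝓡 d) (𝓡 d) ∞ (transplant σ T) := by
  intro x
  by_cases h : x ∈ σ.source
  · have h1 : ContMDiffAt (𝓡 d) (𝓡 d) ∞ (σ.symm ∘ T ∘ σ) x := by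
      refine ContMDiffAt.comp x (contMDiffAt_symm_of_mem_maximalAtlas hσ
        (Equiv.apply_mem_of_eq_self_off hKσ hT (σ.map_source h))) ?_
      exact (contMDiff_iff_contDiff.2 hTs).contMDiffAt.comp x (contMDiffAt_of_mem_maximalAtlas hσ h)
    refine h1.congr_of_eventuallyEq ?_
    filter_upwards [σ.open_source.mem_nhds h] with z hz
    exact transplant_of_mem T hz
  · have h2 : x ∈ (σ.symm '' K)ᶜ := by
      rintro ⟨y, hy, rfl⟩
      exact h (σ.map_target (hKσ hy))
    refine (contMDiffAt_id (I := 𝓡 d)).congr_of_eventuallyEq ?_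
    filter_upwards [(isClosed_image_symm hK hKσ).isOpen_compl.mem_nhds h2] with z hz
    exact transplant_of_notMem hT hz

/-- The diffeomorphism of `M` that is `T` in the chart `σ`, extended by the identity. -/
noncomputable def transplantDiffeo (hσ : σ ∈ IsManifold.maximalAtlas (𝓡 d) ∞ M) (hK : IsCompact K)
    (hKσ : K ⊆ σ.target) (hT : ∀ y ∉ K, T y = y) (hTs : ContDiff ℝ ∞ T)
    (hTs' : ContDiff ℝ ∞ T.symm) : Diffeomorph (𝓡 d) (𝓡 d) M M ∞ where
  toFun := transplant σ T
  invFun := transplant σ T.symm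
  left_inv := transplant_symm_transplant hKσ hT
  right_inv := transplant_symm_transplant (T := T.symm) hKσ (Equiv.symm_eq_self_off hT)
  contMDiff_toFun := contMDiff_transplant hσ hK hKσ hT hTs
  contMDiff_invFun := contMDiff_transplant hσ hK hKσ (Equiv.symm_eq_self_off hT) hTs'

variable [IsManifold (𝓡 d) ∞ M] [MeasurableSpace M] [BorelSpace M] [SecondCountableTopology M]
  [Nonempty M]

theorem exists_volumeDiffeos_eq_transplant
    {A : Set (OpenPartialHomeomorph M (EuclideanSpace ℝ (Fin d)))} {g : RiemMetric d M}
    (hA : IsOrientedAtlas A) (hσ : IsVolumeChart A g σ) (hK : IsCompact K) (hKσ : K ⊆ σ.target)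
    (hT : ∀ y ∉ K, T y = y) (hTs : ContDiff ℝ ∞ T) (hTs' : ContDiff ℝ ∞ T.symm)
    (hdet : ∀ y, (fderiv ℝ T y).det = 1) :
    ∃ ψ ∈ volumeDiffeos A g, ∀ x ∈ σ.source, ψ x = σ.symm (T (σ x)) := by
  let ψ := transplantDiffeo hσ.mem_maximalAtlas hK hKσ hT hTs hTs'
  have hψ : ∀ x, ψ x = transplant σ T x := fun _ => rfl
  refine ⟨ψ, mem_volumeDiffeos_of_det_eq_one hA ψ
    ⟨σ.symm '' K, hK.image_of_continuousOn (σ.continuousOn_symm.mono hKσ),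
      fun x hx => transplant_of_notMem hT hx⟩ fun x => ?_, fun x hx => transplant_of_mem T hx⟩
  by_cases h : x ∈ σ.source
  · have h1 : ∀ z ∈ σ.source, σ.symm (T (σ z)) ∈ σ.source ∧ σ (σ.symm (T (σ z))) = T (σ z) := by
      intro z hz
      have h2 := Equiv.apply_mem_of_eq_self_off hKσ hT (σ.map_source hz)
      exact ⟨σ.map_target h2, σ.right_inv h2⟩
    refine ⟨σ, σ, hσ, hσ, h, ?_, ?_⟩
    · rw [hψ, transplant_of_mem _ h]
      exact (h1 x h).1
    · have e : σ ∘ ψ ∘ σ.symm =ᶠ[𝓝 (σ x)] T := by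
        filter_upwards [σ.open_target.mem_nhds (σ.map_source h)] with y hy
        rw [Function.comp_apply, Function.comp_apply, hψ, transplant_of_mem _ (σ.map_target hy),
          (h1 _ (σ.map_target hy)).2, σ.right_inv hy]
      rw [e.fderiv_eq, hdet]
  · obtain ⟨τ, hτ, hxτ⟩ := exists_isVolumeChart hA g x
    have h2 : x ∈ (σ.symm '' K)ᶜ := by
      rintro ⟨y, hy, rfl⟩
      exact h (σ.map_target (hKσ hy))
    refine ⟨τ, τ, hτ, hτ, hxτ, ?_, ?_⟩
    · rw [hψ, transplant_of_notMem hT h2]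
      exact hxτ
    · have h3 : ∀ᶠ y in 𝓝 (τ x), τ.symm y ∈ (σ.symm '' K)ᶜ :=
        (τ.continuousAt_symm (τ.map_source hxτ)).eventually_mem (by
          rw [τ.left_inv hxτ]
          exact (isClosed_image_symm hK hKσ).isOpen_compl.mem_nhds h2)
      have e : τ ∘ ψ ∘ τ.symm =ᶠ[𝓝 (τ x)] id := by
        filter_upwards [h3, τ.open_target.mem_nhds (τ.map_source hxτ)] with y hy hy'
        rw [Function.comp_apply, Function.comp_apply, hψ, transplant_of_notMem hT hy,
          τ.right_inv hy', id]
      rw [e.fderiv_eq, fderiv_id]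
      exact LinearMap.det_id

/-- Near every point there is a volume chart in which small translations extend to
volume-preserving diffeomorphisms. -/
theorem exists_volumeDiffeos_eq_translation_of_two_le (hd : 2 ≤ d)
    {A : Set (OpenPartialHomeomorph M (EuclideanSpace ℝ (Fin d)))} {g : RiemMetric d M}
    (hA : IsOrientedAtlas A) (x : M) :
    ∃ σ, IsVolumeChart A g σ ∧ x ∈ σ.source ∧ ∃ ρ > 0, Metric.ball (σ x) (2 * ρ) ⊆ σ.target ∧
      ∀ v, ‖v‖ < ρ → ∃ ψ ∈ volumeDiffeos A g, ∀ y ∈ Metric.ball (σ x) ρ,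
        ψ (σ.symm y) = σ.symm (y + v) := by
  obtain ⟨σ, hσ, hx⟩ := exists_isVolumeChart hA g x
  obtain ⟨ε, hε, hεσ⟩ := Metric.isOpen_iff.1 σ.open_target _ (σ.map_source hx)
  -- The extended translation is supported in radius 4 (ε / 8) = ε / 2, inside the chart.
  refine ⟨σ, hσ, hx, ε / 8, by positivity,
    (Metric.ball_subset_ball (by linarith)).trans hεσ, fun v hv => ?_⟩
  obtain ⟨T, hTs, hTs', hdet, hTv, hT⟩ := exists_contDiff_eq_translation
    (by rwa [finrank_euclideanSpace_fin]) (σ x) v hv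
  obtain ⟨ψ, hψ, hψT⟩ := exists_volumeDiffeos_eq_transplant hA hσ
    (K := Metric.closedBall (σ x) (4 * (ε / 8))) (isCompact_closedBall _ _)
    ((Metric.closedBall_subset_ball (by linarith)).trans hεσ)
    (fun y hy => hT y fun h => hy (Metric.ball_subset_closedBall h)) hTs hTs' hdet
  refine ⟨ψ, hψ, fun y hy => ?_⟩
  have hy' : y ∈ σ.target := hεσ (Metric.ball_subset_ball (by linarith) hy)
  rw [hψT _ (σ.map_target hy'), σ.right_inv hy', hTv y hy]

end Transplant

/-! ### Translations of compact manifolds of dimension one -/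

/-- In dimension one a linear map is multiplication by its determinant. This makes transitions
between volume charts locally translations. -/
theorem ContinuousLinearMap.eq_id_of_finrank_eq_one {E : Type*} [NormedAddCommGroup E]
    [NormedSpace ℝ E] (hE : Module.finrank ℝ E = 1) {L : E →L[ℝ] E} (hL : L.det = 1) :
    L = ContinuousLinearMap.id ℝ E := by
  obtain ⟨v, hv, hspan⟩ := finrank_eq_one_iff'.1 hE
  obtain ⟨c, hc⟩ := hspan (L v)
  have h1 : L = c • ContinuousLinearMap.id ℝ E := by
    ext w
    obtain ⟨b, rfl⟩ := hspan w
    simp [← hc, smul_smul, mul_comm]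
  have h2 : L.det = c := by
    rw [h1]
    have : (c • ContinuousLinearMap.id ℝ E).det = c ^ Module.finrank ℝ E * 1 := by
      rw [← LinearMap.det_id (A := ℝ) (M := E), ← LinearMap.det_smul]
      rfl
    rw [this, hE, pow_one, mul_one]
  rw [h1, ← h2, hL, one_smul]

section Flow

variable {d : ℕ} {M : Type*} [TopologicalSpace M] [ChartedSpace (EuclideanSpace ℝ (Fin d)) M]
  [IsManifold (𝓡 d) ∞ M]
  {A : Set (OpenPartialHomeomorph M (EuclideanSpace ℝ (Fin d)))} {g : RiemMetric d M}
  {σ σ' : OpenPartialHomeomorph M (EuclideanSpace ℝ (Fin d))}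

/-- The transition map has the identity as derivative, so on a ball it differs from the identity by
a constant. -/
theorem IsVolumeChart.eventually_apply_symm_add (hd : d = 1) (hA : IsOrientedAtlas A)
    (hσ : IsVolumeChart A g σ) (hσ' : IsVolumeChart A g σ') {z : EuclideanSpace ℝ (Fin d)}
    (hz : z ∈ σ.target) (hz' : σ.symm z ∈ σ'.source) :
    ∀ᶠ w in 𝓝 z, σ.symm w = σ'.symm (σ' (σ.symm z) + (w - z)) := by
  have hdom : (σ.symm ≫ₕ σ').source ∈ 𝓝 z := by
    refine (σ.symm ≫ₕ σ').open_source.mem_nhds ?_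
    rw [OpenPartialHomeomorph.trans_source]
    exact ⟨hz, hz'⟩
  obtain ⟨r, hr, hrs⟩ := Metric.mem_nhds_iff.1 hdom
  have hsub : ∀ w ∈ Metric.ball z r, w ∈ σ.target ∧ σ.symm w ∈ σ'.source := by
    intro w hw
    have := hrs hw
    rwa [OpenPartialHomeomorph.trans_source] at this
  have hcd : ∀ w ∈ Metric.ball z r, DifferentiableAt ℝ (σ' ∘ σ.symm) w := by
    intro w hw
    have h1 := contDiffAt_transition hσ.mem_maximalAtlas hσ'.mem_maximalAtlas
      (σ.map_target (hsub w hw).1) (hsub w hw).2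
    rw [σ.right_inv (hsub w hw).1] at h1
    exact h1.differentiableAt (by simp)
  have hfd : ∀ w ∈ Metric.ball z r, fderiv ℝ (σ' ∘ σ.symm) w = ContinuousLinearMap.id ℝ _ := by
    intro w hw
    have h1 := hσ.det_transition hA hσ' (σ.map_target (hsub w hw).1) (hsub w hw).2
    rw [σ.right_inv (hsub w hw).1] at h1
    exact ContinuousLinearMap.eq_id_of_finrank_eq_one (by rw [finrank_euclideanSpace_fin, hd]) h1
  have hconst : ∀ w ∈ Metric.ball z r,
      (σ' ∘ σ.symm) w - w = (σ' ∘ σ.symm) z - z := by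
    intro w hw
    refine Metric.isOpen_ball.is_const_of_fderiv_eq_zero (𝕜 := ℝ)
      (f := fun w => (σ' ∘ σ.symm) w - w) (convex_ball z r).isPreconnected
      (fun w hw => ((hcd w hw).sub differentiableAt_id).differentiableWithinAt) (fun w hw => ?_) hw
      (Metric.mem_ball_self hr)
    have h2 : fderiv ℝ (fun w => (σ' ∘ σ.symm) w - w) w =
        fderiv ℝ (σ' ∘ σ.symm) w - fderiv ℝ id w := fderiv_sub (hcd w hw) differentiableAt_id
    rw [h2, hfd w hw, fderiv_id, sub_self]
    rfl
  filter_upwards [Metric.ball_mem_nhds z hr] with w hw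
  have h3 : σ' (σ.symm z) + (w - z) = σ' (σ.symm w) := by
    have := hconst w hw
    simp only [Function.comp_apply] at this
    rw [add_sub_assoc', add_comm, add_sub_assoc, ← this]
    abel
  rw [h3, σ'.left_inv (hsub w hw).2]

/-- In dimension one, translating by `v` in a volume chart does not depend on the chart. -/
theorem IsVolumeChart.symm_add_eq_symm_add [T2Space M] (hd : d = 1) (hA : IsOrientedAtlas A)
    (hσ : IsVolumeChart A g σ) (hσ' : IsVolumeChart A g σ') {x : M} (hx : x ∈ σ.source)
    (hx' : x ∈ σ'.source) {v : EuclideanSpace ℝ (Fin d)}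
    (hv : ∀ s ∈ Icc (0 : ℝ) 1, σ x + s • v ∈ σ.target)
    (hv' : ∀ s ∈ Icc (0 : ℝ) 1, σ' x + s • v ∈ σ'.target) :
    σ.symm (σ x + v) = σ'.symm (σ' x + v) := by
  -- Continuous induction along the segment: agreement holds at 0, is closed since M is Hausdorff,
  -- and is propagated by the local translation formula.
  let S : Set ℝ := {s | σ.symm (σ x + s • v) = σ'.symm (σ' x + s • v)}
  have hc : ContinuousOn (fun s : ℝ => σ.symm (σ x + s • v)) (Icc 0 1) :=
    σ.continuousOn_symm.comp (by fun_prop) hv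
  have hc' : ContinuousOn (fun s : ℝ => σ'.symm (σ' x + s • v)) (Icc 0 1) :=
    σ'.continuousOn_symm.comp (by fun_prop) hv'
  have hclosed : IsClosed (S ∩ Icc 0 1) := by
    refine isClosed_of_closure_subset fun s hs => ?_
    have hs1 : s ∈ Icc (0 : ℝ) 1 := isClosed_Icc.closure_subset
      (closure_mono inter_subset_right hs)
    have hne : (𝓝[S ∩ Icc 0 1] s).NeBot := mem_closure_iff_nhdsWithin_neBot.1 hs
    have t1 : Filter.Tendsto (fun s : ℝ => σ.symm (σ x + s • v)) (𝓝[S ∩ Icc 0 1] s)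
        (𝓝 (σ.symm (σ x + s • v))) := (hc s hs1).mono inter_subset_right
    have t2 : Filter.Tendsto (fun s : ℝ => σ'.symm (σ' x + s • v)) (𝓝[S ∩ Icc 0 1] s)
        (𝓝 (σ'.symm (σ' x + s • v))) := (hc' s hs1).mono inter_subset_right
    refine ⟨tendsto_nhds_unique_of_eventuallyEq t1 t2 ?_, hs1⟩
    filter_upwards [self_mem_nhdsWithin] with t ht
    exact ht.1
  have hsub := hclosed.Icc_subset_of_forall_mem_nhdsWithin (a := 0) (b := 1) (by
      change σ.symm (σ x + (0 : ℝ) • v) = σ'.symm (σ' x + (0 : ℝ) • v)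
      rw [zero_smul, add_zero, add_zero, σ.left_inv hx, σ'.left_inv hx']) (by
    rintro s ⟨hs, hs1⟩
    have hs1' : s ∈ Icc (0 : ℝ) 1 := ⟨hs1.1, hs1.2.le⟩
    have hs' : σ.symm (σ x + s • v) = σ'.symm (σ' x + s • v) := hs
    have h1 : σ.symm (σ x + s • v) ∈ σ'.source := by
      rw [hs']
      exact σ'.map_target (hv' s hs1')
    have h2 := hσ.eventually_apply_symm_add hd hA hσ' (hv s hs1') h1
    have h3 : Filter.Tendsto (fun t : ℝ => σ x + t • v) (𝓝 s) (𝓝 (σ x + s • v)) :=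
      Continuous.tendsto (by fun_prop) s
    refine mem_nhdsWithin_of_mem_nhds ?_
    filter_upwards [h3.eventually h2] with t ht
    change σ.symm (σ x + t • v) = σ'.symm (σ' x + t • v)
    rw [ht, hs', σ'.right_inv (hv' s hs1')]
    congr 1
    abel)
  have h4 : (1 : ℝ) ∈ S := hsub (right_mem_Icc.2 zero_le_one)
  have h5 : σ.symm (σ x + (1 : ℝ) • v) = σ'.symm (σ' x + (1 : ℝ) • v) := h4
  rwa [one_smul] at h5

/-- Near a given point its chart still works with half the radius; compactness then makes the radius
uniform. -/
theorem exists_uniform_volumeChart [CompactSpace M] (hA : IsOrientedAtlas A) (g : RiemMetric d M) :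
    ∃ ε > 0, ∀ x : M, ∃ σ, IsVolumeChart A g σ ∧ x ∈ σ.source ∧
      Metric.ball (σ x) ε ⊆ σ.target := by
  have h := isCompact_univ.induction_on (X := M) (p := fun s => ∃ ε > 0, ∀ x ∈ s, ∃ σ,
    IsVolumeChart A g σ ∧ x ∈ σ.source ∧ Metric.ball (σ x) ε ⊆ σ.target)
    ⟨1, one_pos, fun x hx => hx.elim⟩
    (fun s t hst ⟨ε, hε, h⟩ => ⟨ε, hε, fun x hx => h x (hst hx)⟩)
    (fun s t ⟨ε, hε, h⟩ ⟨ε', hε', h'⟩ => ⟨min ε ε', lt_min hε hε', by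
      rintro x (hx | hx)
      · obtain ⟨σ, h1, h2, h3⟩ := h x hx
        exact ⟨σ, h1, h2, (Metric.ball_subset_ball (min_le_left _ _)).trans h3⟩
      · obtain ⟨σ, h1, h2, h3⟩ := h' x hx
        exact ⟨σ, h1, h2, (Metric.ball_subset_ball (min_le_right _ _)).trans h3⟩⟩)
    (fun x _ => by
      obtain ⟨σ, hσ, hx⟩ := exists_isVolumeChart hA g x
      obtain ⟨ε, hε, hεσ⟩ := Metric.isOpen_iff.1 σ.open_target _ (σ.map_source hx)
      refine ⟨σ.source ∩ σ ⁻¹' Metric.ball (σ x) (ε / 2), mem_nhdsWithin_of_mem_nhds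
        ((σ.isOpen_inter_preimage Metric.isOpen_ball).mem_nhds
          ⟨hx, Metric.mem_ball_self (half_pos hε)⟩), ε / 2, half_pos hε, fun z hz =>
        ⟨σ, hσ, hz.1, fun y hy => hεσ ?_⟩⟩
      have h1 : dist (σ z) (σ x) < ε / 2 := hz.2
      have h2 := dist_triangle y (σ z) (σ x)
      rw [Metric.mem_ball] at hy ⊢
      linarith)
  obtain ⟨ε, hε, h⟩ := h
  exact ⟨ε, hε, fun x => h x (mem_univ x)⟩

variable [T2Space M] [MeasurableSpace M] [BorelSpace M] [SecondCountableTopology M] [Nonempty M]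

/-- Moving every point by v in a volume chart around it does not depend on the chart as long as v is
shorter than the uniform radius, and moving by -v is the inverse. The map is not localized: its
compact support is the compactness of M. -/
theorem exists_volumeDiffeos_eq_translation_of_eq_one [CompactSpace M] (hd : d = 1)
    (hA : IsOrientedAtlas A) (g : RiemMetric d M) (x : M) :
    ∃ σ, IsVolumeChart A g σ ∧ x ∈ σ.source ∧ ∃ ρ > 0, Metric.ball (σ x) (2 * ρ) ⊆ σ.target ∧
      ∀ v, ‖v‖ < ρ → ∃ ψ ∈ volumeDiffeos A g, ∀ y ∈ Metric.ball (σ x) ρ,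
        ψ (σ.symm y) = σ.symm (y + v) := by
  obtain ⟨ε, hε, h⟩ := exists_uniform_volumeChart hA g
  choose c hc hxc hball using h
  let R : EuclideanSpace ℝ (Fin d) → M → M := fun v z => (c z).symm (c z z + v)
  have seg : ∀ (z y v : EuclideanSpace ℝ (Fin d)) (r : ℝ), dist y z + ‖v‖ < r →
      ∀ s ∈ Icc (0 : ℝ) 1, y + s • v ∈ Metric.ball z r := by
    intro z y v r hr s hs
    rw [Metric.mem_ball]
    have h1 : dist (y + s • v) y ≤ ‖v‖ := by
      rw [dist_eq_norm, add_sub_cancel_left, norm_smul, Real.norm_of_nonneg hs.1]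
      exact mul_le_of_le_one_left (norm_nonneg v) hs.2
    linarith [dist_triangle (y + s • v) y z]
  have hR : ∀ v : EuclideanSpace ℝ (Fin d), ‖v‖ < ε → ∀ (σ : OpenPartialHomeomorph M (EuclideanSpace ℝ (Fin d))),
      IsVolumeChart A g σ → ∀ z ∈ σ.source, (∀ s ∈ Icc (0 : ℝ) 1, σ z + s • v ∈ σ.target) →
      R v z = σ.symm (σ z + v) := by
    intro v hv σ hσ z hz hs
    exact (hc z).symm_add_eq_symm_add hd hA hσ (hxc z) hz
      (fun s hs => hball z (seg _ _ v ε (by rwa [dist_self, zero_add]) s hs)) hs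
  -- R v is defined with a different chart at each point, but near z it can be computed in the
  -- single chart c z.
  have hloc : ∀ v : EuclideanSpace ℝ (Fin d), ‖v‖ < ε → ∀ z w, w ∈ (c z).source →
      dist (c z w) (c z z) < ε - ‖v‖ → R v w = (c z).symm (c z w + v) := by
    intro v hv z w hw hwz
    exact hR v hv (c z) (hc z) w hw
      (fun s hs => hball z (seg _ _ v ε (by linarith) s hs))
  have hnear : ∀ v : EuclideanSpace ℝ (Fin d), ‖v‖ < ε → ∀ z, ∀ᶠ w in 𝓝 z, w ∈ (c z).source ∧
      dist (c z w) (c z z) < ε - ‖v‖ := by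
    intro v hv z
    exact ((c z).isOpen_inter_preimage Metric.isOpen_ball).mem_nhds
      ⟨hxc z, Metric.mem_ball_self (sub_pos.2 hv)⟩
  have htgt : ∀ v : EuclideanSpace ℝ (Fin d), ‖v‖ < ε → ∀ z, c z z + v ∈ (c z).target := by
    intro v hv z
    refine hball z ?_
    rw [Metric.mem_ball, dist_eq_norm, add_sub_cancel_left]
    exact hv
  have hsm : ∀ v, ‖v‖ < ε → ContMDiff (𝓡 d) (𝓡 d) ∞ (R v) := by
    intro v hv z
    have h1 : ContMDiffAt (𝓡 d) (𝓡 d) ∞ ((c z).symm ∘ (fun y => y + v) ∘ c z) z := by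
      refine ContMDiffAt.comp z (contMDiffAt_symm_of_mem_maximalAtlas (hc z).mem_maximalAtlas
        (htgt v hv z)) ?_
      exact (contMDiff_iff_contDiff.2 (contDiff_id.add contDiff_const)).contMDiffAt.comp z
        (contMDiffAt_of_mem_maximalAtlas (hc z).mem_maximalAtlas (hxc z))
    refine h1.congr_of_eventuallyEq ?_
    filter_upwards [hnear v hv z] with w hw
    exact hloc v hv z w hw.1 hw.2
  have hinv : ∀ v, ‖v‖ < ε → ∀ z, R (-v) (R v z) = z := by
    intro v hv z
    have h1 : R v z = (c z).symm (c z z + v) := rfl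
    have h2 : (c z) (R v z) = c z z + v := (c z).right_inv (htgt v hv z)
    rw [hR (-v) (by rwa [norm_neg]) (c z) (hc z) (R v z)
      (by rw [h1]; exact (c z).map_target (htgt v hv z)), h2, add_neg_cancel_right,
      (c z).left_inv (hxc z)]
    intro s hs
    have h3 : c z (R v z) + s • -v = c z z + (1 - s) • v := by
      rw [h2]
      module
    rw [h3]
    exact hball z (seg _ _ v ε (by rwa [dist_self, zero_add]) (1 - s)
      ⟨sub_nonneg.2 hs.2, by linarith [hs.1]⟩)
  refine ⟨c x, hc x, hxc x, ε / 2, half_pos hε, by rw [mul_div_cancel₀ _ two_ne_zero]; exact hball x,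
    fun v hv => ?_⟩
  have hvε : ‖v‖ < ε := by linarith
  let ψ : Diffeomorph (𝓡 d) (𝓡 d) M M ∞ :=
    { toFun := R v
      invFun := R (-v)
      left_inv := hinv v hvε
      right_inv := fun z => by
        have := hinv (-v) (by rwa [norm_neg]) z
        rwa [neg_neg] at this
      contMDiff_toFun := hsm v hvε
      contMDiff_invFun := hsm (-v) (by rwa [norm_neg]) }
  have hψ : ∀ z, ψ z = R v z := fun _ => rfl
  refine ⟨ψ, mem_volumeDiffeos_of_det_eq_one hA ψ ⟨univ, isCompact_univ, fun z hz =>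
    (hz (mem_univ z)).elim⟩ fun z => ⟨c z, c z, hc z, hc z, hxc z,
      (c z).map_target (htgt v hvε z), ?_⟩, fun y hy => ?_⟩
  · have e : (c z) ∘ ψ ∘ (c z).symm =ᶠ[𝓝 (c z z)] fun y => y + v := by
      have h1 : ∀ᶠ y in 𝓝 (c z z), (c z).symm y ∈ (c z).source ∧
          dist (c z ((c z).symm y)) (c z z) < ε - ‖v‖ :=
        ((c z).continuousAt_symm ((c z).map_source (hxc z))).eventually
          (by rw [(c z).left_inv (hxc z)]; exact hnear v hvε z)
      have h2 : ∀ᶠ y in 𝓝 (c z z), y + v ∈ (c z).target :=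
        (Continuous.continuousAt (by fun_prop : Continuous fun y => y + v)).eventually_mem
          ((c z).open_target.mem_nhds (htgt v hvε z))
      filter_upwards [h1, h2, (c z).open_target.mem_nhds ((c z).map_source (hxc z))]
        with y hy hy2 hy3
      rw [Function.comp_apply, Function.comp_apply, hψ, hloc v hvε z _ hy.1 hy.2,
        (c z).right_inv hy3, (c z).right_inv hy2]
    have h3 : fderiv ℝ (fun y => y + v) (c z z) = ContinuousLinearMap.id ℝ _ := by
      rw [fderiv_add_const]
      exact fderiv_id
    rw [e.fderiv_eq, h3]
    exact LinearMap.det_id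
  · rw [Metric.mem_ball] at hy
    have hy' : y ∈ (c x).target := hball x (by rw [Metric.mem_ball]; linarith)
    have h1 := hloc v hvε x ((c x).symm y) ((c x).map_target hy')
      (by rw [(c x).right_inv hy']; linarith)
    rw [hψ, h1, (c x).right_inv hy']

end Flow

/-! ### Finite measures that are invariant under volume-preserving diffeomorphisms -/

section Invariant

variable {d : ℕ} {M : Type*} [TopologicalSpace M] [ChartedSpace (EuclideanSpace ℝ (Fin d)) M]
  [IsManifold (𝓡 d) ∞ M] [T2Space M] [MeasurableSpace M] [BorelSpace M]
  [SecondCountableTopology M] [Nonempty M]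
  {A : Set (OpenPartialHomeomorph M (EuclideanSpace ℝ (Fin d)))}

theorem exists_volumeDiffeos_eq_translation (hd : d ≠ 1 ∨ CompactSpace M)
    (hA : IsOrientedAtlas A) (g : RiemMetric d M) (x : M) :
    ∃ σ, IsVolumeChart A g σ ∧ x ∈ σ.source ∧ ∃ ρ > 0, Metric.ball (σ x) (2 * ρ) ⊆ σ.target ∧
      ∀ v, ‖v‖ < ρ → ∃ ψ ∈ volumeDiffeos A g, ∀ y ∈ Metric.ball (σ x) ρ,
        ψ (σ.symm y) = σ.symm (y + v) := by
  rcases lt_or_ge 1 d with h2 | h2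
  · exact exists_volumeDiffeos_eq_translation_of_two_le h2 hA x
  rcases Nat.le_one_iff_eq_zero_or_eq_one.1 h2 with rfl | h1
  · obtain ⟨σ, hσ, hx⟩ := exists_isVolumeChart hA g x
    obtain ⟨ε, hε, hεσ⟩ := Metric.isOpen_iff.1 σ.open_target _ (σ.map_source hx)
    refine ⟨σ, hσ, hx, ε / 2, half_pos hε, by rwa [mul_div_cancel₀ _ two_ne_zero], fun v _ => ?_⟩
    refine ⟨Diffeomorph.refl (𝓡 0) M ∞, mem_volumeDiffeos_of_det_eq_one hA _
      ⟨∅, isCompact_empty, fun _ _ => rfl⟩ fun z => ?_, fun y _ => ?_⟩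
    · obtain ⟨τ, hτ, hz⟩ := exists_isVolumeChart hA g z
      exact ⟨τ, τ, hτ, hτ, hz, hz, det_transition_self hz⟩
    · rw [Subsingleton.elim v 0, add_zero]
      rfl
  · have : CompactSpace M := hd.resolve_left (not_not.2 h1)
    exact exists_volumeDiffeos_eq_translation_of_eq_one h1 hA g x

/-- Read in the chart, m is invariant under small translations, hence a multiple of Lebesgue measure
on a smaller ball; in a volume chart Lebesgue measure is the volume. -/
theorem exists_nhds_eq_smul_riemannianVolume (hd : d ≠ 1 ∨ CompactSpace M)
    (hA : IsOrientedAtlas A) (g : RiemMetric d M) (m : Measure M) [IsFiniteMeasure m]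
    (hm : ∀ ψ ∈ volumeDiffeos A g, m.map ψ = m) (x : M) :
    ∃ U : Set M, IsOpen U ∧ x ∈ U ∧ riemannianVolume g U ≠ ⊤ ∧ ∃ κ : ℝ≥0∞, κ ≠ ⊤ ∧
      ∀ s ⊆ U, MeasurableSet s → m s = κ * riemannianVolume g s := by
  obtain ⟨σ, hσ, hx, ρ, hρ, hρσ, hT⟩ := exists_volumeDiffeos_eq_translation hd hA g x
  have hball : ∀ y ∈ Metric.ball (σ x) ρ, y ∈ σ.target := fun y hy =>
    hρσ (Metric.ball_subset_ball (by linarith) hy)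
  let m' : Measure (EuclideanSpace ℝ (Fin d)) := (m.restrict σ.source).map σ
  have hae : AEMeasurable σ (m.restrict σ.source) :=
    σ.continuousOn.aemeasurable σ.open_source.measurableSet
  have hm' : ∀ s : Set (EuclideanSpace ℝ (Fin d)), MeasurableSet s → s ⊆ σ.target →
      m' s = m (σ.symm '' s) := by
    intro s hs hsσ
    rw [Measure.map_apply_of_aemeasurable hae hs,
      Measure.restrict_apply' σ.open_source.measurableSet, inter_comm,
      σ.symm_image_eq_source_inter_preimage hsσ]
  have hinv : ∀ v : EuclideanSpace ℝ (Fin d), ‖v‖ < ρ → ∀ s ⊆ Metric.ball (σ x) ρ,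
      MeasurableSet s → m' ((fun y => y - v) ⁻¹' s) = m' s := by
    intro v hv s hs hsm
    obtain ⟨ψ, hψ, hψT⟩ := hT v hv
    have hsub : (fun y => y - v) ⁻¹' s ⊆ σ.target := by
      intro y hy
      refine hρσ ?_
      have h1 : dist (y - v) (σ x) < ρ := hs hy
      have h2 : dist y (y - v) < ρ := by rwa [dist_eq_norm, sub_sub_cancel]
      have h3 := dist_triangle y (y - v) (σ x)
      rw [Metric.mem_ball]
      linarith
    have hsσ : s ⊆ σ.target := fun y hy => hball y (hs hy)
    have hms : MeasurableSet ((fun y => y - v) ⁻¹' s) :=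
      (by fun_prop : Measurable fun y => y - v) hsm
    rw [hm' _ hms hsub, hm' s hsm hsσ]
    have hme : MeasurableSet (σ.symm '' ((fun y => y - v) ⁻¹' s)) :=
      σ.symm.measurableSet_image hms hsub
    conv_lhs => rw [← hm ψ hψ, Measure.map_apply ψ.continuous.measurable hme]
    congr 1
    ext z
    constructor
    · rintro ⟨y, hy, hyz⟩
      have h1 := hψT (y - v) (hs hy)
      rw [sub_add_cancel, hyz] at h1
      exact ⟨y - v, hy, ψ.injective h1⟩
    · rintro ⟨y, hy, rfl⟩
      refine ⟨y + v, ?_, (hψT y (hs hy)).symm⟩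
      rwa [mem_preimage, add_sub_cancel_right]
  have hfin : IsFiniteMeasure m' := Measure.isFiniteMeasure_map _ _
  set B := Metric.ball (σ x) (ρ / 4) with hB
  have hBt : B ⊆ σ.target := fun y hy => hball y (Metric.ball_subset_ball (by linarith) hy)
  have hB0 : volume B ≠ 0 := (Metric.measure_ball_pos volume _ (by positivity)).ne'
  have hB1 : volume B ≠ ⊤ := measure_ball_lt_top.ne
  have hUo : IsOpen (σ.symm '' B) := σ.symm.isOpen_image_of_subset_source Metric.isOpen_ball hBt
  have himg : ∀ s ⊆ σ.symm '' B, s ⊆ σ.source ∧ σ '' s ⊆ B := by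
    intro s hs
    constructor
    · intro z hz
      obtain ⟨y, hy, rfl⟩ := hs hz
      exact σ.map_target (hBt hy)
    · rintro _ ⟨z, hz, rfl⟩
      obtain ⟨y, hy, rfl⟩ := hs hz
      rwa [σ.right_inv (hBt hy)]
  refine ⟨σ.symm '' B, hUo, ⟨σ x, Metric.mem_ball_self (by positivity), σ.left_inv hx⟩, ?_,
    m' B / volume B, ENNReal.div_ne_top (measure_ne_top _ _) hB0, fun s hs hsm => ?_⟩
  · rw [hσ.riemannianVolume_apply hA hUo.measurableSet (himg _ subset_rfl).1]
    exact ((measure_mono (himg _ subset_rfl).2).trans_lt measure_ball_lt_top).ne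
  · obtain ⟨hsσ, hsB⟩ := himg s hs
    have hsm' := σ.measurableSet_image hsm hsσ
    have h1 := Measure.mul_eq_mul_of_locally_translation_invariant m' volume (σ x) hinv hsm' hsB
    have h2 : m' (σ '' s) = m s := by
      rw [hm' _ hsm' (hsB.trans hBt), image_image]
      congr 1
      calc (fun z => σ.symm (σ z)) '' s = id '' s :=
            image_congr fun z hz => σ.left_inv (hsσ hz)
        _ = s := image_id s
    rw [h2] at h1
    rw [hσ.riemannianVolume_apply hA hsm hsσ, ENNReal.div_eq_inv_mul, mul_assoc, ← h1, mul_comm (m s),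
      ← mul_assoc, ENNReal.inv_mul_cancel hB0 hB1, one_mul]

/-- On a connected manifold, the volume is the only finite measure that is invariant under
volume-preserving diffeomorphisms, up to a factor. -/
theorem exists_eq_smul_riemannianVolume [ConnectedSpace M] (hd : d ≠ 1 ∨ CompactSpace M)
    (hA : IsOrientedAtlas A) (g : RiemMetric d M) (m : Measure M) [IsFiniteMeasure m]
    (hm : ∀ ψ ∈ volumeDiffeos A g, m.map ψ = m) : ∃ κ : ℝ≥0∞, m = κ • riemannianVolume g := by
  choose U hU hxU hfin κ hκ hUκ using exists_nhds_eq_smul_riemannianVolume hd hA g m hm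
  -- An overlap has positive finite volume, so the two local factors agree.
  have hloc : IsLocallyConstant κ := by
    refine (IsLocallyConstant.iff_exists_open κ).2 fun x => ⟨U x, hU x, hxU x, fun z hz => ?_⟩
    have ho : IsOpen (U x ∩ U z) := (hU x).inter (hU z)
    have h1 := hUκ x _ inter_subset_left ho.measurableSet
    have h2 := hUκ z _ inter_subset_right ho.measurableSet
    have h3 : riemannianVolume g (U x ∩ U z) ≠ 0 :=
      (riemannianVolume_pos_of_isOpen hA g ho ⟨z, hz, hxU z⟩).ne'
    have h4 : riemannianVolume g (U x ∩ U z) ≠ ⊤ :=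
      ((measure_mono inter_subset_left).trans_lt (hfin x).lt_top).ne
    rw [h1] at h2
    exact ((ENNReal.mul_left_inj h3 h4).1 h2).symm
  obtain ⟨x₀⟩ := ‹Nonempty M›
  refine ⟨κ x₀, Measure.ext_of_locally_eq fun x => ⟨U x, (hU x).mem_nhds (hxU x),
    (hU x).measurableSet, fun s hs hsm => ?_⟩⟩
  rw [hUκ x s hs hsm, hloc.apply_eq_of_isPreconnected isPreconnected_univ (mem_univ x)
    (mem_univ x₀), Measure.smul_apply, smul_eq_mul]

theorem riemannianVolume_univ_smul_eq [ConnectedSpace M] (hd : d ≠ 1 ∨ CompactSpace M)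
    (hA : IsOrientedAtlas A) (g : RiemMetric d M)
    (ν : Measure M) [IsProbabilityMeasure ν] (hν : ∀ ψ ∈ volumeDiffeos A g, ν.map ψ = ν) :
    riemannianVolume g univ • ν = riemannianVolume g := by
  obtain ⟨κ, hκ⟩ := exists_eq_smul_riemannianVolume hd hA g ν hν
  have h0 : riemannianVolume g univ ≠ 0 :=
    (riemannianVolume_pos_of_isOpen hA g isOpen_univ univ_nonempty).ne'
  have h1 : κ * riemannianVolume g univ = 1 := by
    rw [← smul_eq_mul, ← Measure.smul_apply, ← hκ, measure_univ]
  rw [hκ, smul_smul, mul_comm, h1, one_smul]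

end Invariant

/-! ### The action of multipliers -/

section Multipliers

theorem exists_forall_abs_le {X : Type*} [TopologicalSpace X] (a : C_c(X, ℝ)) :
    ∃ C, ∀ x, |a x| ≤ C := by
  obtain ⟨C, hC⟩ := a.continuous.bounded_above_of_compact_support a.hasCompactSupport
  exact ⟨C, hC⟩

variable {X : Type*} [TopologicalSpace X] [MeasurableSpace X] [BorelSpace X]

theorem lintegral_expMultiplier (a : C_c(X, ℝ)) (μ : FiniteMeasure X) {f : X → ℝ≥0∞}
    (hf : Measurable f) : ∫⁻ x, f x ∂(expMultiplier a μ : Measure X) =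
      ∫⁻ x, ENNReal.ofReal (Real.exp (a x)) * f x ∂(μ : Measure X) :=
  lintegral_withDensity_eq_lintegral_mul _
    (Real.measurable_exp.comp a.continuous.measurable).ennreal_ofReal hf

theorem measurable_expMultiplier (a : C_c(X, ℝ)) : Measurable (expMultiplier a) := by
  refine FiniteMeasure.measurable_of_measurable_apply fun s hs => ?_
  have e : ∀ μ : FiniteMeasure X, (expMultiplier a μ : Measure X) s =
      ∫⁻ x, s.indicator (fun x => ENNReal.ofReal (Real.exp (a x))) x ∂(μ : Measure X) := by
    intro μ
    rw [lintegral_indicator hs]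
    exact withDensity_apply _ hs
  simp_rw [e]
  exact FiniteMeasure.measurable_lintegral
    ((Real.measurable_exp.comp a.continuous.measurable).ennreal_ofReal.indicator hs)

theorem expMultiplier_apply_univ (a : C_c(X, ℝ)) (μ : FiniteMeasure X) :
    (expMultiplier a μ : Measure X) univ = expMass a 1 μ := by
  have h := lintegral_expMultiplier a μ (f := fun _ => 1) measurable_const
  simp only [lintegral_one, mul_one] at h
  simp [h, expMass]

theorem expMass_expMultiplier (a : C_c(X, ℝ)) {h : X → ℝ} (hh : Measurable h)
    (μ : FiniteMeasure X) : expMass h 1 (expMultiplier a μ) = expMass (fun x => a x + h x) 1 μ := by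
  rw [expMass, lintegral_expMultiplier a μ (by fun_prop)]
  refine lintegral_congr fun x => ?_
  rw [← ENNReal.ofReal_mul (Real.exp_pos _).le, ← Real.exp_add]
  ring_nf

theorem expMultiplier_expMultiplier (a b : C_c(X, ℝ)) (μ : FiniteMeasure X) :
    expMultiplier a (expMultiplier b μ) = expMultiplier (a + b) μ := by
  apply Subtype.ext
  refine Measure.ext_of_lintegral _ fun f hf => ?_
  have h1 := lintegral_expMultiplier a (expMultiplier b μ) hf
  have h2 := lintegral_expMultiplier (a + b) μ hf
  rw [lintegral_expMultiplier b μ (by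
    have := a.continuous.measurable
    fun_prop)] at h1
  refine h1.trans (Eq.trans ?_ h2.symm)
  refine lintegral_congr fun x => ?_
  rw [← mul_assoc, ← ENNReal.ofReal_mul (Real.exp_pos _).le, ← Real.exp_add, add_comm]
  rfl

theorem expMultiplier_zero (μ : FiniteMeasure X) : expMultiplier (0 : C_c(X, ℝ)) μ = μ := by
  apply Subtype.ext
  refine Measure.ext_of_lintegral _ fun f hf => ?_
  have h1 := lintegral_expMultiplier (0 : C_c(X, ℝ)) μ hf
  refine h1.trans (lintegral_congr fun x => ?_)
  simp

theorem map_expMultiplier_add {Q : Measure (FiniteMeasure X)} {a b : C_c(X, ℝ)} {c c' : ℝ≥0∞}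
    (ha : Q.map (expMultiplier a) = c • Q) (hb : Q.map (expMultiplier b) = c' • Q) :
    Q.map (expMultiplier (a + b)) = (c * c') • Q := by
  have e : expMultiplier (a + b) = expMultiplier a ∘ expMultiplier b :=
    funext fun μ => (expMultiplier_expMultiplier a b μ).symm
  rw [e, ← Measure.map_map (measurable_expMultiplier a) (measurable_expMultiplier b), hb,
    Measure.map_smul, ha, smul_smul, mul_comm]

theorem map_expMultiplier_neg {Q : Measure (FiniteMeasure X)} {a : C_c(X, ℝ)} {c : ℝ≥0∞}
    (hc0 : c ≠ 0) (hc : c ≠ ⊤) (ha : Q.map (expMultiplier a) = c • Q) :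
    Q.map (expMultiplier (-a)) = c⁻¹ • Q := by
  have e : expMultiplier (-a) ∘ expMultiplier a = id := funext fun μ => by
    rw [Function.comp_apply, expMultiplier_expMultiplier, neg_add_cancel, expMultiplier_zero, id]
  have h1 : (c • Q).map (expMultiplier (-a)) = Q := by
    rw [← ha, Measure.map_map (measurable_expMultiplier _) (measurable_expMultiplier a), e,
      Measure.map_id]
  rw [Measure.map_smul] at h1
  calc Q.map (expMultiplier (-a)) = c⁻¹ • c • Q.map (expMultiplier (-a)) := by
        rw [smul_smul, ENNReal.inv_mul_cancel hc0 hc, one_smul]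
    _ = c⁻¹ • Q := by rw [h1]

theorem lintegral_comp_expMultiplier {Q : Measure (FiniteMeasure X)} {a : C_c(X, ℝ)} {c : ℝ≥0∞}
    (ha : Q.map (expMultiplier a) = c • Q) {F : FiniteMeasure X → ℝ≥0∞} (hF : Measurable F) :
    ∫⁻ μ, F (expMultiplier a μ) ∂Q = c * ∫⁻ μ, F μ ∂Q := by
  rw [← lintegral_map hF (measurable_expMultiplier a), ha, lintegral_smul_measure, smul_eq_mul]

end Multipliers

/-! ### Projective invariance of the multiplicative Lebesgue measure -/

section MultLebesgue

variable {X : Type*} [TopologicalSpace X] [MeasurableSpace X] [BorelSpace X]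
  {θ : ℝ} {ν : ProbabilityMeasure X}

/-- The multiplier turns the functional at b into the functional at a + b, and the exponents of the
Laplace functional add. -/
theorem map_expMultiplier_multLebesgue_of_nonneg (hθ : 0 < θ) {a : C_c(X, ℝ)}
    (h0 : ∀ x, 0 ≤ a x) : (multLebesgue θ ν).map (expMultiplier a) =
      ENNReal.ofReal (Real.exp (-(θ * ∫ x, a x ∂(ν : Measure X)))) • multLebesgue θ ν := by
  obtain ⟨C, hC⟩ := exists_forall_abs_le a
  have ham : Measurable (a : X → ℝ) := a.continuous.measurable
  have hint : ∀ {b : X → ℝ} {C : ℝ}, Measurable b → (∀ x, 0 ≤ b x) → (∀ x, b x ≤ C) →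
      Integrable b (ν : Measure X) := fun hb h0 hC =>
    integrable_of_abs_le hb (fun x => by rw [abs_of_nonneg (h0 x)]; exact hC x) ν.toFiniteMeasure
  have hC' : ∀ x, a x ≤ C := fun x => (le_abs_self _).trans (hC x)
  refine ext_of_lintegral_expNeg_expMass ?_ fun b C' hb hb0 hbC => ?_
  · rw [lintegral_map measurable_expNeg_mass (measurable_expMultiplier a)]
    simp_rw [expMultiplier_apply_univ]
    rw [lintegral_expNeg_expMass_multLebesgue hθ ham h0 hC']
    exact ENNReal.ofReal_ne_top
  · have hm : Measurable fun μ : FiniteMeasure X => expNeg (expMass b 1 μ) :=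
      measurable_expNeg.comp (measurable_expMass_right hb 1)
    rw [lintegral_map hm (measurable_expMultiplier a), lintegral_smul_measure]
    simp only [expMass_expMultiplier a hb]
    rw [lintegral_expNeg_expMass_multLebesgue hθ (a := fun x => a x + b x) (ham.add hb)
      (C := C + C')
      (fun x => add_nonneg (h0 x) (hb0 x)) (fun x => add_le_add (hC' x) (hbC x)),
      lintegral_expNeg_expMass_multLebesgue hθ hb hb0 hbC, smul_eq_mul,
      ← ENNReal.ofReal_mul (Real.exp_pos _).le, ← Real.exp_add,
      integral_add (hint ham h0 hC') (hint hb hb0 hbC)]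
    ring_nf

/-- The Laplace functional is available at nonnegative functions only, so a is split into positive
and negative parts. These are merely continuous, which is enough here. -/
theorem exists_map_expMultiplier_multLebesgue (hθ : 0 < θ) (a : C_c(X, ℝ)) :
    ∃ c : ℝ≥0∞, (multLebesgue θ ν).map (expMultiplier a) = c • multLebesgue θ ν := by
  have h1 := map_expMultiplier_multLebesgue_of_nonneg (ν := ν) hθ (a := a ⊔ 0)
    (fun x => le_sup_right)
  have h2 := map_expMultiplier_multLebesgue_of_nonneg (ν := ν) hθ (a := (-a) ⊔ 0)
    (fun x => le_sup_right)
  have e : a = (a ⊔ 0) + -((-a) ⊔ 0) := by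
    ext x
    have : a x = max (a x) 0 + -max (-a x) 0 := by
      rcases le_total 0 (a x) with h | h
      · rw [max_eq_left h, max_eq_right (neg_nonpos.2 h)]
        ring
      · rw [max_eq_right h, max_eq_left (neg_nonneg.2 h)]
        ring
    exact this
  have h3 := map_expMultiplier_neg (by simp [Real.exp_pos]) ENNReal.ofReal_ne_top h2
  rw [e]
  exact ⟨_, map_expMultiplier_add h1 h3⟩

end MultLebesgue

/-! ### The intensity of a projectively invariant measure -/

/-- At the kink z = 1 the derivative is the limit of the derivatives nearby. A differentiable weight
is needed that vanishes for masses above one, where the size of Q is not yet controlled. -/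
theorem hasDerivAt_max_one_sub_sq (z : ℝ) :
    HasDerivAt (fun z : ℝ => max (1 - z) 0 ^ 2) (-(2 * max (1 - z) 0)) z := by
  have h : ∀ y : ℝ, y ≠ 1 →
      HasDerivAt (fun z : ℝ => max (1 - z) 0 ^ 2) (-(2 * max (1 - y) 0)) y := by
    intro y hy
    rcases lt_or_gt_of_ne hy with h | h
    · have h1 : HasDerivAt (fun z : ℝ => (1 - z) ^ 2) (-(2 * max (1 - y) 0)) y := by
        have h2 := ((hasDerivAt_id y).const_sub 1).fun_pow 2
        rw [max_eq_left (by linarith)]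
        simpa using h2
      refine h1.congr_of_eventuallyEq ?_
      filter_upwards [Iio_mem_nhds h] with w hw
      rw [max_eq_left (by linarith [mem_Iio.1 hw])]
    · have h1 : HasDerivAt (fun _ : ℝ => (0 : ℝ)) (-(2 * max (1 - y) 0)) y := by
        rw [max_eq_right (by linarith)]
        simpa using hasDerivAt_const y (0 : ℝ)
      refine h1.congr_of_eventuallyEq ?_
      filter_upwards [Ioi_mem_nhds h] with w hw
      rw [max_eq_right (by linarith [mem_Ioi.1 hw])]
      simp
  rcases eq_or_ne z 1 with rfl | hz
  · exact hasDerivAt_of_hasDerivAt_of_ne (g := fun y => -(2 * max (1 - y) 0)) h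
      (by fun_prop) (by fun_prop)
  · exact h z hz

section MeanMeasure

variable {X : Type*} [MeasurableSpace X]

/-- The weight `((1 - z)⁺) ^ 2` of the total mass. -/
noncomputable def massWeight (μ : FiniteMeasure X) : ℝ≥0∞ :=
  ENNReal.ofReal (max (1 - ((μ : Measure X) univ).toReal) 0 ^ 2)

/-- The weight `2 (1 - z)⁺` of the total mass. -/
noncomputable def massSlope (μ : FiniteMeasure X) : ℝ≥0∞ :=
  ENNReal.ofReal (2 * max (1 - ((μ : Measure X) univ).toReal) 0)

theorem measurable_mass : Measurable fun μ : FiniteMeasure X => (μ : Measure X) univ :=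
  (Measure.measurable_coe MeasurableSet.univ).comp FiniteMeasure.measurable_toMeasure

theorem measurable_massWeight : Measurable (massWeight (X := X)) := by
  have := measurable_mass (X := X)
  unfold massWeight
  fun_prop

theorem measurable_massSlope : Measurable (massSlope (X := X)) := by
  have := measurable_mass (X := X)
  unfold massSlope
  fun_prop

theorem measurableSet_massBall (r : ℝ≥0) : MeasurableSet (massBall X r) := by
  have e : massBall X r = (fun μ : FiniteMeasure X => ((μ : Measure X) univ).toNNReal) ⁻¹' Iic r :=
    rfl
  rw [e]
  exact measurable_mass.ennreal_toNNReal measurableSet_Iic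

theorem mem_massBall_iff {r : ℝ≥0} {μ : FiniteMeasure X} :
    μ ∈ massBall X r ↔ (μ : Measure X) univ ≤ r := by
  rw [massBall, mem_ofPred_eq, ← ENNReal.coe_le_coe, FiniteMeasure.ennreal_mass]

theorem one_sub_mass_nonpos {μ : FiniteMeasure X} (h : μ ∉ massBall X 1) :
    1 - ((μ : Measure X) univ).toReal ≤ 0 := by
  rw [mem_massBall_iff, not_le] at h
  have := (ENNReal.toReal_lt_toReal (by simp) (measure_ne_top (μ : Measure X) univ)).2 h
  simp only [ENNReal.coe_one, ENNReal.toReal_one] at this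
  linarith

theorem massWeight_le (μ : FiniteMeasure X) :
    massWeight μ ≤ (massBall X 1).indicator 1 μ := by
  by_cases h : μ ∈ massBall X 1
  · rw [indicator_of_mem h, Pi.one_apply, massWeight, ENNReal.ofReal_le_one]
    have h1 : max (1 - ((μ : Measure X) univ).toReal) 0 ≤ 1 :=
      max_le (by linarith [ENNReal.toReal_nonneg (a := (μ : Measure X) univ)]) zero_le_one
    exact pow_le_one₀ (le_max_right _ _) h1
  · rw [indicator_of_notMem h, massWeight, max_eq_right (one_sub_mass_nonpos h)]
    simp

theorem massSlope_mul_mass_le (μ : FiniteMeasure X) :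
    massSlope μ * (μ : Measure X) univ ≤ (massBall X 1).indicator (fun _ => 2) μ := by
  by_cases h : μ ∈ massBall X 1
  · rw [indicator_of_mem h]
    have h1 : massSlope μ ≤ 2 := by
      rw [massSlope, ← ENNReal.ofReal_ofNat]
      refine ENNReal.ofReal_le_ofReal ?_
      have h1 : max (1 - ((μ : Measure X) univ).toReal) 0 ≤ 1 :=
        max_le (by linarith [ENNReal.toReal_nonneg (a := (μ : Measure X) univ)]) zero_le_one
      linarith
    calc massSlope μ * (μ : Measure X) univ ≤ 2 * 1 := by
          gcongr
          simpa using mem_massBall_iff.1 h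
      _ = 2 := mul_one 2
  · rw [indicator_of_notMem h, massSlope, max_eq_right (one_sub_mass_nonpos h)]
    simp

variable (Q : Measure (FiniteMeasure X))

theorem lintegral_massWeight_le : ∫⁻ μ, massWeight μ ∂Q ≤ Q (massBall X 1) :=
  (lintegral_mono massWeight_le).trans_eq (lintegral_indicator_one (measurableSet_massBall 1))

/-- The mean of the measures `μ` under `Q`, weighted by a function of the total mass. -/
noncomputable def meanMeasure : Measure X :=
  (∫⁻ μ, massWeight μ ∂Q)⁻¹ • (Q.withDensity massSlope).bind fun μ => (μ : Measure X)

theorem lintegral_meanMeasure {f : X → ℝ≥0∞} (hf : Measurable f) :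
    ∫⁻ x, f x ∂meanMeasure Q = (∫⁻ μ, massWeight μ ∂Q)⁻¹ *
      ∫⁻ μ, massSlope μ * ∫⁻ x, f x ∂(μ : Measure X) ∂Q := by
  rw [meanMeasure, lintegral_smul_measure, Measure.lintegral_bind
    FiniteMeasure.measurable_toMeasure.aemeasurable hf.aemeasurable,
    lintegral_withDensity_eq_lintegral_mul _ measurable_massSlope
      (FiniteMeasure.measurable_lintegral hf)]
  rfl

/-- The slope vanishes off the unit ball, so only the finite mass of that ball enters. -/
theorem isFiniteMeasure_meanMeasure (h0 : ∫⁻ μ, massWeight μ ∂Q ≠ 0)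
    (h1 : Q (massBall X 1) ≠ ⊤) : IsFiniteMeasure (meanMeasure Q) := by
  constructor
  have e := lintegral_meanMeasure Q (f := fun _ => 1) measurable_const
  simp only [lintegral_one] at e
  rw [e]
  refine ENNReal.mul_lt_top (ENNReal.inv_lt_top.2 (pos_iff_ne_zero.2 h0)) ?_
  refine (lintegral_mono massSlope_mul_mass_le).trans_lt ?_
  rw [lintegral_indicator_const (measurableSet_massBall 1)]
  exact ENNReal.mul_lt_top (by simp) h1.lt_top

/-- If slope times mass vanished almost everywhere, so would the slope, because Q does not charge
the zero measure, and with the slope the weight. -/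
theorem meanMeasure_univ_ne_zero (h0 : ∫⁻ μ, massWeight μ ∂Q ≠ 0) (h1 : Q (massBall X 1) ≠ ⊤)
    (hQ : Q (massBall X 0) = 0) : meanMeasure Q univ ≠ 0 := by
  have e := lintegral_meanMeasure Q (f := fun _ => 1) measurable_const
  simp only [lintegral_one] at e
  rw [e]
  refine mul_ne_zero (ENNReal.inv_ne_zero.2
    (ne_top_of_le_ne_top h1 (lintegral_massWeight_le Q))) fun h => h0 ?_
  have hm : Measurable fun μ : FiniteMeasure X => massSlope μ * (μ : Measure X) univ :=
    measurable_massSlope.mul measurable_mass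
  rw [lintegral_eq_zero_iff hm] at h
  rw [lintegral_eq_zero_iff measurable_massWeight]
  have hQ' : ∀ᵐ μ ∂Q, μ ∉ massBall X 0 := by
    rw [ae_iff]
    simpa using hQ
  filter_upwards [h, hQ'] with μ h2 h3
  have h4 : (μ : Measure X) univ ≠ 0 := by
    rw [mem_massBall_iff] at h3
    simpa using h3
  have h5 : massSlope μ = 0 := (mul_eq_zero.1 h2).resolve_right h4
  rw [massSlope, ENNReal.ofReal_eq_zero] at h5
  have h6 : max (1 - ((μ : Measure X) univ).toReal) 0 = 0 :=
    le_antisymm (by linarith) (le_max_right _ _)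
  simp [massWeight, h6]

end MeanMeasure

/-! ### The factor by which a multiplier acts -/

section Projective

variable {X : Type*} [TopologicalSpace X] [MeasurableSpace X] [BorelSpace X]

/-- The projective factor of a nonnegative multiplier. -/
theorem map_expMultiplier_eq_of_projective (Q : Measure (FiniteMeasure X)) [SFinite Q]
    (h0 : ∫⁻ μ, massWeight μ ∂Q ≠ 0) (h1 : Q (massBall X 1) ≠ ⊤) {a : C_c(X, ℝ)}
    (ha : ∀ x, 0 ≤ a x)
    (hc : ∀ s : ℝ, 0 ≤ s → ∃ c : ℝ≥0∞, Q.map (expMultiplier (s • a)) = c • Q) :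
    Q.map (expMultiplier a) =
      ENNReal.ofReal (Real.exp (-∫ x, a x ∂meanMeasure Q)) • Q := by
  have hfm := isFiniteMeasure_meanMeasure Q h0 h1
  obtain ⟨C, hC⟩ := exists_forall_abs_le a
  have hC' : ∀ x, a x ≤ C := fun x => (le_abs_self _).trans (hC x)
  have ham : Measurable (a : X → ℝ) := a.continuous.measurable
  have htop : ∫⁻ μ, massWeight μ ∂Q ≠ ⊤ := ne_top_of_le_ne_top h1 (lintegral_massWeight_le Q)
  have hint : Integrable a (meanMeasure Q) :=
    integrable_of_abs_le ham hC (⟨meanMeasure Q, hfm⟩ : FiniteMeasure X)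
  let l : ℝ≥0 := Real.toNNReal (∫ x, a x ∂meanMeasure Q)
  have hl : (l : ℝ≥0∞) = ∫⁻ x, ENNReal.ofReal (a x) ∂meanMeasure Q :=
    ofReal_integral_eq_lintegral_ofReal hint (.of_forall ha)
  have hlr : (l : ℝ) = ∫ x, a x ∂meanMeasure Q :=
    Real.coe_toNNReal _ (integral_nonneg ha)
  have hmass : ∀ (s : ℝ) (μ : FiniteMeasure X),
      (expMultiplier (s • a) μ : Measure X) univ = expMass a s μ := by
    intro s μ
    rw [expMultiplier_apply_univ]
    simp [expMass]
  have hlin : ∀ (s : ℝ) (μ : FiniteMeasure X),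
      ∫⁻ x, ENNReal.ofReal (a x) ∂(expMultiplier (s • a) μ : Measure X) =
        ∫⁻ x, ENNReal.ofReal (a x * Real.exp (s * a x)) ∂(μ : Measure X) := by
    intro s μ
    rw [lintegral_expMultiplier _ _ ham.ennreal_ofReal]
    refine lintegral_congr fun x => ?_
    rw [← ENNReal.ofReal_mul (Real.exp_pos _).le, mul_comm]
    rfl
  -- Let A(s) be the integral of the weight of e^(s a) μ. Projective invariance multiplies A(0) and
  -- the integral defining -A'(0) by the same constant, so -A'(s) / A(s) equals the integral of a
  -- against `meanMeasure Q` for every s.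
  have key := lintegral_comp_expMass ham ha hC' hasDerivAt_max_one_sub_sq
    (g := fun z => 2 * max (1 - z) 0) (fun z => mul_nonneg zero_le_two (le_max_right _ _))
    (fun z => sq_nonneg _) (by fun_prop) (by fun_prop) Q (l := l)
    (by
      simp_rw [expMass_zero]
      exact htop) (by
      intro s hs
      obtain ⟨c, hc⟩ := hc s hs
      have e1 := lintegral_comp_expMultiplier hc
        (F := fun μ => massSlope μ * ∫⁻ x, ENNReal.ofReal (a x) ∂(μ : Measure X))
        (measurable_massSlope.mul (FiniteMeasure.measurable_lintegral ham.ennreal_ofReal))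
      have e2 := lintegral_comp_expMultiplier hc (F := massWeight) measurable_massWeight
      have e3 := lintegral_meanMeasure Q ham.ennreal_ofReal
      simp only [massSlope, massWeight, hmass, hlin] at e1 e2 e3
      have h0' : ∫⁻ μ : FiniteMeasure X,
        ENNReal.ofReal (max (1 - ((μ : Measure X) univ).toReal) 0 ^ 2) ∂Q ≠ 0 := h0
      have htop' : ∫⁻ μ : FiniteMeasure X,
        ENNReal.ofReal (max (1 - ((μ : Measure X) univ).toReal) 0 ^ 2) ∂Q ≠ ⊤ := htop
      rw [e1, e2, hl, e3, mul_left_comm, mul_right_comm, ENNReal.inv_mul_cancel h0' htop',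
        one_mul])
  -- The factor at s = 1 is A(1) / A(0).
  obtain ⟨c, hc⟩ := hc 1 zero_le_one
  have e2 := lintegral_comp_expMultiplier hc (F := massWeight) measurable_massWeight
  have e4 : ∫⁻ μ, massWeight (expMultiplier ((1 : ℝ) • a) μ) ∂Q = (∫⁻ μ, massWeight μ ∂Q) *
      ENNReal.ofReal (Real.exp (-l)) := by
    simp only [massWeight, hmass]
    simpa only [expMass_zero] using key
  rw [e4, mul_comm] at e2
  have e5 := (ENNReal.mul_left_inj h0 htop).1 e2
  rw [one_smul] at hc
  rw [hc, ← e5, hlr]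

end Projective

/-! ### Smooth test functions -/

section SmoothTest

open Filter

variable {d : ℕ} {M : Type*} [TopologicalSpace M] [ChartedSpace (EuclideanSpace ℝ (Fin d)) M]
  [IsManifold (𝓡 d) ∞ M] [T2Space M] [SecondCountableTopology M]

variable (d M) in
theorem exists_smooth_cutoff : ∃ χ : ℕ → C_c(M, ℝ),
    (∀ n, ContMDiff (𝓡 d) 𝓘(ℝ, ℝ) ∞ (χ n)) ∧ (∀ n x, χ n x ∈ Icc (0 : ℝ) 1) ∧
    ∀ x, ∀ᶠ n in atTop, χ n x = 1 := by
  have := ChartedSpace.locallyCompactSpace (EuclideanSpace ℝ (Fin d)) M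
  have := sigmaCompactSpace_of_locallyCompact_secondCountable (X := M)
  let K := CompactExhaustion.choice M
  have h : ∀ n, ∃ f : C_c(M, ℝ), ContMDiff (𝓡 d) 𝓘(ℝ, ℝ) ∞ f ∧
      (∀ x, f x ∈ Icc (0 : ℝ) 1) ∧ ∀ x ∈ K n, f x = 1 := by
    intro n
    obtain ⟨f, h0, h1, hf⟩ := exists_contMDiffMap_zero_one_of_isClosed (n := ⊤) (𝓡 d)
      (s := (interior (K (n + 1)))ᶜ) (t := K n) isOpen_interior.isClosed_compl
      (K.isCompact n).isClosed
      (disjoint_compl_left_iff_subset.2 (K.subset_interior_succ n))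
    have hc : HasCompactSupport f := HasCompactSupport.intro (K.isCompact (n + 1)) fun x hx =>
      h0 fun hx' => hx (interior_subset hx')
    exact ⟨⟨⟨f, f.contMDiff.continuous⟩, hc⟩, f.contMDiff, hf, fun x hx => h1 hx⟩
  choose χ hχ h01 h1 using h
  refine ⟨χ, hχ, h01, fun x => ?_⟩
  obtain ⟨n, hn⟩ := K.exists_mem x
  filter_upwards [eventually_ge_atTop n] with m hm
  exact h1 m x (K.subset hm hn)

variable [MeasurableSpace M] [BorelSpace M]

/-- Measures on the finite measures on a manifold are determined by their exponential functionals
at nonnegative smooth functions with compact support. -/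
theorem ext_of_lintegral_expNeg_expMass_smooth {Q Q' : Measure (FiniteMeasure M)}
    (hQ : ∫⁻ μ : FiniteMeasure M, expNeg ((μ : Measure M) univ) ∂Q ≠ ⊤)
    (heq : ∀ a : C_c(M, ℝ), ContMDiff (𝓡 d) 𝓘(ℝ, ℝ) ∞ a → (∀ x, 0 ≤ a x) →
      ∫⁻ μ, expNeg (expMass a 1 μ) ∂Q = ∫⁻ μ, expNeg (expMass a 1 μ) ∂Q') : Q = Q' := by
  have := ChartedSpace.locallyCompactSpace (EuclideanSpace ℝ (Fin d)) M
  have := sigmaCompactSpace_of_locallyCompact_secondCountable (X := M)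
  apply expTilt_injective
  have h00 := heq 0 contMDiff_const (fun _ => le_rfl)
  have e0 : ∀ Q : Measure (FiniteMeasure M),
      ∫⁻ μ, expNeg (expMass (0 : C_c(M, ℝ)) 1 μ) ∂Q =
      ∫⁻ μ : FiniteMeasure M, expNeg ((μ : Measure M) univ) ∂Q := fun Q => by simp [expMass]
  rw [e0, e0] at h00
  have := isFiniteMeasure_expTilt hQ
  have := isFiniteMeasure_expTilt (Q := Q') (h00 ▸ hQ)
  refine FiniteMeasure.ext_of_laplace
    {h | ∃ f : C_c(M, ℝ), ContMDiff (𝓡 d) 𝓘(ℝ, ℝ) ∞ f ∧ (∀ x, 0 ≤ f x) ∧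
      h = fun x => ENNReal.ofReal (f x)}
    ⟨0, contMDiff_const, fun _ => le_rfl, by ext; simp⟩ ?_ ?_ ?_ {U | IsOpen U}
    (BorelSpace.measurable_eq.trans rfl) isPiSystem_isOpen isOpen_univ ?_ ?_
  · rintro _ ⟨f, hf, h0, rfl⟩ _ ⟨f', hf', h0', rfl⟩
    refine ⟨f + f', hf.add hf', fun x => add_nonneg (h0 x) (h0' x), ?_⟩
    ext x
    exact (ENNReal.ofReal_add (h0 x) (h0' x)).symm
  · rintro _ ⟨f, hf, h0, rfl⟩
    exact f.continuous.measurable.ennreal_ofReal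
  · rintro _ ⟨f, hf, h0, rfl⟩
    obtain ⟨C, hC⟩ := exists_forall_abs_le f
    exact ⟨C.toNNReal, fun x => ENNReal.ofReal_le_ofReal ((le_abs_self _).trans (hC x))⟩
  · intro U hU
    -- With f smooth, nonnegative and nonzero exactly on U, the functions χ n (1 - e^(-n f)) are
    -- admissible and tend pointwise to the indicator of U.
    obtain ⟨χ, hχ, h01, h1⟩ := exists_smooth_cutoff d M
    obtain ⟨f, hfU, hf, hf0⟩ := IsOpen.exists_contMDiff_support_eq (n := ⊤) (𝓡 d) hU
    have hg : ∀ n : ℕ, ContDiff ℝ ∞ fun y : ℝ => 1 - Real.exp (-(n * y)) := fun n => by fun_prop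
    have hgf : ∀ n : ℕ, ContMDiff (𝓡 d) 𝓘(ℝ, ℝ) ∞
        fun x => χ n x * (1 - Real.exp (-(n * f x))) := fun n =>
      (hχ n).mul ((hg n).contMDiff.comp hf)
    have hb0 : ∀ (n : ℕ) x, 0 ≤ 1 - Real.exp (-(n * f x)) := fun n x => by
      rw [sub_nonneg, Real.exp_le_one_iff]
      exact neg_nonpos.2 (mul_nonneg n.cast_nonneg (hf0 x))
    have hb1 : ∀ (n : ℕ) x, 1 - Real.exp (-(n * f x)) ≤ 1 := fun n x => by
      linarith [Real.exp_pos (-(n * f x))]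
    refine ⟨fun n x => ENNReal.ofReal (χ n x * (1 - Real.exp (-(n * f x)))), fun n => ?_,
      fun n x => ?_, fun x => ?_⟩
    · exact ⟨⟨⟨_, (hgf n).continuous⟩, (χ n).hasCompactSupport.mul_right⟩, hgf n,
        fun x => mul_nonneg (h01 n x).1 (hb0 n x), rfl⟩
    · rw [ENNReal.ofReal_le_one]
      exact mul_le_one₀ (h01 n x).2 (hb0 n x) (hb1 n x)
    · have hx : Tendsto (fun n => χ n x) atTop (𝓝 1) :=
        tendsto_const_nhds.congr' ((h1 x).mono fun n hn => hn.symm)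
      by_cases hxU : x ∈ U
      · rw [indicator_of_mem hxU]
        have hpos : 0 < f x := lt_of_le_of_ne (hf0 x) (Ne.symm (by rwa [← hfU] at hxU))
        have h2 : Tendsto (fun n : ℕ => Real.exp (-(n * f x))) atTop (𝓝 0) :=
          Real.tendsto_exp_neg_atTop_nhds_zero.comp
            (tendsto_natCast_atTop_atTop.atTop_mul_const hpos)
        have h3 := hx.mul (h2.const_sub 1)
        simpa [Function.comp_def] using (ENNReal.continuous_ofReal.tendsto _).comp h3
      · rw [indicator_of_notMem hxU]
        have hz : f x = 0 := by
          rw [← hfU] at hxU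
          simpa using hxU
        simp [hz]
  · rintro _ ⟨f, hf, h0, rfl⟩
    obtain ⟨C, hC⟩ := exists_forall_abs_le f
    have hC' : ∀ x, ENNReal.ofReal (f x) ≤ C.toNNReal := fun x =>
      ENNReal.ofReal_le_ofReal ((le_abs_self _).trans (hC x))
    have hfm : Measurable (f : M → ℝ) := f.continuous.measurable
    rw [lintegral_expNeg_expTilt Q hfm.ennreal_ofReal hC',
      lintegral_expNeg_expTilt Q' hfm.ennreal_ofReal hC']
    simp_rw [ENNReal.toReal_ofReal (h0 _)]
    -- The test class is stable under f ↦ log(1 + f): smoothness uses f ≥ 0, and log 1 = 0 keeps the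
    -- support compact.
    have hs : ContMDiff (𝓡 d) 𝓘(ℝ, ℝ) ∞ fun x => Real.log (1 + f x) := fun x =>
      (ContDiffAt.contMDiffAt (f := fun y : ℝ => Real.log (1 + y)) (x := f x)
        ((contDiffAt_const.add contDiffAt_id).log (by have := h0 x; simp only [id]; positivity))).comp x
        (hf x)
    have hcs : HasCompactSupport fun x => Real.log (1 + f x) :=
      f.hasCompactSupport.comp_left (g := fun y : ℝ => Real.log (1 + y)) (by simp)
    exact heq ⟨⟨_, hs.continuous⟩, hcs⟩ hs fun x => Real.log_nonneg (by linarith [h0 x])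

end SmoothTest

/-! ### Projectively invariant measures are multiplicative Lebesgue measures -/

-- Constants need not have compact support; scalings of the total mass are reached as limits of
-- cut-off multipliers, by dominated convergence.
open Filter in
theorem tendsto_expMass_smul {X : Type*} [TopologicalSpace X] [MeasurableSpace X] [BorelSpace X]
    {χ : ℕ → C_c(X, ℝ)} (h01 : ∀ n x, χ n x ∈ Icc (0 : ℝ) 1)
    (h1 : ∀ x, ∀ᶠ n in atTop, χ n x = 1) (r : ℝ) (μ : FiniteMeasure X) :
    Tendsto (fun n => expMass (r • χ n) 1 μ) atTop
      (𝓝 (ENNReal.ofReal (Real.exp r) * (μ : Measure X) univ)) := by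
  rw [← lintegral_const]
  refine tendsto_lintegral_of_dominated_convergence (fun _ => ENNReal.ofReal (Real.exp |r|))
    (fun n => ?_) (fun n => .of_forall fun x => ?_) ?_ (.of_forall fun x => ?_)
  · have : Measurable (χ n : X → ℝ) := (χ n).continuous.measurable
    change Measurable fun x => ENNReal.ofReal (Real.exp (1 * (r * χ n x)))
    fun_prop
  · refine ENNReal.ofReal_le_ofReal (Real.exp_le_exp.2 ?_)
    rw [one_mul]
    calc r * χ n x ≤ |r * χ n x| := le_abs_self _
      _ = |r| * χ n x := by rw [abs_mul, abs_of_nonneg (h01 n x).1]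
      _ ≤ |r| := mul_le_of_le_one_right (abs_nonneg r) (h01 n x).2
  · rw [lintegral_const]
    exact ENNReal.mul_ne_top ENNReal.ofReal_ne_top (measure_ne_top _ _)
  · refine tendsto_const_nhds.congr' ((h1 x).mono fun n hn => ?_)
    have : (r • χ n) x = r * χ n x := rfl
    simp [this, hn]

theorem massWeight_eq_zero_iff {X : Type*} [MeasurableSpace X] {μ : FiniteMeasure X} :
    massWeight μ = 0 ↔ 1 ≤ (μ : Measure X) univ := by
  have h : (1 : ℝ) ≤ ((μ : Measure X) univ).toReal ↔ 1 ≤ (μ : Measure X) univ := by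
    rw [← ENNReal.toReal_one, ENNReal.toReal_le_toReal ENNReal.one_ne_top (measure_ne_top _ _)]
  rw [← h, massWeight, ENNReal.ofReal_eq_zero]
  constructor
  · intro h1
    have h2 := pow_eq_zero_iff two_ne_zero |>.1 (le_antisymm h1 (sq_nonneg _))
    linarith [le_max_left (1 - ((μ : Measure X) univ).toReal) 0]
  · intro h1
    rw [max_eq_right (by linarith)]
    simp

/-- The multipliers a and -a cancel, so evaluation on the unit ball gives c * c' = 1. -/
theorem multiplier_factor_ne {X : Type*} [TopologicalSpace X] [MeasurableSpace X] [BorelSpace X]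
    {Q : Measure (FiniteMeasure X)} (hQ : Q (massBall X 1) = 1) {a : C_c(X, ℝ)} {c c' : ℝ≥0∞}
    (ha : Q.map (expMultiplier a) = c • Q) (ha' : Q.map (expMultiplier (-a)) = c' • Q) :
    c ≠ 0 ∧ c ≠ ⊤ := by
  have h := map_expMultiplier_add ha ha'
  have e : expMultiplier (a + -a) = id := funext fun μ => by
    rw [add_neg_cancel, expMultiplier_zero, id]
  rw [e, Measure.map_id] at h
  have h1 := congrArg (fun P => P (massBall X 1)) h
  simp only [Measure.smul_apply, smul_eq_mul, hQ, mul_one] at h1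
  constructor
  · rintro rfl
    simp at h1
  · rintro rfl
    rcases eq_or_ne c' 0 with h2 | h2
    · simp [h2] at h1
    · rw [ENNReal.top_mul h2] at h1
      exact ENNReal.one_ne_top h1

theorem invariantUnderShift_smul_iff {X : Type*} [MeasurableSpace X]
    {Q : Measure (FiniteMeasure X)} {c : ℝ≥0∞} (h0 : c ≠ 0) (h1 : c ≠ ⊤) (ψ : X → X) :
    InvariantUnderShift (c • Q) ψ ↔ InvariantUnderShift Q ψ := by
  unfold InvariantUnderShift
  rw [Measure.map_smul]
  refine ⟨fun h => ?_, fun h => by rw [h]⟩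
  have h2 := congrArg (fun P => c⁻¹ • P) h
  simpa only [smul_smul, ENNReal.inv_mul_cancel h0 h1, one_smul] using h2

-- Exponential decay beats polynomial growth: the second factor is at most (2 (n + 1)) ^ k for a
-- natural number k ≥ θ.
open Filter in
theorem tsum_exp_neg_mul_exp_mul_log_ne_top (θ : ℝ) :
    ∑' n : ℕ, ENNReal.ofReal (Real.exp (-n)) *
      ENNReal.ofReal (Real.exp (Real.log (2 * (n + 1)) * θ)) ≠ ⊤ := by
  obtain ⟨k, hk⟩ := exists_nat_ge θ
  have h1 := (summable_nat_add_iff 1).2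
    (Real.summable_pow_mul_exp_neg_nat_mul k (r := 1) one_pos)
  have h2 := (h1.mul_left (2 ^ k * Real.exp 1)).tsum_ofReal_ne_top
  refine ne_top_of_le_ne_top h2 (ENNReal.tsum_le_tsum fun n => ?_)
  rw [← ENNReal.ofReal_mul (Real.exp_pos _).le]
  refine ENNReal.ofReal_le_ofReal ?_
  have hn : (1 : ℝ) ≤ 2 * (n + 1) := by
    have : (0 : ℝ) ≤ n := n.cast_nonneg
    linarith
  have h3 : Real.exp (Real.log (2 * (n + 1)) * θ) ≤ (2 * (n + 1)) ^ k := by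
    rw [← Real.rpow_natCast, Real.rpow_def_of_pos (by linarith)]
    exact Real.exp_le_exp.2 (mul_le_mul_of_nonneg_left hk (Real.log_nonneg hn))
  calc Real.exp (-n) * Real.exp (Real.log (2 * (n + 1)) * θ)
      ≤ Real.exp (-n) * (2 * (n + 1)) ^ k := by gcongr
    _ = 2 ^ k * Real.exp 1 * (((n + 1 : ℕ) : ℝ) ^ k * Real.exp (-1 * ((n + 1 : ℕ) : ℝ))) := by
        have : Real.exp (-n) = Real.exp 1 * Real.exp (-1 * ((n + 1 : ℕ) : ℝ)) := by
          rw [← Real.exp_add]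
          push_cast
          ring_nf
        rw [this, mul_pow]
        push_cast
        ring

/-- The term n = ⌊z⌋ suffices: z / (2 (n + 1)) ≤ 1 / 2, so the squared weight is at least 1 / 4,
which the factor 4 compensates, and e^(-z) ≤ e^(-n). -/
theorem expNeg_le_tsum {z : ℝ≥0∞} (hz : z ≠ ⊤) :
    expNeg z ≤ ∑' n : ℕ, 4 * (ENNReal.ofReal (Real.exp (-n)) *
      ENNReal.ofReal (max (1 - (ENNReal.ofReal (Real.exp (-Real.log (2 * (n + 1)))) * z).toReal)
        0 ^ 2)) := by
  lift z to ℝ≥0 using hz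
  let n := ⌊z⌋₊
  refine le_trans ?_ (ENNReal.le_tsum n)
  have h1 : (n : ℝ) ≤ z := Nat.floor_le z.2
  have h2 : (z : ℝ) < n + 1 := Nat.lt_floor_add_one z
  have hp : (0 : ℝ) < 2 * (n + 1) := by
    have : (0 : ℝ) ≤ n := n.cast_nonneg
    linarith
  rw [ENNReal.toReal_mul, ENNReal.toReal_ofReal (Real.exp_pos _).le,
    Real.exp_neg (Real.log _), Real.exp_log hp, ENNReal.coe_toReal, ← ENNReal.ofReal_mul (Real.exp_pos _).le,
    ← ENNReal.ofReal_ofNat, ← ENNReal.ofReal_mul (by norm_num), expNeg, ENNReal.coe_toReal]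
  refine ENNReal.ofReal_le_ofReal ?_
  have h3 : (1 / 2 : ℝ) ≤ max (1 - (2 * ((n : ℝ) + 1))⁻¹ * z) 0 := by
    refine le_max_of_le_left ?_
    have : (2 * ((n : ℝ) + 1))⁻¹ * z ≤ 1 / 2 := by
      rw [inv_mul_le_iff₀ hp]
      linarith
    linarith
  have h4 : (1 / 4 : ℝ) ≤ max (1 - (2 * ((n : ℝ) + 1))⁻¹ * z) 0 ^ 2 := by
    nlinarith
  have h5 : Real.exp (-z) ≤ Real.exp (-n) := Real.exp_le_exp.2 (by linarith)
  nlinarith [Real.exp_pos (-(n : ℝ))]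

theorem contMDiff_smul_of_contMDiff {d : ℕ} {M : Type*} [TopologicalSpace M]
    [ChartedSpace (EuclideanSpace ℝ (Fin d)) M] {a : C_c(M, ℝ)}
    (ha : ContMDiff (𝓡 d) 𝓘(ℝ, ℝ) ∞ a) (r : ℝ) : ContMDiff (𝓡 d) 𝓘(ℝ, ℝ) ∞ (r • a) := by
  have h : ContMDiff (𝓡 d) 𝓘(ℝ, ℝ) ∞ fun x => r * a x := (contMDiff_const (c := r)).mul ha
  exact h

theorem exists_factor_ne {d : ℕ} {M : Type*} [TopologicalSpace M]
    [ChartedSpace (EuclideanSpace ℝ (Fin d)) M] [MeasurableSpace M] [BorelSpace M]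
    {Q : Measure (FiniteMeasure M)} (h1 : Q (massBall M 1) = 1)
    (hc : ∀ a : C_c(M, ℝ), ContMDiff (𝓡 d) 𝓘(ℝ, ℝ) ∞ a →
      ∃ c : ℝ≥0∞, Q.map (expMultiplier a) = c • Q)
    {a : C_c(M, ℝ)} (ha : ContMDiff (𝓡 d) 𝓘(ℝ, ℝ) ∞ a) :
    ∃ c : ℝ≥0∞, c ≠ 0 ∧ c ≠ ⊤ ∧ Q.map (expMultiplier a) = c • Q := by
  obtain ⟨c, hca⟩ := hc a ha
  obtain ⟨c', hca'⟩ := hc (-a) ha.neg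
  have h := multiplier_factor_ne h1 hca hca'
  exact ⟨c, h.1, h.2, hca⟩

/-! ### Growth of a projectively invariant measure and its identification -/

section Characterization

open Filter

variable {d : ℕ} {M : Type*} [TopologicalSpace M] [ChartedSpace (EuclideanSpace ℝ (Fin d)) M]
  [IsManifold (𝓡 d) ∞ M] [T2Space M] [SecondCountableTopology M] [MeasurableSpace M] [BorelSpace M]
  {Q : Measure (FiniteMeasure M)}

/-- The sets {μ(e^(-k χ n)) ≤ 1} are preimages of the unit ball under multipliers, hence of finite
measure. They cover the space: if k is at least the total mass of μ, then e^(-k) μ(M) < 1, and this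
is the limit of μ(e^(-k χ n)). -/
theorem sigmaFinite_of_projective (h1 : Q (massBall M 1) = 1)
    (hc : ∀ a : C_c(M, ℝ), ContMDiff (𝓡 d) 𝓘(ℝ, ℝ) ∞ a →
      ∃ c : ℝ≥0∞, Q.map (expMultiplier a) = c • Q) : SigmaFinite Q := by
  obtain ⟨χ, hχ, h01, hχ1⟩ := exists_smooth_cutoff d M
  refine Measure.sigmaFinite_of_countable
    (S := range fun p : ℕ × ℕ => expMultiplier (-(p.2 : ℝ) • χ p.1) ⁻¹' massBall M 1)
    (countable_range _) ?_ ?_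
  · rintro _ ⟨p, rfl⟩
    obtain ⟨c, hc0, hct, hca⟩ := exists_factor_ne h1 hc
      (contMDiff_smul_of_contMDiff (hχ p.1) (-(p.2 : ℝ)))
    rw [← Measure.map_apply (measurable_expMultiplier _) (measurableSet_massBall 1), hca,
      Measure.smul_apply, h1]
    simpa using hct.lt_top
  · refine eq_univ_of_forall fun μ => ?_
    obtain ⟨k, hk⟩ := exists_nat_ge ((μ : Measure M) univ).toReal
    have hlt : ENNReal.ofReal (Real.exp (-k)) * (μ : Measure M) univ < 1 := by
      rw [← ENNReal.ofReal_toReal (measure_ne_top (μ : Measure M) univ),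
        ← ENNReal.ofReal_mul (Real.exp_pos _).le, ENNReal.ofReal_lt_one, Real.exp_neg,
        inv_mul_lt_iff₀ (Real.exp_pos _), mul_one]
      linarith [Real.add_one_le_exp (k : ℝ)]
    obtain ⟨n, hn⟩ := ((tendsto_expMass_smul h01 hχ1 (-k) μ).eventually (gt_mem_nhds hlt)).exists
    refine mem_sUnion.2 ⟨_, mem_range_self (n, k), ?_⟩
    rw [mem_preimage, mem_massBall_iff, expMultiplier_apply_univ, ENNReal.coe_one]
    exact hn.le

/-- If the weight vanished almost everywhere, so would the weight of e^(-χ n) μ by projective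
invariance. In the limit e^(-1) μ(M) ≥ 1 almost everywhere, and the unit ball would be null. -/
theorem lintegral_massWeight_ne_zero (h1 : Q (massBall M 1) = 1)
    (hc : ∀ a : C_c(M, ℝ), ContMDiff (𝓡 d) 𝓘(ℝ, ℝ) ∞ a →
      ∃ c : ℝ≥0∞, Q.map (expMultiplier a) = c • Q) : ∫⁻ μ, massWeight μ ∂Q ≠ 0 := by
  intro h0
  obtain ⟨χ, hχ, h01, hχ1⟩ := exists_smooth_cutoff d M
  have h : ∀ n, ∀ᵐ μ ∂Q, 1 ≤ expMass ((-1 : ℝ) • χ n) 1 μ := by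
    intro n
    obtain ⟨c, hca⟩ := hc _ (contMDiff_smul_of_contMDiff (hχ n) (-1))
    have e := lintegral_comp_expMultiplier hca measurable_massWeight
    have hm : Measurable fun μ => massWeight (expMultiplier ((-1 : ℝ) • χ n) μ) :=
      measurable_massWeight.comp (measurable_expMultiplier _)
    rw [h0, mul_zero, lintegral_eq_zero_iff hm] at e
    filter_upwards [e] with μ hμ
    rw [← expMultiplier_apply_univ]
    exact massWeight_eq_zero_iff.1 hμ
  have h2 : ∀ᵐ μ ∂Q, μ ∉ massBall M 1 := by
    filter_upwards [ae_all_iff.2 h] with μ hμ hμ1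
    have h3 := ge_of_tendsto' (tendsto_expMass_smul h01 hχ1 (-1) μ) hμ
    rw [mem_massBall_iff, ENNReal.coe_one] at hμ1
    have h4 : ENNReal.ofReal (Real.exp (-1)) * (μ : Measure M) univ ≤
        ENNReal.ofReal (Real.exp (-1)) := mul_le_of_le_one_right' hμ1
    have h5 : ENNReal.ofReal (Real.exp (-1)) < 1 := by
      rw [ENNReal.ofReal_lt_one, Real.exp_lt_one_iff]
      norm_num
    exact absurd (h3.trans h4) (not_le.2 h5)
  rw [ae_iff] at h2
  simp only [not_not] at h2
  exact one_ne_zero (h1.symm.trans h2)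

/-- The factor of e^(-s χ n) is the inverse of that of e^(s χ n), hence at most e^(s m(M)) with m
the mean measure; Fatou's lemma lets n tend to infinity. In terms of the radius e^s this is
polynomial growth of Q. -/
theorem lintegral_massWeight_scale_le [SFinite Q] (h1 : Q (massBall M 1) = 1)
    (hc : ∀ a : C_c(M, ℝ), ContMDiff (𝓡 d) 𝓘(ℝ, ℝ) ∞ a →
      ∃ c : ℝ≥0∞, Q.map (expMultiplier a) = c • Q) {s : ℝ} (hs : 0 ≤ s) :
    ∫⁻ μ : FiniteMeasure M, ENNReal.ofReal
        (max (1 - (ENNReal.ofReal (Real.exp (-s)) * (μ : Measure M) univ).toReal) 0 ^ 2) ∂Q ≤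
      ENNReal.ofReal (Real.exp (s * (meanMeasure Q).real univ)) := by
  have hA0 := lintegral_massWeight_ne_zero h1 hc
  have hfm := isFiniteMeasure_meanMeasure Q hA0 (by simp [h1])
  obtain ⟨χ, hχ, h01, hχ1⟩ := exists_smooth_cutoff d M
  have hlim : ∀ μ : FiniteMeasure M,
      Tendsto (fun n => massWeight (expMultiplier (-(s • χ n)) μ)) atTop
      (𝓝 (ENNReal.ofReal
        (max (1 - (ENNReal.ofReal (Real.exp (-s)) * (μ : Measure M) univ).toReal) 0 ^ 2))) := by
    intro μ
    have e : ∀ n, -(s • χ n) = (-s) • χ n := fun n => by ext x; simp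
    simp_rw [massWeight, expMultiplier_apply_univ, e]
    have h := (ENNReal.tendsto_toReal (ENNReal.mul_ne_top (ENNReal.ofReal_ne_top (r := Real.exp (-s)))
      (measure_ne_top (μ : Measure M) univ))).comp (tendsto_expMass_smul h01 hχ1 (-s) μ)
    have hcont : Continuous fun z : ℝ => ENNReal.ofReal (max (1 - z) 0 ^ 2) :=
      ENNReal.continuous_ofReal.comp (by fun_prop)
    exact (hcont.tendsto _).comp h
  have hle : ∀ n, ∫⁻ μ, massWeight (expMultiplier (-(s • χ n)) μ) ∂Q ≤
      ENNReal.ofReal (Real.exp (s * (meanMeasure Q).real univ)) := by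
    intro n
    have hpos : ∀ x, 0 ≤ (s • χ n) x := fun x => mul_nonneg hs (h01 n x).1
    have e1 := map_expMultiplier_eq_of_projective Q hA0 (by simp [h1]) hpos fun t _ =>
      hc _ (contMDiff_smul_of_contMDiff (contMDiff_smul_of_contMDiff (hχ n) s) t)
    have e2 := map_expMultiplier_neg (by simp [Real.exp_pos]) ENNReal.ofReal_ne_top e1
    rw [lintegral_comp_expMultiplier e2 measurable_massWeight,
      ← ENNReal.ofReal_inv_of_pos (Real.exp_pos _), ← Real.exp_neg, neg_neg]
    have hI : ∫ x, (s • χ n) x ∂meanMeasure Q ≤ s * (meanMeasure Q).real univ := by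
      have hb : ∀ x, (s • χ n) x ≤ s := fun x => mul_le_of_le_one_right hs (h01 n x).2
      have hint : Integrable (s • χ n) (meanMeasure Q) :=
        integrable_of_abs_le (f := ⇑(s • χ n)) (s • χ n).continuous.measurable
          (fun x => by rw [abs_of_nonneg (hpos x)]; exact hb x)
          (⟨meanMeasure Q, hfm⟩ : FiniteMeasure M)
      refine (integral_mono hint (integrable_const s) hb).trans_eq ?_
      rw [integral_const, smul_eq_mul, mul_comm]
    calc _ ≤ ENNReal.ofReal (Real.exp (s * (meanMeasure Q).real univ)) * 1 := by
          gcongr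
          exact (lintegral_massWeight_le Q).trans_eq h1
      _ = _ := mul_one _
  calc _ = ∫⁻ μ, liminf (fun n => massWeight (expMultiplier (-(s • χ n)) μ)) atTop ∂Q :=
        lintegral_congr fun μ => (hlim μ).liminf_eq.symm
    _ ≤ liminf (fun n => ∫⁻ μ, massWeight (expMultiplier (-(s • χ n)) μ) ∂Q) atTop :=
        lintegral_liminf_le fun n => measurable_massWeight.comp (measurable_expMultiplier _)
    _ ≤ _ := liminf_le_of_le (by isBoundedDefault) fun b hb =>
        (hb.exists.choose_spec).trans (hle _)

/-- Integrating the series of `expNeg_le_tsum`, the polynomial growth of Q is summed against e^(-n).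
-/
theorem lintegral_expNeg_mass_ne_top [SFinite Q] (h1 : Q (massBall M 1) = 1)
    (hc : ∀ a : C_c(M, ℝ), ContMDiff (𝓡 d) 𝓘(ℝ, ℝ) ∞ a →
      ∃ c : ℝ≥0∞, Q.map (expMultiplier a) = c • Q) :
    ∫⁻ μ : FiniteMeasure M, expNeg ((μ : Measure M) univ) ∂Q ≠ ⊤ := by
  have hmass := measurable_mass (X := M)
  have hm : ∀ n : ℕ, Measurable fun μ : FiniteMeasure M => ENNReal.ofReal
      (max (1 - (ENNReal.ofReal (Real.exp (-Real.log (2 * (n + 1)))) *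
        (μ : Measure M) univ).toReal) 0 ^ 2) := fun n => by fun_prop
  have hS := tsum_exp_neg_mul_exp_mul_log_ne_top ((meanMeasure Q).real univ)
  refine ne_top_of_le_ne_top (ENNReal.mul_ne_top (a := 4) (by simp) hS) ?_
  refine (lintegral_mono fun μ : FiniteMeasure M => expNeg_le_tsum (measure_ne_top (μ : Measure M) univ)).trans ?_
  rw [lintegral_tsum fun n => (((hm n).const_mul _).const_mul _).aemeasurable,
    ← ENNReal.tsum_mul_left]
  refine ENNReal.tsum_le_tsum fun n => ?_
  rw [lintegral_const_mul _ ((hm n).const_mul _), lintegral_const_mul _ (hm n)]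
  gcongr
  refine lintegral_massWeight_scale_le h1 hc (Real.log_nonneg ?_)
  have : (0 : ℝ) ≤ n := n.cast_nonneg
  linarith

/-- A measure that gives mass one to the unit ball, does not charge the zero measure and is
projectively invariant under smooth multipliers is a multiplicative Lebesgue measure. -/
theorem exists_eq_smul_multLebesgue (h0 : Q (massBall M 0) = 0) (h1 : Q (massBall M 1) = 1)
    (hc : ∀ a : C_c(M, ℝ), ContMDiff (𝓡 d) 𝓘(ℝ, ℝ) ∞ a →
      ∃ c : ℝ≥0∞, Q.map (expMultiplier a) = c • Q) :
    ∃ (θ : ℝ) (ν : ProbabilityMeasure M), 0 < θ ∧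
      Q = ENNReal.ofReal (Real.Gamma (θ + 1)) • multLebesgue θ ν := by
  have := sigmaFinite_of_projective h1 hc
  have hA0 := lintegral_massWeight_ne_zero h1 hc
  have hB : Q (massBall M 1) ≠ ⊤ := by simp [h1]
  have hfm := isFiniteMeasure_meanMeasure Q hA0 hB
  have hm0 := meanMeasure_univ_ne_zero Q hA0 hB h0
  have hmt : meanMeasure Q univ ≠ ⊤ := measure_ne_top _ _
  let θ : ℝ := (meanMeasure Q univ).toReal
  have hθ : 0 < θ := ENNReal.toReal_pos hm0 hmt
  let ν : ProbabilityMeasure M := ⟨(meanMeasure Q univ)⁻¹ • meanMeasure Q,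
    ⟨by rw [Measure.smul_apply, smul_eq_mul, ENNReal.inv_mul_cancel hm0 hmt]⟩⟩
  have hν : ∀ a : M → ℝ, θ * ∫ x, a x ∂(ν : Measure M) = ∫ x, a x ∂meanMeasure Q := by
    intro a
    have e : ∫ x, a x ∂(ν : Measure M) =
        ((meanMeasure Q univ)⁻¹).toReal • ∫ x, a x ∂meanMeasure Q := integral_smul_measure _ _
    rw [e, ENNReal.toReal_inv, smul_eq_mul, ← mul_assoc, mul_inv_cancel₀ hθ.ne', one_mul]
  let k := ∫⁻ μ : FiniteMeasure M, expNeg ((μ : Measure M) univ) ∂Q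
  have hk : k ≠ ⊤ := lintegral_expNeg_mass_ne_top h1 hc
  -- With m = θ ν the mean measure, both sides have exponential functional k exp(-∫ a dm) at a.
  have hQ : Q = k • multLebesgue θ ν := by
    refine ext_of_lintegral_expNeg_expMass_smooth (d := d) hk fun a ha ha0 => ?_
    obtain ⟨C, hC⟩ := exists_forall_abs_le a
    rw [lintegral_smul_measure, lintegral_expNeg_expMass_multLebesgue hθ (a := ⇑a)
      a.continuous.measurable ha0 (fun x => (le_abs_self _).trans (hC x)), hν, smul_eq_mul]
    have e1 := map_expMultiplier_eq_of_projective Q hA0 hB ha0 fun t _ =>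
      hc _ (contMDiff_smul_of_contMDiff ha t)
    have e2 := lintegral_comp_expMultiplier e1 measurable_expNeg_mass
    simp_rw [expMultiplier_apply_univ] at e2
    rw [e2, mul_comm]
  refine ⟨θ, ν, hθ, ?_⟩
  have hΓ : 0 < Real.Gamma (θ + 1) := Real.Gamma_pos_of_pos (by linarith)
  -- The unit ball has mass 1 / Γ(θ + 1) under `multLebesgue θ ν`, which fixes k.
  have h2 := h1
  rw [hQ, Measure.smul_apply, multLebesgue_massBall hθ, smul_eq_mul] at h2
  simp only [NNReal.coe_one, Real.one_rpow, one_div] at h2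
  rw [ENNReal.ofReal_inv_of_pos hΓ] at h2
  have h3 : k = ENNReal.ofReal (Real.Gamma (θ + 1)) := by
    rw [← inv_inv (ENNReal.ofReal (Real.Gamma (θ + 1)))]
    exact ENNReal.eq_inv_of_mul_eq_one_left h2
  rw [← h3]
  exact hQ

end Characterization

/-! ### Natural measures on a Riemannian manifold -/

theorem ofReal_gamma_ne {θ : ℝ} (hθ : 0 < θ) :
    ENNReal.ofReal (Real.Gamma (θ + 1)) ≠ 0 ∧ ENNReal.ofReal (Real.Gamma (θ + 1)) ≠ ⊤ :=
  ⟨by simpa using Real.Gamma_pos_of_pos (by linarith), ENNReal.ofReal_ne_top⟩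

theorem gamma_smul_multLebesgue_massBall {X : Type*} [MeasurableSpace X] {θ : ℝ} (hθ : 0 < θ)
    (ν : ProbabilityMeasure X) (r : ℝ≥0) :
    (ENNReal.ofReal (Real.Gamma (θ + 1)) • multLebesgue θ ν) (massBall X r) =
      (r : ℝ≥0∞) ^ θ := by
  have hΓ : 0 < Real.Gamma (θ + 1) := Real.Gamma_pos_of_pos (by linarith)
  rw [Measure.smul_apply, multLebesgue_massBall hθ, smul_eq_mul, ← ENNReal.ofReal_mul hΓ.le,
    mul_div_cancel₀ _ hΓ.ne', ← ENNReal.ofReal_rpow_of_nonneg r.coe_nonneg hθ.le,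
    ENNReal.ofReal_coe_nnreal]

section Natural

variable {d : ℕ} {M : Type*} [TopologicalSpace M] [ChartedSpace (EuclideanSpace ℝ (Fin d)) M]
  [IsManifold (𝓡 d) ∞ M] [MeasurableSpace M]
  [SecondCountableTopology M] [Nonempty M]
  {A : Set (OpenPartialHomeomorph M (EuclideanSpace ℝ (Fin d)))} {g : RiemMetric d M}

theorem ofReal_smul_eq_riemannianVolume_iff {θ : ℝ} {ν : ProbabilityMeasure M}
    (hν : riemannianVolume g univ • (ν : Measure M) = riemannianVolume g) :
    ENNReal.ofReal θ • (ν : Measure M) = riemannianVolume g ↔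
      ENNReal.ofReal θ = riemannianVolume g univ := by
  refine ⟨fun h => ?_, fun h => by rw [h, hν]⟩
  rw [← h]
  simp

variable [BorelSpace M] [T2Space M] [ConnectedSpace M]

theorem eq_normalized_riemannianVolume (hd : d ≠ 1 ∨ CompactSpace M) (hA : IsOrientedAtlas A)
    {θ : ℝ} (hθ : 0 < θ) {ν : ProbabilityMeasure M}
    (h : ∀ ψ ∈ volumeDiffeos A g, InvariantUnderShift (multLebesgue θ ν) ψ) :
    riemannianVolume g univ • (ν : Measure M) = riemannianVolume g :=
  riemannianVolume_univ_smul_eq hd hA g ν fun ψ hψ =>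
    (invariantUnderShift_multLebesgue_iff hθ ν ψ.continuous.measurable).1 (h ψ hψ)

theorem isNaturalMeasure_iff (hd : d ≠ 1 ∨ CompactSpace M) (hA : IsOrientedAtlas A)
    (hg : riemannianVolume g univ ≠ ⊤) (Q : Measure (FiniteMeasure M)) :
    IsNaturalMeasure A g Q ↔ ∃ (θ : ℝ) (ν : ProbabilityMeasure M), 0 < θ ∧
      riemannianVolume g univ • (ν : Measure M) = riemannianVolume g ∧
      Q = ENNReal.ofReal (Real.Gamma (θ + 1)) • multLebesgue θ ν := by
  constructor
  · intro h
    obtain ⟨θ, ν, hθ, rfl⟩ := exists_eq_smul_multLebesgue h.nontrivial h.normalized h.multipliers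
    refine ⟨θ, ν, hθ, eq_normalized_riemannianVolume hd hA hθ fun ψ hψ => ?_, rfl⟩
    exact (invariantUnderShift_smul_iff (ofReal_gamma_ne hθ).1 (ofReal_gamma_ne hθ).2 ψ).1
      (h.shifts ψ hψ)
  · rintro ⟨θ, ν, hθ, hν, rfl⟩
    refine ⟨?_, ?_, fun a _ => ?_, fun ψ hψ => ?_⟩
    · rw [gamma_smul_multLebesgue_massBall hθ]
      simp [hθ]
    · rw [gamma_smul_multLebesgue_massBall hθ]
      simp
    · obtain ⟨c, hc⟩ := exists_map_expMultiplier_multLebesgue (ν := ν) hθ a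
      exact ⟨c, by rw [Measure.map_smul, hc, smul_comm]⟩
    · rw [invariantUnderShift_smul_iff (ofReal_gamma_ne hθ).1 (ofReal_gamma_ne hθ).2,
        invariantUnderShift_multLebesgue_iff hθ ν ψ.continuous.measurable]
      have h0 : riemannianVolume g univ ≠ 0 :=
        (riemannianVolume_pos_of_isOpen hA g isOpen_univ univ_nonempty).ne'
      -- Invariance of ν is inherited from the volume once ν is solved for, which needs the volume
      -- to be positive and finite.
      have e : (ν : Measure M) = (riemannianVolume g univ)⁻¹ • riemannianVolume g := by
        conv_rhs => rw [← hν, smul_smul]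
        simp [ENNReal.inv_mul_cancel h0 hg]
      rw [e, Measure.map_smul, hψ.2.2]

theorem isNaturalMeasure_and_scale_iff (hd : d ≠ 1 ∨ CompactSpace M) (hA : IsOrientedAtlas A)
    (hg : riemannianVolume g univ ≠ ⊤) (Q : Measure (FiniteMeasure M)) :
    (IsNaturalMeasure A g Q ∧
        ∀ r : ℝ≥0, Q (massBall M r) = (r : ℝ≥0∞) ^ (riemannianVolume g univ).toReal) ↔
      ∃ (θ : ℝ) (ν : ProbabilityMeasure M), 0 < θ ∧
        ENNReal.ofReal θ • (ν : Measure M) = riemannianVolume g ∧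
        Q = ENNReal.ofReal (Real.Gamma (θ + 1)) • multLebesgue θ ν := by
  rw [isNaturalMeasure_iff hd hA hg]
  constructor
  · rintro ⟨⟨θ, ν, hθ, hν, rfl⟩, hr⟩
    refine ⟨θ, ν, hθ, (ofReal_smul_eq_riemannianVolume_iff hν).2 ?_, rfl⟩
    -- A single radius other than 0 and 1 determines the exponent.
    have h2 := hr 2
    rw [gamma_smul_multLebesgue_massBall hθ, ← ENNReal.coe_rpow_of_ne_zero two_ne_zero,
      ← ENNReal.coe_rpow_of_ne_zero two_ne_zero, ENNReal.coe_inj] at h2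
    have h3 : θ = (riemannianVolume g univ).toReal :=
      (Real.rpow_right_inj two_pos (by norm_num)).1 (congrArg NNReal.toReal h2)
    rw [h3, ENNReal.ofReal_toReal hg]
  · rintro ⟨θ, ν, hθ, hν, rfl⟩
    have h : ENNReal.ofReal θ = riemannianVolume g univ := by
      rw [← hν]
      simp
    refine ⟨⟨θ, ν, hθ, h ▸ hν, rfl⟩, fun r => ?_⟩
    rw [gamma_smul_multLebesgue_massBall hθ, ← h, ENNReal.toReal_ofReal hθ.le]

end Natural

theorem propositionp :
    (∀ (X : Type*) [TopologicalSpace X] [PolishSpace X] [MeasurableSpace X] [BorelSpace X]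
      (θ : ℝ) (_ : 0 < θ) (ν : ProbabilityMeasure X)
      (G : Subgroup (Equiv.Perm X)) (_ : G ≤ shiftGroup X),
      (∀ ψ ∈ G, InvariantUnderShift (multLebesgue θ ν) ψ) ↔
        ∀ ψ ∈ G, (ν : Measure X).map ψ = ν) ∧
    (∀ (d : ℕ) (M : Type*) [TopologicalSpace M] [T2Space M] [SecondCountableTopology M]
      [ConnectedSpace M] [ChartedSpace (EuclideanSpace ℝ (Fin d)) M] [IsManifold (𝓡 d) ∞ M]
      [MeasurableSpace M] [BorelSpace M] (_ : d ≠ 1 ∨ CompactSpace M)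
      (A : Set (OpenPartialHomeomorph M (EuclideanSpace ℝ (Fin d)))) (_ : IsOrientedAtlas A)
      (g : RiemMetric d M) (_ : riemannianVolume g univ ≠ ⊤),
      (∀ (θ : ℝ) (_ : 0 < θ) (ν : ProbabilityMeasure M),
        (∀ ψ ∈ volumeDiffeos A g, InvariantUnderShift (multLebesgue θ ν) ψ) →
          riemannianVolume g univ • (ν : Measure M) = riemannianVolume g ∧
          (ENNReal.ofReal θ • (ν : Measure M) = riemannianVolume g ↔
            ENNReal.ofReal θ = riemannianVolume g univ)) ∧
      (∀ Q : Measure (FiniteMeasure M),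
        IsNaturalMeasure A g Q ↔
          ∃ (θ : ℝ) (ν : ProbabilityMeasure M), 0 < θ ∧
            riemannianVolume g univ • (ν : Measure M) = riemannianVolume g ∧
            Q = ENNReal.ofReal (Real.Gamma (θ + 1)) • multLebesgue θ ν) ∧
      (∀ Q : Measure (FiniteMeasure M),
        (IsNaturalMeasure A g Q ∧
            ∀ r : ℝ≥0, Q (massBall M r) = (r : ℝ≥0∞) ^ (riemannianVolume g univ).toReal) ↔
          ∃ (θ : ℝ) (ν : ProbabilityMeasure M), 0 < θ ∧
            ENNReal.ofReal θ • (ν : Measure M) = riemannianVolume g ∧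
            Q = ENNReal.ofReal (Real.Gamma (θ + 1)) • multLebesgue θ ν)) := by
  refine ⟨fun X _ _ _ _ θ hθ ν G hG => forall₂_congr fun ψ hψ =>
    invariantUnderShift_multLebesgue_iff hθ ν (hG hψ).1,
    fun d M _ _ _ _ _ _ _ _ hd A hA g hg => ⟨fun θ hθ ν h => ?_,
      isNaturalMeasure_iff hd hA hg, isNaturalMeasure_and_scale_iff hd hA hg⟩⟩
  have hν := eq_normalized_riemannianVolume hd hA hθ h
  exact ⟨hν, ofReal_smul_eq_riemannianVolume_iff hν⟩
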